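/- **Setting.** Let $K$ be a number field. For a place $w$ of $K$, let $|\cdot|_w$ be the normalised absolute value on the completion $K_w$ (the square of the modulus if $w$ is complex), and for $w$ finite let $O_w$ be the ring of integers of $K_w$. A *nice variety* over $K$ is a smooth, projective, geometrically integral $K$-variety. An *adelic metric* on a nice variety $V$ is a family of continuous maps $\|\cdot\|_w : TV(K_w)\to\mathbb R_{\ge 0}$, one for each place $w$, such that the restriction of $\|\cdot\|_w$ to each tangent space $T_PV$, $P\in V(K_w)$, is - an ultrametric norm with values in $|K_w|_w$ if $w$ is finite, - a euclidean norm if $w$ is real, - of the form $y\mapsto\phi_P(y,y)$ with $\phi_P$ a positive definite hermitian form if $w$ is complex, and such that there are a finite set $S$ of places containing the archimedean ones and a model $\mathcal E\to\mathcal V$ of the bundle $TV\to V$ over the ring of $S$-integers such that, for every $w\notin S$ and $P\in\mathcal V(O_w)$, the unit ball of $T_PV$ is the $O_w$-module $\mathcal E_P$. Let $V$ be a nice variety of dimension $d\ge 1$ with an adelic metric, and let $P\in V(K)$. The arithmetic degree of a subspace $F\subset T_PV$ with basis $e_1,\dots,e_r$ is $\widehat{\deg}(F)=-\sum_w\log\|e_1\wedge\dots\wedge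 e_r\|_w$, where $\bigwedge^rF$ carries the norms induced by the restrictions to $F$ of those of $T_PV$. For $x\in[0,d]$, let $m_P(x)$ be the largest $y$ such that $(x,y)$ lies in the convex hull of the set of all $(\dim F,\widehat{\deg}(F))$, where $F$ runs over the subspaces of $T_PV$. The slopes of $P$ are $\mu_i(P)=m_P(i)-m_P(i-1)$ for $1\le i\le d$, its logarithmic height is $h(P)=\widehat{\deg}(T_PV)$, and its freeness is $l(P)=d\,\mu_d(P)/h(P)$ if $\mu_d(P)>0$ and $l(P)=0$ otherwise. **Statement.** Let $\varphi:X\to Y$ be a dominant morphism of nice varieties over $K$, both equipped with adelic metrics. Let $m=\dim X$ and $n=\dim Y$, and assume $n\ge 1$. 1. There is a real constant $C$ such that, for every $P\in X(K)$ for which the linear map $T_P\varphi:T_PX\to T_{\varphi(P)}Y$ is onto, $$\mu_m(P)\le\mu_n(\varphi(P))+C,$$ and, if moreover $h(P)>0$, $$l(P)\le\frac{m\,h(\varphi(P))}{n\,h(P)}\,l(\varphi(P))+\frac{m\,C}{h(P)}.$$ 2. If $Q\in Y(K)$ is a non-critical value of $\varphi$ (that is, $T_P\varphi$ is onto for every field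 extension $L/K$ and every $L$-point $P$ of $X$ above $Q$), then $l(P)\to 0$ as $h(P)\to+\infty$ with $P$ in $X_Q(K)=\{P\in X(K)\mid\varphi(P)=Q\}$. -/

import Mathlib

open AlgebraicGeometry CategoryTheory Filter Topology
open NumberField IsDedekindDomain IsLocalRing

universe u

noncomputable section

namespace AdelicSlopes

/-! ### Nice varieties, points, tangent spaces -/

section Geometry

variable {K : Type u} [Field K] {X Y : Scheme.{u}}

attribute [local instance] MvPolynomial.gradedAlgebra in
/-- The structure morphism of the projective space of dimension `N` over `K`. -/
def projSpaceHom (K : Type u) [Field K] (N : ℕ) :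
    Proj (MvPolynomial.homogeneousSubmodule (Fin (N + 1)) K) ⟶ Spec (.of K) :=
  Proj.toSpecZero (MvPolynomial.homogeneousSubmodule (Fin (N + 1)) K) ≫
    Spec.map (CommRingCat.ofHom
      (algebraMap K (MvPolynomial.homogeneousSubmodule (Fin (N + 1)) K 0)))

attribute [local instance] MvPolynomial.gradedAlgebra in
/-- A nice variety over `K`: smooth, projective and geometrically integral. -/
structure IsNice (p : X ⟶ Spec (.of K)) : Prop where
  smooth : Smooth p
  projective : ∃ (N : ℕ) (i : X ⟶ Proj (MvPolynomial.homogeneousSubmodule (Fin (N + 1)) K)),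
    IsClosedImmersion i ∧ i ≫ projSpaceHom K N = p
  geometricallyIntegral : GeometricallyIntegral p

/-- The set `X(L)` of `L`-points of the `K`-scheme `X`. -/
def Point (p : X ⟶ Spec (.of K)) (L : Type u) [Field L] [Algebra K L] : Type u :=
  {P : Spec (.of L) ⟶ X // P ≫ p = Spec.map (CommRingCat.ofHom (algebraMap K L))}

/-- The constant functions: `K → Γ(X, U)`. -/
def const (p : X ⟶ Spec (.of K)) (U : X.Opens) : K →+* Γ(X, U) :=
  (p.appLE ⊤ U le_top).hom.comp (Scheme.ΓSpecIso (.of K)).inv.hom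

/-- The constant germs: `K → 𝒪_{X,x}`. -/
def constGerm (p : X ⟶ Spec (.of K)) (x : X) : K →+* X.presheaf.stalk x :=
  (X.presheaf.germ ⊤ x (TopologicalSpace.Opens.mem_top x)).hom.comp (const p ⊤)

theorem stalkMap_constGerm {p : X ⟶ Spec (.of K)} {q : Y ⟶ Spec (.of K)} (φ : X ⟶ Y)
    (hφ : φ ≫ q = p) (x : X) (c : K) :
    φ.stalkMap x (constGerm q (φ x) c) = constGerm p x c := by
  subst hφ
  have key : (q.appLE ⊤ ⊤ le_top ≫ Y.presheaf.germ ⊤ (φ x) trivial) ≫ φ.stalkMap x =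
      (φ ≫ q).appLE ⊤ ⊤ le_top ≫ X.presheaf.germ ⊤ x trivial := by
    have h1 := Scheme.Hom.germ_stalkMap φ ⊤ x trivial
    have h2 := Scheme.Hom.appLE_comp_appLE φ q ⊤ ⊤ ⊤ le_top le_top
    rw [Category.assoc]
    refine (congrArg (q.appLE ⊤ ⊤ le_top ≫ ·) h1).trans ?_
    rw [Scheme.Hom.app_eq_appLE]
    exact congrArg (· ≫ X.presheaf.germ ⊤ x trivial) h2
  exact congrArg (fun f => f.hom ((Scheme.ΓSpecIso (.of K)).inv.hom c)) key

namespace Point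

variable {p : X ⟶ Spec (.of K)} {q : Y ⟶ Spec (.of K)}
  {L : Type u} [Field L] [Algebra K L]

/-- The point of the underlying space of `X` over which an `L`-point lies. -/
def pt (P : Point p L) : X := P.1 (closedPoint L)

/-- The evaluation `𝒪_{X,P} → L` of germs of functions at the `L`-point `P`. -/
def eval (P : Point p L) : X.presheaf.stalk P.pt →+* L :=
  (Scheme.stalkClosedPointTo (R := .of L) P.1).hom

/-- The `L`-point of `X` defined by a `K`-point of `X`. -/
def baseChange (P : Point p K) (L : Type u) [Field L] [Algebra K L] : Point p L :=
  ⟨Spec.map (CommRingCat.ofHom (algebraMap K L)) ≫ P.1, by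
    rw [Category.assoc, P.2, ← Spec.map_comp]; rfl⟩

/-- The image of a point under a morphism of `K`-schemes. -/
def map (φ : X ⟶ Y) (hφ : φ ≫ q = p) (P : Point p L) : Point q L :=
  ⟨P.1 ≫ φ, by rw [Category.assoc, hφ, P.2]⟩

end Point

variable {p : X ⟶ Spec (.of K)} {q : Y ⟶ Spec (.of K)}
  {L : Type u} [Field L] [Algebra K L]

/-- The tangent space `T_P X` at an `L`-point `P`: the `L`-vector space of `K`-linear derivations
`𝒪_{X,P} → L`, where `L` is an `𝒪_{X,P}`-algebra through evaluation at `P`. -/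
def Tangent (P : Point p L) : Submodule L (X.presheaf.stalk P.pt → L) where
  carrier := {D | (∀ a b, D (a + b) = D a + D b) ∧
    (∀ a b, D (a * b) = P.eval a * D b + P.eval b * D a) ∧
    ∀ c : K, D (constGerm p P.pt c) = 0}
  add_mem' := by
    rintro D E ⟨h1, h2, h3⟩ ⟨k1, k2, k3⟩
    refine ⟨fun a b => ?_, fun a b => ?_, fun c => ?_⟩
    · simp only [Pi.add_apply, h1, k1]; ring
    · simp only [Pi.add_apply, h2, k2]; ring
    · simp only [Pi.add_apply, h3, k3, add_zero]
  zero_mem' := by simp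
  smul_mem' := by
    rintro l D ⟨h1, h2, h3⟩
    refine ⟨fun a b => ?_, fun a b => ?_, fun c => ?_⟩
    · simp only [Pi.smul_apply, smul_eq_mul, h1]; ring
    · simp only [Pi.smul_apply, smul_eq_mul, h2]; ring
    · simp only [Pi.smul_apply, smul_eq_mul, h3, mul_zero]

/-- The tangent map `T_P φ : T_P X → T_{φ(P)} Y`, given by `D ↦ D ∘ φ^♯`. -/
def tangentMap (φ : X ⟶ Y) (hφ : φ ≫ q = p) (P : Point p L) :
    Tangent P →ₗ[L] Tangent (P.map φ hφ) where
  toFun D := ⟨fun a => D.1 (φ.stalkMap P.pt a), by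
    obtain ⟨D, h1, h2, h3⟩ := D
    have hev : ∀ a, (P.map φ hφ).eval a = P.eval (φ.stalkMap P.pt a) := fun a => by
      have := Scheme.stalkClosedPointTo_comp (R := .of L) P.1 φ
      exact congrArg (fun f => f.hom a) this
    refine ⟨fun a b => ?_, fun a b => ?_, fun c => ?_⟩
    · exact (congrArg D (map_add _ a b)).trans (h1 _ _)
    · rw [hev, hev]
      exact (congrArg D (map_mul _ a b)).trans (h2 _ _)
    · exact (congrArg D (stalkMap_constGerm φ hφ P.pt c)).trans (h3 c)⟩
  map_add' _ _ := rfl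
  map_smul' _ _ := rfl

theorem pt_specializes (P : Point p K) : P.pt ⤳ (P.baseChange L).pt := by
  have h : (Spec.map (CommRingCat.ofHom (algebraMap K L))) (closedPoint L) = closedPoint K :=
    Subsingleton.elim (α := PrimeSpectrum K) _ _
  have : (P.baseChange L).pt = P.pt := congrArg (fun z => P.1 z) h
  rw [this]

theorem eval_baseChange (P : Point p K) (a : X.presheaf.stalk (P.baseChange L).pt) :
    (P.baseChange L).eval a =
      algebraMap K L (P.eval (X.presheaf.stalkSpecializes (pt_specializes P) a)) := by
  obtain ⟨U, hU, s, rfl⟩ := X.presheaf.exists_germ_eq a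
  have hU' : P.pt ∈ U := (pt_specializes P).mem_open U.isOpen hU
  have h1 : X.presheaf.stalkSpecializes (pt_specializes P) (X.presheaf.germ U _ hU s) =
      X.presheaf.germ U _ hU' s :=
    congrArg (fun f => f.hom s) (X.presheaf.germ_stalkSpecializes hU (pt_specializes P))
  rw [h1]
  have h2 : ∀ (x : X) (f : Spec (.of L) ⟶ X) (g : X.presheaf.stalk x ⟶ .of L)
      (_ : IsLocalHom g.hom) (_ : f = Spec.map g ≫ X.fromSpecStalk x) (hf : f (closedPoint L) ∈ U) (hx : x ∈ U),
      X.presheaf.germ U _ hf ≫ Scheme.stalkClosedPointTo (R := .of L) f =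
        X.presheaf.germ U x hx ≫ g := by
    rintro x f g hg rfl hf hx
    exact Scheme.germ_stalkClosedPointTo_Spec_fromSpecStalk (R := .of L) g U hf
  have h3 : (P.baseChange L).1 = Spec.map (Scheme.stalkClosedPointTo (R := .of K) P.1 ≫
      CommRingCat.ofHom (algebraMap K L)) ≫ X.fromSpecStalk P.pt := by
    have := Scheme.Spec_stalkClosedPointTo_fromSpecStalk (R := .of K) P.1
    exact (congrArg (Spec.map (CommRingCat.ofHom (algebraMap K L)) ≫ ·) this.symm).trans
      ((Category.assoc _ _ _).symm.trans
        (congrArg (· ≫ X.fromSpecStalk P.pt) (Spec.map_comp _ _).symm))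
  have h5 : IsLocalHom (Scheme.stalkClosedPointTo (R := .of K) P.1 ≫
      CommRingCat.ofHom (algebraMap K L)).hom := by
    have h6 : IsLocalHom (algebraMap K L) := inferInstance
    have h7 := Scheme.isLocalHom_stalkClosedPointTo' P.1
    exact RingHom.isLocalHom_comp (algebraMap K L) (Scheme.stalkClosedPointTo (R := .of K) P.1).hom
  have h4 := h2 _ _ _ h5 h3 hU hU'
  exact congrArg (fun f => f.hom s) h4

theorem stalkSpecializes_constGerm {x y : X} (h : x ⤳ y) (c : K) :
    X.presheaf.stalkSpecializes h (constGerm p y c) = constGerm p x c :=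
  congrArg (fun f => f.hom (const p ⊤ c))
    (X.presheaf.germ_stalkSpecializes (U := ⊤) (TopologicalSpace.Opens.mem_top y) h)

/-- The vector of `T_{P_L} X` defined by a vector of `T_P X`, where `P` is a `K`-point: the
canonical map `T_P X → (T_P X) ⊗_K L = T_{P_L} X`. -/
def Tangent.baseChange {P : Point p K} (D : Tangent P) (L : Type u) [Field L] [Algebra K L] :
    Tangent (P.baseChange L) :=
  ⟨fun a => algebraMap K L (D.1 (X.presheaf.stalkSpecializes (pt_specializes P) a)), by
    obtain ⟨D, h1, h2, h3⟩ := D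
    refine ⟨fun a b => ?_, fun a b => ?_, fun c => ?_⟩
    · simp only [map_add, h1]
    · simp only [map_mul, h2, map_add, eval_baseChange]
    · simp only [stalkSpecializes_constGerm, h3, map_zero]⟩

/-- The map `T_P φ` is onto. -/
def IsOntoAt (φ : X ⟶ Y) (hφ : φ ≫ q = p) (P : Point p L) : Prop :=
  Function.Surjective (tangentMap φ hφ P)

/-- A rational point `Q` of `Y` is a non-critical value of `φ` if `T_P φ` is onto for every point
`P` of `X` over `Q` with values in an extension `L` of `K`. -/
def IsNonCriticalValue (φ : X ⟶ Y) (hφ : φ ≫ q = p) (Q : Point q K) : Prop :=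
  ∀ (L : Type u) [Field L] [Algebra K L] (P : Point p L),
    P.map φ hφ = Q.baseChange L → IsOntoAt φ hφ P

/-! ### The total space `TX(L)` of the tangent bundle and its topology -/

/-- The set `TX(L)` of `L`-points of the tangent bundle: pairs of an `L`-point of `X` and a tangent
vector at this point. -/
structure TangentBundle (p : X ⟶ Spec (.of K)) (L : Type u) [Field L] [Algebra K L] : Type u where
  /-- The point. -/
  point : Point p L
  /-- The tangent vector. -/
  vec : Tangent point

/-- The affine chart of `TX(L)` over an open subset `U` of `X`: the coordinates of `(P, D)` are
all the `f(P)` and `D(f)`, for `f ∈ Γ(X, U)`. -/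
def tangentChart (p : X ⟶ Spec (.of K)) (L : Type u) [Field L] [Algebra K L] (U : X.Opens)
    (t : {t : TangentBundle p L // t.point.pt ∈ U}) : Γ(X, U) → L × L :=
  fun f => (t.1.point.eval (X.presheaf.germ U _ t.2 f), t.1.vec.1 (X.presheaf.germ U _ t.2 f))

/-- The topology of `TX(L)` for a topological field `L`: the strong topology on `TU(L)` for each
affine open subset `U` of `X`, glued along these subsets. -/
instance (p : X ⟶ Spec (.of K)) (L : Type u) [Field L] [Algebra K L] [TopologicalSpace L] :
    TopologicalSpace (TangentBundle p L) :=
  ⨆ U : X.affineOpens, TopologicalSpace.coinduced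
    (Subtype.val : {t : TangentBundle p L // t.point.pt ∈ U.1} → TangentBundle p L)
    (TopologicalSpace.induced (tangentChart p L U.1) inferInstance)

/-! ### Vector fields and frames -/

/-- A vector field on an open subset `U` of `X`, that is a section over `U` of the tangent sheaf:
a `K`-linear derivation of the sheaf of functions on `U`. -/
structure VectorField (p : X ⟶ Spec (.of K)) (U : X.Opens) where
  /-- The action of the vector field on the functions on an open subset `V` of `U`. -/
  app : ∀ V : X.Opens, V ≤ U → Γ(X, V) → Γ(X, V)
  map_add : ∀ V hV f g, app V hV (f + g) = app V hV f + app V hV g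
  leibniz : ∀ V hV f g, app V hV (f * g) = f * app V hV g + g * app V hV f
  map_const : ∀ V hV (c : K), app V hV (const p V c) = 0
  map_res : ∀ (V W : X.Opens) (hV : V ≤ U) (hW : W ≤ V) (f : Γ(X, V)),
    app W (hW.trans hV) (X.presheaf.map (homOfLE hW).op f) =
      X.presheaf.map (homOfLE hW).op (app V hV f)

/-- The vector fields `∂₁, …, ∂ᵣ` on `U` trivialise the tangent bundle over `U`: they form a basis
of the tangent sheaf restricted to `U`. -/
def IsFrame {U : X.Opens} {r : ℕ} (d : Fin r → VectorField p U) : Prop :=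
  ∀ (V : X.Opens) (hV : V ≤ U) (η : VectorField p V), ∃! g : Fin r → Γ(X, V),
    ∀ (W : X.Opens) (hW : W ≤ V) (f : Γ(X, W)),
      η.app W hW f = ∑ a, X.presheaf.map (homOfLE hW).op (g a) * (d a).app W (hW.trans hV) f

/-- The tangent vector `y` at `P ∈ U(L)` is the linear combination `∑ cₐ ∂ₐ(P)` of the values
at `P` of vector fields on `U`. -/
def IsCombination {U : X.Opens} {r : ℕ} (d : Fin r → VectorField p U) {P : Point p L}
    (c : Fin r → L) (y : Tangent P) : Prop :=
  ∀ (W : X.Opens) (hW : W ≤ U) (hP : P.pt ∈ W) (f : Γ(X, W)),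
    y.1 (X.presheaf.germ W _ hP f) =
      ∑ a, c a * P.eval (X.presheaf.germ W _ hP ((d a).app W hW f))

end Geometry

/-! ### Models of the tangent bundle and adelic metrics -/

section Adelic

variable {K : Type u} [Field K] [NumberField K] {X Y : Scheme.{u}}

/-- A model over the ring `𝒪_S` of `S`-integers of the tangent bundle `TX → X`: a proper flat
model `𝒱` of `X`, with a vector bundle on `𝒱` extending `TX`. The bundle is given by frames of `TX`
over the generic fibres of the members of an open cover of `𝒱`, whose transition matrices have
their coefficients in the functions on `𝒱`. -/
structure TangentModel (p : X ⟶ Spec (.of K)) (S : Set (HeightOneSpectrum (𝓞 K))) where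
  /-- The model of `X`. -/
  V : Scheme.{u}
  /-- The structure morphism of the model. -/
  hom : V ⟶ Spec (.of (S.integer K))
  proper : IsProper hom
  flat : Flat hom
  /-- The identification of `X` with the generic fibre. -/
  incl : X ⟶ V
  isPullback : IsPullback incl p hom
    (Spec.map (CommRingCat.ofHom (algebraMap (S.integer K) K)))
  /-- The number of members of the cover. -/
  k : ℕ
  /-- The open cover of the model. -/
  U : Fin k → V.Opens
  cover : ⨆ i, U i = ⊤
  /-- The rank of the bundle. -/
  r : ℕ
  /-- The frames. -/
  frame : ∀ i, Fin r → VectorField p (incl ⁻¹ᵁ U i)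
  isFrame : ∀ i, IsFrame (frame i)
  transition : ∀ i j, ∃ g : Fin r → Fin r → Γ(V, U i ⊓ U j),
    ∀ (W : X.Opens) (hW : W ≤ incl ⁻¹ᵁ (U i ⊓ U j)) (f : Γ(X, W)) (a : Fin r),
      (frame i a).app W (fun _ hx => (hW hx).1) f =
        ∑ b, incl.appLE (U i ⊓ U j) W hW (g a b) * (frame j b).app W (fun _ hx => (hW hx).2) f

/-- For `w ∉ S`, the unit balls for `N` of the tangent spaces at the `K_w`-points which extend to
`O_w`-points of the model are the `O_w`-modules defined by the model of the tangent bundle. -/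
def TangentModel.DefinesNorm {p : X ⟶ Spec (.of K)} {S : Set (HeightOneSpectrum (𝓞 K))}
    (M : TangentModel p S) (w : HeightOneSpectrum (𝓞 K))
    (N : ∀ P : Point p (w.adicCompletion K), Tangent P → ℝ) : Prop :=
  ∀ (P : Point p (w.adicCompletion K)) (x : Spec (.of (w.adicCompletionIntegers K)) ⟶ M.V),
    Spec.map (CommRingCat.ofHom
      (algebraMap (w.adicCompletionIntegers K) (w.adicCompletion K))) ≫ x = P.1 ≫ M.incl →
    ∀ i, x (closedPoint (w.adicCompletionIntegers K)) ∈ M.U i →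
    ∀ y : Tangent P, N P y ≤ 1 ↔ ∃ c : Fin M.r → w.adicCompletionIntegers K,
      IsCombination (M.frame i) (fun a => (c a : w.adicCompletion K)) y

/-- Ultrametric norms with values in the image of the absolute value `abv`, over a field `L` with
an ultrametric absolute value. -/
structure IsUltrametricNorm {L E : Type u} [Field L] [AddCommGroup E] [Module L E] (abv : L → ℝ)
    (N : E → ℝ) : Prop where
  eq_zero_iff : ∀ y, N y = 0 ↔ y = 0
  smul : ∀ (a : L) y, N (a • y) = abv a * N y
  add_le : ∀ y z, N (y + z) ≤ max (N y) (N z)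
  mem_range : ∀ y, ∃ a : L, N y = abv a

/-- The norms allowed at an archimedean place: euclidean norms, `y ↦ √φ(y,y)`, if the place is
real, and `y ↦ φ(y,y)` with `φ` positive definite hermitian if it is complex. -/
def IsHermitianNorm (v : InfinitePlace K) {E : Type u} [AddCommGroup E] [Module v.Completion E]
    (N : E → ℝ) : Prop :=
  ∃ φ : E → E → ℂ,
    (∀ x y z, φ (x + y) z = φ x z + φ y z) ∧
    (∀ a x y, φ (a • x) y = InfinitePlace.Completion.extensionEmbedding v a * φ x y) ∧
    (∀ x y, φ y x = starRingEnd ℂ (φ x y)) ∧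
    (∀ x, x ≠ 0 → 0 < (φ x x).re) ∧
    (v.IsReal → (∀ x y, (φ x y).im = 0) ∧ ∀ x, N x = √(φ x x).re) ∧
    (v.IsComplex → ∀ x, N x = (φ x x).re)

/-- An adelic metric on `X`: a (classical) adelic norm on its tangent bundle. -/
structure AdelicMetric (p : X ⟶ Spec (.of K)) where
  /-- The norms at the finite places. -/
  finNorm : ∀ (w : HeightOneSpectrum (𝓞 K)) (P : Point p (w.adicCompletion K)), Tangent P → ℝ
  /-- The norms at the archimedean places. -/
  infNorm : ∀ (v : InfinitePlace K) (P : Point p v.Completion), Tangent P → ℝ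
  continuous_finNorm : ∀ w : HeightOneSpectrum (𝓞 K), Continuous
    (fun t : TangentBundle p (w.adicCompletion K) => finNorm w t.point t.vec)
  continuous_infNorm : ∀ v : InfinitePlace K, Continuous
    (fun t : TangentBundle p v.Completion => infNorm v t.point t.vec)
  isUltrametricNorm : ∀ (w : HeightOneSpectrum (𝓞 K)) (P : Point p (w.adicCompletion K)),
    IsUltrametricNorm (fun a : w.adicCompletion K => ‖a‖) (finNorm w P)
  isHermitianNorm : ∀ (v : InfinitePlace K) (P : Point p v.Completion),
    IsHermitianNorm v (infNorm v P)
  exists_model : ∃ (S : Set (HeightOneSpectrum (𝓞 K))) (_ : S.Finite) (M : TangentModel p S),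
    ∀ w ∉ S, M.DefinesNorm w (finNorm w)

/-! ### Arithmetic degree, slopes, heights and freeness -/

/-- The norm of `e₁ ∧ ⋯ ∧ eᵣ` in the top exterior power of a space of dimension `r`: the absolute
value of the determinant of `e₁, …, eᵣ` in any basis `b₁, …, bᵣ` which is adapted to the norm, that
is, for which `b₁ ∧ ⋯ ∧ bᵣ` has norm `1`. The value does not depend on the adapted basis. -/
def wedgeNorm {L E : Type u} [Field L] [AddCommGroup E] [Module L E] {r : ℕ} (abv : L → ℝ)
    (IsAdapted : (Fin r → E) → Prop) (e : Fin r → E) : ℝ :=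
  sInf {t | ∃ (b : Fin r → E) (g : Matrix (Fin r) (Fin r) L), IsAdapted b ∧
    (∀ i, e i = ∑ j, g i j • b j) ∧ t = abv g.det}

/-- The family `b` is a basis of the module `{y | N y ≤ 1}` over the ring `{a | abv a ≤ 1}`, where
`y` belongs to the `L`-vector space generated by `b`. -/
def IsUnitBallBasis {L E : Type u} [Field L] [AddCommGroup E] [Module L E] (abv : L → ℝ)
    (N : E → ℝ) {r : ℕ} (b : Fin r → E) : Prop :=
  LinearIndependent L b ∧ ∀ c : Fin r → L, N (∑ i, c i • b i) ≤ 1 ↔ ∀ i, abv (c i) ≤ 1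

/-- The family `b` is orthonormal for `N`: `N (∑ cᵢ bᵢ)` is `√(∑ |cᵢ|²)` at a real place and
`∑ |cᵢ|²` at a complex place. -/
def IsOrthonormalFamily (v : InfinitePlace K) {E : Type u} [AddCommGroup E]
    [Module v.Completion E] (N : E → ℝ) {r : ℕ} (b : Fin r → E) : Prop :=
  ∀ c : Fin r → v.Completion, N (∑ i, c i • b i) = √((∑ i, ‖c i‖ ^ 2) ^ v.mult)

namespace AdelicMetric

variable {p : X ⟶ Spec (.of K)} (M : AdelicMetric p) (P : Point p K)

/-- The norm at the finite place `w` of `e₁ ∧ ⋯ ∧ eᵣ`, for vectors of `T_P X`. -/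
def finWedgeNorm (w : HeightOneSpectrum (𝓞 K)) {r : ℕ} (e : Fin r → Tangent P) : ℝ :=
  wedgeNorm (fun a : w.adicCompletion K => ‖a‖)
    (IsUnitBallBasis (fun a : w.adicCompletion K => ‖a‖) (M.finNorm w (P.baseChange _)))
    (fun i => Tangent.baseChange (e i) (w.adicCompletion K))

/-- The norm at the archimedean place `v` of `e₁ ∧ ⋯ ∧ eᵣ`, for vectors of `T_P X`; the normalised
absolute value is the square of the modulus if `v` is complex. -/
def infWedgeNorm (v : InfinitePlace K) {r : ℕ} (e : Fin r → Tangent P) : ℝ :=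
  wedgeNorm (fun a : v.Completion => ‖a‖ ^ v.mult)
    (IsOrthonormalFamily v (M.infNorm v (P.baseChange _)))
    (fun i => Tangent.baseChange (e i) v.Completion)

/-- `- ∑_w log ‖e₁ ∧ ⋯ ∧ eᵣ‖_w`, for vectors `e₁, …, eᵣ` of `T_P X`. -/
def wedgeDegree {r : ℕ} (e : Fin r → Tangent P) : ℝ :=
  (- ∑ᶠ w : HeightOneSpectrum (𝓞 K), Real.log (M.finWedgeNorm P w e)) -
    ∑ v : InfinitePlace K, Real.log (M.infWedgeNorm P v e)

open Classical in
/-- The arithmetic degree of a subspace `F` of `T_P X`, with the restrictions of the norms: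
`- ∑_w log ‖e₁ ∧ ⋯ ∧ eᵣ‖_w` for a basis `e₁, …, eᵣ` of `F`. By the product formula, the value does
not depend on the basis. -/
def degree (F : Submodule K (Tangent P)) : ℝ :=
  if h : Nonempty (Module.Basis (Fin (Module.finrank K F)) K F) then
    M.wedgeDegree P (fun i => (h.some i : Tangent P))
  else 0

/-- The Newton polygon of `T_P X`. -/
def newtonPolygon : Set (ℝ × ℝ) :=
  convexHull ℝ (Set.range fun F : Submodule K (Tangent P) =>
    ((Module.finrank K F : ℝ), M.degree P F))

/-- The concave function whose graph is the upper boundary of the Newton polygon. -/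
def polygonFun (x : ℝ) : ℝ := sSup {y : ℝ | (x, y) ∈ M.newtonPolygon P}

/-- The slopes `μ_i(P)` of the rational point `P`, for `1 ≤ i ≤ dim X`. -/
def slope (i : ℕ) : ℝ := M.polygonFun P i - M.polygonFun P (i - 1)

/-- The logarithmic height `h(P)` of `P` for the induced norm on the anticanonical line bundle,
that is the arithmetic degree of `T_P X`. -/
def height : ℝ := M.degree P ⊤

open Classical in
/-- The freeness `l(P)` of a rational point `P` of a variety of dimension `n`. -/
def freeness (n : ℕ) : ℝ := if 0 < M.slope P n then n * M.slope P n / M.height P else 0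

end AdelicMetric

end Adelic

end AdelicSlopes

end

/-! Call (deg T_P X − deg F) / codim F the slope of the quotient of T_P X by a proper subspace F. By
convexity of the Newton polygon, the last slope of P is the smallest slope of such a quotient
(`mul_slope_le` and `le_slope`). Let T be the tangent map at P, assumed onto, and let G be a proper
subspace of the tangent space at φ(P). With F the inverse image of G, the map T induces an
isomorphism from T_P X / F to the quotient by G. If T multiplies the norms at each place w by at
most c_w, the determinant of this isomorphism, in dimension s, is at most c_w ^ s times a factor
equal to 1 at the finite places and bounded by a power of s! at the others. Taking logarithms and
summing over the places bounds the degree of T_P X / F by that of the quotient by G plus s C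
(`exists_comap_degree_le`). So μ_m(P) − C is at most the slope of every quotient of the tangent
space at φ(P), hence at most μ_n(φ(P)).

The constant C must not depend on P, and it must be finite. This is
`IsNice.exists_norm_tangentMap_le`, which has two halves. At a fixed place, points with bounded
coordinates in an affine open subset, together with normalised tangent vectors, form a compact set
(`isCompact_chart`), on which the ratio of the two continuous norms is bounded. At almost all finite
places, the tangent maps send unit balls into unit balls: near any point, a vector at an integral
point has norm at most 1 exactly when its values on generators of the functions are integral
(`exists_nhds_eventually_norm_le_one_iff`, which rests on the models), and a morphism preserves this
integrality. Both halves need a finite cover by small affine open subsets in which every point has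
bounded coordinates, by 1 at almost all places. Projectivity provides it: divide by the largest
homogeneous coordinate, then refine by a partition of unity (`IsNice.exists_bounded_cover`).

Local volumes are treated uniformly through `LocalNorm`, a common description of ultrametric and
hermitian norms in which Gram–Schmidt orthogonalisation is possible. The degree is a sum over all
places, meaningful because a free family of rational tangent vectors is adapted at almost all places
(`almostAdapted`), and independent of the basis by the product formula. The polygon is a supremum,
meaningful because degrees of subspaces are bounded above (`exists_degree_le`).

The inequality on freeness is then elementary, with the sign of μ_n(φ(P)) decided by cases. Over a
non-critical value Q the point φ(P) is constant, so that the bound for l(P) is a constant divided by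
h(P). -/

noncomputable section

set_option linter.unusedSectionVars false

namespace AdelicSlopes

section

/-! ### Norms with orthonormal-type bases over one local field, and volumes -/

section LocalNorm

variable {L E E' : Type u} [Field L] [AddCommGroup E] [Module L E] [AddCommGroup E'] [Module L E']

/-- A norm `N` on `E`, homogeneous for the multiplicative function `abv` on `L`, together with a
class `Ad` of families which behave like orthonormal families for `N`; the absolute value of the
determinant of a square matrix of size `s` is bounded by `κ s` times the `s`-th power of a bound
for its entries. -/
structure LocalNorm (abv : L → ℝ) (N : E → ℝ) (Ad : ∀ r, (Fin r → E) → Prop) (κ : ℕ → ℝ) :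
    Prop where
  abv_one : abv 1 = 1
  abv_mul : ∀ a b, abv (a * b) = abv a * abv b
  abv_nonneg : ∀ a, 0 ≤ abv a
  abv_pos : ∀ a, a ≠ 0 → 0 < abv a
  det_le : ∀ s (M : Matrix (Fin s) (Fin s) L) (c : ℝ), 0 ≤ c → (∀ i j, abv (M i j) ≤ c) →
    abv M.det ≤ κ s * c ^ s
  indep : ∀ {r} (b : Fin r → E), Ad r b → LinearIndependent L b
  le_one : ∀ {r} (b : Fin r → E), Ad r b → ∀ i, N (b i) ≤ 1
  coord_le : ∀ {r} (b : Fin r → E), Ad r b → ∀ (c : Fin r → L) i, abv (c i) ≤ N (∑ j, c j • b j)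
  norm_eq : ∀ {r} (b b' : Fin r → E), Ad r b → Ad r b' → ∀ c : Fin r → L,
    N (∑ j, c j • b j) = N (∑ j, c j • b' j)
  empty : ∀ b : Fin 0 → E, Ad 0 b
  extend : ∀ {r} (b : Fin r → E), Ad r b → ∀ e : E, e ∉ Submodule.span L (Set.range b) →
    ∃ x, Ad (r + 1) (Fin.snoc b x) ∧
      Submodule.span L (Set.range (Fin.snoc b x : Fin (r + 1) → E)) =
        Submodule.span L (Set.range (Fin.snoc b e : Fin (r + 1) → E))

theorem sum_smul_sum {ι κ' : Type*} [Fintype ι] [Fintype κ'] (c : ι → L) (g : Matrix ι κ' L)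
    (b : κ' → E) : ∑ i, c i • ∑ j, g i j • b j = ∑ j, (Matrix.vecMul c g) j • b j := by
  simp only [Finset.smul_sum, smul_smul]
  rw [Finset.sum_comm]
  simp [Matrix.vecMul, dotProduct, Finset.sum_smul]

theorem sum_mul_smul {ι κ' μ : Type*} [Fintype κ'] [Fintype μ] (g : Matrix ι κ' L)
    (h : Matrix κ' μ L) (b : μ → E) (i : ι) :
    ∑ j, g i j • ∑ k, h j k • b k = ∑ k, (g * h) i k • b k :=
  sum_smul_sum (g i) h b

theorem exists_matrix_of_mem_span {ι κ' : Type*} [Fintype κ'] {e : ι → E} {b : κ' → E}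
    (h : ∀ i, e i ∈ Submodule.span L (Set.range b)) :
    ∃ g : Matrix ι κ' L, ∀ i, e i = ∑ j, g i j • b j := by
  choose g hg using fun i => (Submodule.mem_span_range_iff_exists_fun L).1 (h i)
  exact ⟨g, fun i => (hg i).symm⟩

theorem matrix_eq_of_indep {ι κ' : Type*} [Fintype κ'] {b : κ' → E} (hb : LinearIndependent L b)
    {g h : Matrix ι κ' L} (H : ∀ i, ∑ j, g i j • b j = ∑ j, h i j • b j) : g = h := by
  ext i j
  have := Fintype.linearIndependent_iff.1 hb (fun j => g i j - h i j)
    (by simp [sub_smul, Finset.sum_sub_distrib, H i]) j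
  exact sub_eq_zero.1 this

theorem det_ne_zero_of_indep {r : ℕ} {e b : Fin r → E} (he : LinearIndependent L e)
    {g : Matrix (Fin r) (Fin r) L} (h : ∀ i, e i = ∑ j, g i j • b j) : g.det ≠ 0 := by
  intro h0
  obtain ⟨c, hc, hcg⟩ := Matrix.exists_vecMul_eq_zero_iff.2 h0
  apply hc
  have : ∑ i, c i • e i = 0 := by
    simp_rw [h, sum_smul_sum, hcg]; simp
  funext i
  exact Fintype.linearIndependent_iff.1 he c this i

namespace LocalNorm

variable {abv : L → ℝ} {N : E → ℝ} {Ad : ∀ r, (Fin r → E) → Prop} {κ : ℕ → ℝ}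

theorem abv_pow (H : LocalNorm abv N Ad κ) (a : L) (n : ℕ) : abv (a ^ n) = abv a ^ n := by
  induction n with
  | zero => simp [H.abv_one]
  | succ n ih => rw [pow_succ, H.abv_mul, ih, pow_succ]

/-- The matrix `g` preserves `N` in the coordinates of `b'`, hence so do its powers, whose entries
therefore stay bounded by 1. By `det_le` the powers of `abv g.det` are bounded by a constant, which
excludes a value larger than 1. The argument serves finite and archimedean places alike. -/
theorem abv_det_le_one (H : LocalNorm abv N Ad κ) {r : ℕ} {b b' : Fin r → E} (hb : Ad r b)
    (hb' : Ad r b') {g : Matrix (Fin r) (Fin r) L} (h : ∀ i, b i = ∑ j, g i j • b' j) :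
    abv g.det ≤ 1 := by
  have inv : ∀ c : Fin r → L, N (∑ j, (Matrix.vecMul c g) j • b' j) = N (∑ j, c j • b' j) := by
    intro c
    rw [← sum_smul_sum, ← H.norm_eq b b' hb hb']
    simp_rw [← h]
  have hpow : ∀ n (c : Fin r → L),
      N (∑ j, (Matrix.vecMul c (g ^ n)) j • b' j) = N (∑ j, c j • b' j) := by
    intro n
    induction n with
    | zero => simp
    | succ n ih =>
      intro c
      rw [pow_succ, ← Matrix.vecMul_vecMul, inv, ih]
  have hent : ∀ n i j, abv ((g ^ n) i j) ≤ 1 := by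
    intro n i j
    have h1 := H.coord_le b' hb' (Matrix.vecMul (Pi.single i 1) (g ^ n)) j
    rw [hpow] at h1
    have h2 : ∑ j, (Pi.single i 1 : Fin r → L) j • b' j = b' i := by
      simp [Pi.single_apply, ite_smul]
    rw [h2] at h1
    simpa using h1.trans (H.le_one b' hb' i)
  by_contra! hlt
  obtain ⟨n, hn⟩ := pow_unbounded_of_one_lt (κ r) hlt
  have := H.det_le r (g ^ n) 1 zero_le_one (hent n)
  rw [Matrix.det_pow, H.abv_pow] at this
  simp at this
  linarith

theorem abv_det_eq_one (H : LocalNorm abv N Ad κ) {r : ℕ} {b b' : Fin r → E} (hb : Ad r b)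
    (hb' : Ad r b') {g : Matrix (Fin r) (Fin r) L} (h : ∀ i, b i = ∑ j, g i j • b' j) :
    abv g.det = 1 := by
  have hle := H.abv_det_le_one hb hb' h
  have hdet : g.det ≠ 0 := det_ne_zero_of_indep (H.indep b hb) h
  have hu : IsUnit g.det := isUnit_iff_ne_zero.2 hdet
  have h' : ∀ i, b' i = ∑ j, g⁻¹ i j • b j := by
    intro i
    simp_rw [h]
    rw [sum_mul_smul, Matrix.nonsing_inv_mul g hu]
    simp [Matrix.one_apply, ite_smul]
  have hle' := H.abv_det_le_one hb' hb h'
  have hprod : abv g.det * abv (g⁻¹).det = 1 := by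
    rw [← H.abv_mul, ← Matrix.det_mul, Matrix.mul_nonsing_inv g hu, Matrix.det_one, H.abv_one]
  have h0 := H.abv_nonneg g.det
  nlinarith

/-- Two adapted bases of the same space differ by a determinant of absolute value 1, so the set
whose infimum defines `wedgeNorm` is a singleton. -/
theorem wedgeNorm_eq (H : LocalNorm abv N Ad κ) {r : ℕ} {b e : Fin r → E} (hb : Ad r b)
    {g : Matrix (Fin r) (Fin r) L} (h : ∀ i, e i = ∑ j, g i j • b j) (hg : g.det ≠ 0) :
    wedgeNorm abv (Ad r) e = abv g.det := by
  have hu : IsUnit g.det := isUnit_iff_ne_zero.2 hg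
  have : {t | ∃ (b : Fin r → E) (g : Matrix (Fin r) (Fin r) L), Ad r b ∧
      (∀ i, e i = ∑ j, g i j • b j) ∧ t = abv g.det} = {abv g.det} := by
    ext t
    constructor
    · rintro ⟨b', g', hb', h', rfl⟩
      have h2 : ∀ i, b i = ∑ j, (g⁻¹ * g') i j • b' j := by
        intro i
        rw [← sum_mul_smul]
        simp_rw [← h', h]
        rw [sum_mul_smul, Matrix.nonsing_inv_mul g hu]
        simp [Matrix.one_apply, ite_smul]
      have h3 := H.abv_det_eq_one hb hb' h2
      have h4 : g' = g * (g⁻¹ * g') := by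
        rw [← mul_assoc, Matrix.mul_nonsing_inv g hu, one_mul]
      rw [Set.mem_singleton_iff, h4, Matrix.det_mul, H.abv_mul, h3, mul_one]
    · rintro rfl
      exact ⟨b, g, hb, h, rfl⟩
  rw [wedgeNorm, this, csInf_singleton]

/-- Gram–Schmidt: `extend` is applied one vector at a time, and the adapted family already present
is never changed. -/
theorem exists_flag (H : LocalNorm abv N Ad κ) {r : ℕ} (b : Fin r → E) (hb : Ad r b) :
    ∀ {s : ℕ} (e : Fin s → E), LinearIndependent L (Fin.append b e) →
    ∃ x : Fin s → E, Ad (r + s) (Fin.append b x) ∧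
      Submodule.span L (Set.range (Fin.append b x)) =
        Submodule.span L (Set.range (Fin.append b e)) := by
  intro s
  induction s with
  | zero =>
    intro e he
    refine ⟨e, ?_, rfl⟩
    rw [Fin.append_right_nil _ _ rfl]; exact hb
  | succ s ih =>
    intro e he
    have key : ∀ (f : Fin s → E) (y : E),
        Fin.append b (Fin.snoc f y) = (Fin.snoc (Fin.append b f) y : Fin (r + s + 1) → E) :=
      fun f y => Fin.append_snoc b f y
    obtain ⟨f, y, rfl⟩ : ∃ (f : Fin s → E) (y : E), e = Fin.snoc f y :=
      ⟨Fin.init e, e (Fin.last s), (Fin.snoc_init_self e).symm⟩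
    rw [key] at he
    have he' := linearIndependent_finSnoc.1 he
    obtain ⟨x, hx, hspan⟩ := ih f he'.1
    obtain ⟨z, hz, hspan'⟩ := H.extend _ hx y (by rw [hspan]; exact he'.2)
    refine ⟨Fin.snoc x z, ?_, ?_⟩
    · rw [key]; exact hz
    · rw [key, key]
      have h1 : ∀ (f : Fin (r + s) → E) (y : E),
          Submodule.span L (Set.range (Fin.snoc f y : Fin (r + s + 1) → E)) =
            Submodule.span L {y} ⊔ Submodule.span L (Set.range f) := by
        intro f y
        rw [Fin.range_snoc, Submodule.span_insert]
      refine hspan'.trans ?_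
      rw [h1, h1, hspan]

theorem exists_adapted (H : LocalNorm abv N Ad κ) {s : ℕ} (e : Fin s → E)
    (he : LinearIndependent L e) : ∃ b : Fin s → E, Ad s b ∧
      Submodule.span L (Set.range b) = Submodule.span L (Set.range e) := by
  induction s with
  | zero => exact ⟨e, H.empty e, rfl⟩
  | succ s ih =>
    obtain ⟨f, y, rfl⟩ : ∃ (f : Fin s → E) (y : E), e = Fin.snoc f y :=
      ⟨Fin.init e, e (Fin.last s), (Fin.snoc_init_self e).symm⟩
    have he' := linearIndependent_finSnoc.1 he
    obtain ⟨x, hx, hspan⟩ := ih f he'.1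
    obtain ⟨z, hz, hspan'⟩ := H.extend _ hx y (by rw [hspan]; exact he'.2)
    refine ⟨Fin.snoc x z, hz, hspan'.trans ?_⟩
    rw [Fin.range_snoc, Fin.range_snoc, Submodule.span_insert, Submodule.span_insert, hspan]

theorem exists_wedgeNorm_eq (H : LocalNorm abv N Ad κ) {r : ℕ} (e : Fin r → E)
    (he : LinearIndependent L e) : ∃ (b : Fin r → E) (g : Matrix (Fin r) (Fin r) L), Ad r b ∧
      (∀ i, e i = ∑ j, g i j • b j) ∧ g.det ≠ 0 ∧ wedgeNorm abv (Ad r) e = abv g.det := by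
  obtain ⟨b, hb, hspan⟩ := H.exists_adapted e he
  obtain ⟨g, hg⟩ := exists_matrix_of_mem_span (L := L) (e := e) (b := b)
    (fun i => hspan ▸ Submodule.subset_span ⟨i, rfl⟩)
  have := det_ne_zero_of_indep he hg
  exact ⟨b, g, hb, hg, this, H.wedgeNorm_eq hb hg this⟩

theorem wedgeNorm_pos (H : LocalNorm abv N Ad κ) {r : ℕ} (e : Fin r → E)
    (he : LinearIndependent L e) : 0 < wedgeNorm abv (Ad r) e := by
  obtain ⟨b, g, -, -, h, h'⟩ := H.exists_wedgeNorm_eq e he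
  rw [h']; exact H.abv_pos _ h

theorem wedgeNorm_mul (H : LocalNorm abv N Ad κ) {r : ℕ} {e e' : Fin r → E}
    (he : LinearIndependent L e) {h : Matrix (Fin r) (Fin r) L}
    (hh : ∀ i, e' i = ∑ j, h i j • e j) (hdet : h.det ≠ 0) :
    wedgeNorm abv (Ad r) e' = abv h.det * wedgeNorm abv (Ad r) e := by
  obtain ⟨b, g, hb, hg, hg0, heq⟩ := H.exists_wedgeNorm_eq e he
  rw [heq, ← H.abv_mul, ← Matrix.det_mul]
  refine H.wedgeNorm_eq hb (fun i => ?_) (by rw [Matrix.det_mul]; exact mul_ne_zero hdet hg0)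
  rw [hh]
  simp_rw [hg]
  rw [sum_mul_smul]

theorem wedgeNorm_adapted (H : LocalNorm abv N Ad κ) {r : ℕ} {b : Fin r → E} (hb : Ad r b) :
    wedgeNorm abv (Ad r) b = 1 := by
  rw [H.wedgeNorm_eq (g := 1) hb (fun i => by simp [Matrix.one_apply, ite_smul]) (by simp)]
  simp [H.abv_one]

/-- An adapted flag for a flag of two spaces, and the corresponding triangular decomposition. -/
theorem exists_triangular (H : LocalNorm abv N Ad κ) {r s : ℕ} (e : Fin r → E) (f : Fin s → E)
    (hef : LinearIndependent L (Fin.append e f)) :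
    ∃ (b : Fin r → E) (x : Fin s → E) (A : Matrix (Fin r) (Fin r) L)
      (B : Matrix (Fin s) (Fin r) L) (D : Matrix (Fin s) (Fin s) L),
      Ad r b ∧ Ad (r + s) (Fin.append b x) ∧
      Submodule.span L (Set.range b) = Submodule.span L (Set.range e) ∧
      Submodule.span L (Set.range (Fin.append b x)) =
        Submodule.span L (Set.range (Fin.append e f)) ∧
      (∀ i, e i = ∑ j, A i j • b j) ∧
      (∀ i, f i = ∑ j, B i j • b j + ∑ j, D i j • x j) ∧
      wedgeNorm abv (Ad r) e = abv A.det ∧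
      wedgeNorm abv (Ad (r + s)) (Fin.append e f) = abv A.det * abv D.det := by
  have he : LinearIndependent L e := by
    have := hef.comp (Fin.castAdd s) (Fin.castAdd_injective r s)
    convert this using 1
    funext i; simp
  obtain ⟨b, A, hb, hA, hA0, hwe⟩ := H.exists_wedgeNorm_eq e he
  have hspan : Submodule.span L (Set.range b) = Submodule.span L (Set.range e) := by
    apply le_antisymm
    · rw [Submodule.span_le]
      rintro _ ⟨i, rfl⟩
      have : b i = ∑ j, A⁻¹ i j • e j := by
        simp_rw [hA]
        rw [sum_mul_smul, Matrix.nonsing_inv_mul A (isUnit_iff_ne_zero.2 hA0)]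
        simp [Matrix.one_apply, ite_smul]
      rw [this]
      exact Submodule.sum_mem _ fun j _ => Submodule.smul_mem _ _ (Submodule.subset_span ⟨j, rfl⟩)
    · rw [Submodule.span_le]
      rintro _ ⟨i, rfl⟩
      rw [hA]
      exact Submodule.sum_mem _ fun j _ => Submodule.smul_mem _ _ (Submodule.subset_span ⟨j, rfl⟩)
  have hrange : ∀ (u : Fin r → E) (v : Fin s → E), Submodule.span L (Set.range (Fin.append u v)) =
      Submodule.span L (Set.range u) ⊔ Submodule.span L (Set.range v) := by
    intro u v
    rw [← Submodule.span_union]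
    congr 1
    ext y
    constructor
    · rintro ⟨i, rfl⟩
      refine Fin.addCases (fun i => ?_) (fun i => ?_) i
      · left; exact ⟨i, by simp⟩
      · right; exact ⟨i, by simp⟩
    · rintro (⟨i, rfl⟩ | ⟨i, rfl⟩)
      · exact ⟨Fin.castAdd s i, by simp⟩
      · exact ⟨Fin.natAdd r i, by simp⟩
  have hspan2 : Submodule.span L (Set.range (Fin.append b f)) =
      Submodule.span L (Set.range (Fin.append e f)) := by
    rw [hrange, hrange, hspan]
  have hbf : LinearIndependent L (Fin.append b f) := by
    rw [linearIndependent_iff_card_eq_finrank_span] at hef ⊢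
    rw [hef, Set.finrank, Set.finrank, hspan2]
  obtain ⟨x, hx, hspanx⟩ := H.exists_flag b hb f hbf
  obtain ⟨G, hG⟩ := exists_matrix_of_mem_span (L := L) (e := f) (b := Fin.append b x) (fun i => by
    rw [hspanx, hrange]
    exact Submodule.mem_sup_right (Submodule.subset_span ⟨i, rfl⟩))
  let B : Matrix (Fin s) (Fin r) L := fun i j => G i (Fin.castAdd s j)
  let D : Matrix (Fin s) (Fin s) L := fun i j => G i (Fin.natAdd r j)
  have hf : ∀ i, f i = ∑ j, B i j • b j + ∑ j, D i j • x j := by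
    intro i
    rw [hG i, Fin.sum_univ_add]
    simp [B, D]
  -- In the adapted basis the whole family has a block triangular matrix, and `D.det` measures the
  -- volume of `f` modulo the span of `e`.
  let T : Matrix (Fin (r + s)) (Fin (r + s)) L :=
    (Matrix.fromBlocks A 0 B D).submatrix finSumFinEquiv.symm finSumFinEquiv.symm
  have hT : ∀ i, Fin.append e f i = ∑ j, T i j • Fin.append b x j := by
    intro i
    rw [Fin.sum_univ_add]
    refine Fin.addCases (fun i => ?_) (fun i => ?_) i
    · simp [T, hA i]
    · simp [T, hf i]
  have hTdet : T.det = A.det * D.det := by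
    simp only [T]
    rw [Matrix.det_submatrix_equiv_self, Matrix.det_fromBlocks_zero₁₂]
  refine ⟨b, x, A, B, D, hb, hx, hspan, hspanx.trans hspan2, hA, hf, hwe, ?_⟩
  rw [H.wedgeNorm_eq hx hT (det_ne_zero_of_indep hef hT), hTdet, H.abv_mul]

/-- The inequality between the volumes of quotient spaces under a linear map of norm at most `C`. -/
theorem wedgeNorm_quotient_le (H : LocalNorm abv N Ad κ) {N' : E' → ℝ}
    {Ad' : ∀ r, (Fin r → E') → Prop} {κ' : ℕ → ℝ} (H' : LocalNorm abv N' Ad' κ')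
    (T : E →ₗ[L] E') {C : ℝ} (hC : 0 ≤ C) (hT : ∀ y, N' (T y) ≤ C * N y)
    {r s t : ℕ} (e : Fin r → E) (f : Fin s → E) (g : Fin t → E')
    (hef : LinearIndependent L (Fin.append e f))
    (hgf : LinearIndependent L (Fin.append g (fun i => T (f i))))
    (heg : ∀ i, T (e i) ∈ Submodule.span L (Set.range g)) :
    wedgeNorm abv (Ad' (t + s)) (Fin.append g (fun i => T (f i))) * wedgeNorm abv (Ad r) e ≤
      κ' s * C ^ s * (wedgeNorm abv (Ad' t) g * wedgeNorm abv (Ad (r + s)) (Fin.append e f)) := by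
  obtain ⟨b, x, A, B, D, hb, hx, hspan, hspan', hA, hf, hwe, hwef⟩ := H.exists_triangular e f hef
  obtain ⟨b', x', A', B', D', hb', hx', hspan1, hspan1', hA', hf', hwg, hwgf⟩ :=
    H'.exists_triangular g _ hgf
  have hTb : ∀ i, T (b i) ∈ Submodule.span L (Set.range b') := by
    intro i
    have h1 : b i ∈ Submodule.span L (Set.range e) := hspan ▸ Submodule.subset_span ⟨i, rfl⟩
    have h2 := Submodule.mem_map_of_mem (f := T) h1
    rw [Submodule.map_span] at h2
    rw [hspan1]
    refine (Submodule.span_le.2 ?_) h2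
    rintro _ ⟨_, ⟨j, rfl⟩, rfl⟩
    exact heg j
  have hb'x' : ∀ v, v ∈ Submodule.span L (Set.range b') →
      v ∈ Submodule.span L (Set.range (Fin.append b' x')) := by
    intro v hv
    refine Submodule.span_mono ?_ hv
    rintro _ ⟨j, rfl⟩
    exact ⟨Fin.castAdd s j, by simp⟩
  have hTx : ∀ i, T (x i) ∈ Submodule.span L (Set.range (Fin.append b' x')) := by
    intro i
    have h1 : x i ∈ Submodule.span L (Set.range (Fin.append e f)) := by
      rw [← hspan']; exact Submodule.subset_span ⟨Fin.natAdd r i, by simp⟩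
    have h2 := Submodule.mem_map_of_mem (f := T) h1
    rw [Submodule.map_span] at h2
    refine (Submodule.span_le.2 ?_) h2
    rintro _ ⟨_, ⟨j, rfl⟩, rfl⟩
    refine Fin.addCases (fun j => ?_) (fun j => ?_) j
    · rw [Fin.append_left]
      apply hb'x'
      rw [hspan1]; exact heg j
    · rw [Fin.append_right]
      have : T (f j) ∈ Submodule.span L (Set.range (Fin.append g fun i => T (f i))) :=
        Submodule.subset_span ⟨Fin.natAdd t j, by simp⟩
      rwa [← hspan1'] at this
  obtain ⟨P, hP⟩ := exists_matrix_of_mem_span (L := L) hTb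
  obtain ⟨G, hG⟩ := exists_matrix_of_mem_span (L := L) hTx
  -- `M` is the matrix, in the bases `x` and `x'`, of the map which `T` induces between the
  -- quotients by the spans of `b` and `b'`. Its entries are coordinates of the vectors `T (x i)` in
  -- an adapted basis, so they are bounded by `C`.
  let M : Matrix (Fin s) (Fin s) L := fun i j => G i (Fin.natAdd t j)
  let Q : Matrix (Fin s) (Fin t) L := fun i j => G i (Fin.castAdd s j)
  have hTx' : ∀ i, T (x i) = ∑ j, Q i j • b' j + ∑ j, M i j • x' j := by
    intro i
    rw [hG i, Fin.sum_univ_add]; simp [Q, M]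
  have hM : ∀ i j, abv (M i j) ≤ C := by
    intro i j
    have h1 := H'.coord_le _ hx' (G i) (Fin.natAdd t j)
    rw [← hG i] at h1
    refine h1.trans ((hT _).trans ?_)
    have h2 := H.le_one _ hx (Fin.natAdd r i)
    rw [Fin.append_right] at h2
    nlinarith
  -- Modulo the span of `b'`, which contains the images of the `b i`, the vectors `T (f i)` have
  -- coordinates `D * M` in `x'`.
  have hD' : D' = D * M := by
    have h1 : ∀ i, T (f i) = ∑ j, (B * P + D * Q) i j • b' j + ∑ j, (D * M) i j • x' j := by
      intro i
      rw [hf i, map_add, map_sum, map_sum]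
      simp only [map_smul, hTx', hP, smul_add, Finset.sum_add_distrib]
      rw [sum_mul_smul, sum_mul_smul, sum_mul_smul]
      simp only [Matrix.add_apply, add_smul, Finset.sum_add_distrib]
      abel
    have h2 : (fun i => Fin.append (B' i) (D' i) : Matrix (Fin s) (Fin (t + s)) L) =
        fun i => Fin.append ((B * P + D * Q) i) ((D * M) i) := by
      refine matrix_eq_of_indep (H'.indep _ hx') fun i => ?_
      rw [Fin.sum_univ_add, Fin.sum_univ_add]
      simp only [Fin.append_left, Fin.append_right]
      rw [← hf' i, ← h1 i]
    ext i j
    have := congrFun (congrFun h2 i) (Fin.natAdd t j)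
    simpa only [Fin.append_right] using this
  rw [hwe, hwef, hwg, hwgf, hD', Matrix.det_mul, H.abv_mul]
  have h1 := H'.det_le s M C hC hM
  have h2 : 0 ≤ abv A'.det * (abv A.det * abv D.det) :=
    mul_nonneg (H.abv_nonneg _) (mul_nonneg (H.abv_nonneg _) (H.abv_nonneg _))
  calc abv A'.det * (abv D.det * abv M.det) * abv A.det
      = abv M.det * (abv A'.det * (abv A.det * abv D.det)) := by ring
    _ ≤ κ' s * C ^ s * (abv A'.det * (abv A.det * abv D.det)) :=
        mul_le_mul_of_nonneg_right h1 h2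

/-- The volume of a family is at most that of a subfamily times the norms of the other vectors. -/
theorem wedgeNorm_append_le (H : LocalNorm abv N Ad κ) {r s : ℕ} (e : Fin r → E) (f : Fin s → E)
    (hef : LinearIndependent L (Fin.append e f)) {C : ℝ} (hC : 0 ≤ C)
    (hf : ∀ i, N (f i) ≤ C) :
    wedgeNorm abv (Ad (r + s)) (Fin.append e f) ≤ κ s * C ^ s * wedgeNorm abv (Ad r) e := by
  obtain ⟨b, x, A, B, D, hb, hx, -, -, hA, hD, hwe, hwef⟩ := H.exists_triangular e f hef
  rw [hwe, hwef, mul_comm]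
  refine mul_le_mul_of_nonneg_right (H.det_le s D C hC fun i j => ?_) (H.abv_nonneg _)
  have h1 := H.coord_le _ hx (Fin.append (B i) (D i)) (Fin.natAdd r j)
  rw [Fin.sum_univ_add] at h1
  simp only [Fin.append_left, Fin.append_right] at h1
  rw [← hD i] at h1
  exact h1.trans (hf i)

end LocalNorm

end LocalNorm

end

section

/-! ### Ultrametric norms -/

section FiniteLocalNorm

variable {L E : Type u} [NormedField L] [IsUltrametricDist L] [AddCommGroup E] [Module L E]
  {N : E → ℝ}

namespace IsUltrametricNorm

theorem zero (h : IsUltrametricNorm (fun a : L => ‖a‖) N) : N 0 = 0 := (h.eq_zero_iff 0).2 rfl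

theorem nonneg (h : IsUltrametricNorm (fun a : L => ‖a‖) N) (y : E) : 0 ≤ N y := by
  obtain ⟨a, ha⟩ := h.mem_range y
  rw [ha]; exact norm_nonneg a

theorem neg (h : IsUltrametricNorm (fun a : L => ‖a‖) N) (y : E) : N (-y) = N y := by
  rw [← neg_one_smul L y, h.smul]; simp

theorem sub_le (h : IsUltrametricNorm (fun a : L => ‖a‖) N) (y z : E) :
    N (y - z) ≤ max (N y) (N z) := by
  rw [sub_eq_add_neg, ← h.neg z]; exact h.add_le _ _

/-- A nonzero vector is a multiple of a vector of norm `1`. -/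
theorem exists_smul (h : IsUltrametricNorm (fun a : L => ‖a‖) N) {y : E} (hy : y ≠ 0) :
    ∃ a : L, a ≠ 0 ∧ N y = ‖a‖ ∧ N (a⁻¹ • y) = 1 := by
  obtain ⟨a, ha⟩ := h.mem_range y
  have ha0 : a ≠ 0 := by
    rintro rfl
    exact hy ((h.eq_zero_iff y).1 (by simpa using ha))
  refine ⟨a, ha0, ha, ?_⟩
  rw [h.smul, ha, norm_inv, inv_mul_cancel₀ (norm_ne_zero_iff.2 ha0)]

end IsUltrametricNorm

theorem IsUnitBallBasis.norm_le_iff (h : IsUltrametricNorm (fun a : L => ‖a‖) N) {r : ℕ}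
    {b : Fin r → E} (hb : IsUnitBallBasis (fun a : L => ‖a‖) N b) {a : L} (ha : a ≠ 0)
    (c : Fin r → L) : N (∑ i, c i • b i) ≤ ‖a‖ ↔ ∀ i, ‖c i‖ ≤ ‖a‖ := by
  have h1 := hb.2 (fun i => a⁻¹ * c i)
  have h2 : ∑ i, (a⁻¹ * c i) • b i = a⁻¹ • ∑ i, c i • b i := by
    rw [Finset.smul_sum]; simp [mul_smul]
  have ha' : 0 < ‖a‖ := norm_pos_iff.2 ha
  rw [h2, h.smul] at h1
  simp only [norm_inv, norm_mul] at h1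
  rw [inv_mul_le_iff₀ ha', mul_one] at h1
  rw [h1]
  refine forall_congr' fun i => ?_
  rw [inv_mul_le_iff₀ ha', mul_one]

/-- The norm takes its values among those of the absolute value, so it is determined by its unit
ball through rescaling. -/
theorem IsUnitBallBasis.norm_eq (h : IsUltrametricNorm (fun a : L => ‖a‖) N) {r : ℕ}
    {b : Fin r → E} (hb : IsUnitBallBasis (fun a : L => ‖a‖) N b) (c : Fin r → L) :
    N (∑ i, c i • b i) = ‖c‖ := by
  apply le_antisymm
  · by_cases hr : Nonempty (Fin r)
    · obtain ⟨i, -, hi⟩ := Finset.exists_max_image Finset.univ (fun i => ‖c i‖)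
        ⟨Classical.choice hr, Finset.mem_univ _⟩
      by_cases hc : c i = 0
      · have : c = 0 := by
          funext j
          have := hi j (Finset.mem_univ _)
          rw [hc, norm_zero] at this
          exact norm_le_zero_iff.1 this
        simp [this, h.zero]
      · exact ((hb.norm_le_iff h hc c).2 fun j => hi j (Finset.mem_univ _)).trans (norm_le_pi_norm c i)
    · rw [not_nonempty_iff] at hr
      simp [h.zero]
  · obtain ⟨a, ha⟩ := h.mem_range (∑ i, c i • b i)
    by_cases ha0 : a = 0
    · have h1 : ∑ i, c i • b i = 0 := (h.eq_zero_iff _).1 (by rw [ha, ha0]; simp)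
      have : c = 0 := funext fun i => Fintype.linearIndependent_iff.1 hb.1 c h1 i
      simp [this, h.zero]
    · have h1 := (hb.norm_le_iff h ha0 c).1 ha.le
      rw [ha]
      exact (pi_norm_le_iff_of_nonneg (norm_nonneg a)).2 h1

theorem norm_det_le_of_ultrametric {s : ℕ} (M : Matrix (Fin s) (Fin s) L) (c : ℝ) (hc : 0 ≤ c)
    (h : ∀ i j, ‖M i j‖ ≤ c) : ‖M.det‖ ≤ c ^ s := by
  rw [Matrix.det_apply]
  refine IsUltrametricDist.norm_sum_le_of_forall_le_of_nonneg (pow_nonneg hc s) fun σ _ => ?_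
  have h1 : ‖Equiv.Perm.sign σ • ∏ i, M (σ i) i‖ = ‖∏ i, M (σ i) i‖ := by
    rcases Int.units_eq_one_or (Equiv.Perm.sign σ) with h | h <;> simp [h]
  rw [h1, norm_prod]
  calc ∏ i, ‖M (σ i) i‖ ≤ ∏ _i : Fin s, c := Finset.prod_le_prod (fun _ _ => norm_nonneg _) fun i _ => h _ _
    _ = c ^ s := by simp

/-- By local compactness the distance from `e` to the span of `b` is attained. The difference with a
nearest point, rescaled to norm 1, is then at distance 1 from the span: this is ultrametric
orthogonality. -/
theorem IsUnitBallBasis.extend [ProperSpace L] (h : IsUltrametricNorm (fun a : L => ‖a‖) N) {r : ℕ}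
    {b : Fin r → E} (hb : IsUnitBallBasis (fun a : L => ‖a‖) N b) (e : E)
    (he : e ∉ Submodule.span L (Set.range b)) :
    ∃ x, IsUnitBallBasis (fun a : L => ‖a‖) N (Fin.snoc b x : Fin (r + 1) → E) ∧
      Submodule.span L (Set.range (Fin.snoc b x : Fin (r + 1) → E)) =
        Submodule.span L (Set.range (Fin.snoc b e : Fin (r + 1) → E)) := by
  let F : (Fin r → L) → ℝ := fun c => N (e - ∑ i, c i • b i)
  have hsub : ∀ c d : Fin r → L, |F c - F d| ≤ ‖c - d‖ := by
    have aux : ∀ c d : Fin r → L, F c ≤ F d + ‖c - d‖ := by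
      intro c d
      have h1 : e - ∑ i, c i • b i = (e - ∑ i, d i • b i) - ∑ i, (c - d) i • b i := by
        simp [sub_smul, Finset.sum_sub_distrib]
      have h2 := h.sub_le (e - ∑ i, d i • b i) (∑ i, (c - d) i • b i)
      rw [← h1, hb.norm_eq h] at h2
      exact h2.trans (max_le (le_add_of_nonneg_right (norm_nonneg _))
        (le_add_of_nonneg_left (h.nonneg _)))
    intro c d
    rw [abs_le]
    constructor
    · have := aux d c
      rw [norm_sub_rev] at this; linarith
    · linarith [aux c d]
  have hcont : Continuous F := by
    refine (LipschitzWith.of_dist_le_mul (K := 1) fun c d => ?_).continuous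
    rw [Real.dist_eq, dist_eq_norm, NNReal.coe_one, one_mul]
    exact hsub c d
  -- Outside the ball of radius `N e` no coefficient vector does better than 0, so a minimum on this
  -- compact ball is a global one.
  obtain ⟨c₀, -, hc₀⟩ := (isCompact_closedBall (0 : Fin r → L) (N e)).exists_isMinOn
    ⟨0, Metric.mem_closedBall_self (h.nonneg e)⟩ hcont.continuousOn
  have hF0 : F 0 = N e := by simp [F]
  have hmin : ∀ c, F c₀ ≤ F c := by
    intro c
    by_cases hc : ‖c‖ ≤ N e
    · exact hc₀ (by simpa using hc)
    · push Not at hc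
      have h1 : F c₀ ≤ F 0 := hc₀ (Metric.mem_closedBall_self (h.nonneg e))
      have h2 : N (∑ i, c i • b i) ≤ max (N e) (F c) := by
        have := h.sub_le e (e - ∑ i, c i • b i)
        simpa using this
      rw [hb.norm_eq h] at h2
      rcases le_max_iff.1 h2 with h3 | h3 <;> linarith
  set e' := e - ∑ i, c₀ i • b i with he'
  have hsum : ∀ c : Fin r → L, ∑ i, c i • b i ∈ Submodule.span L (Set.range b) := fun c =>
    Submodule.sum_mem _ fun j _ => Submodule.smul_mem _ _ (Submodule.subset_span ⟨j, rfl⟩)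
  have he'0 : e' ≠ 0 := by
    intro h0
    apply he
    rw [sub_eq_zero.1 h0]
    exact hsum c₀
  obtain ⟨a, ha0, ha, hx1⟩ := h.exists_smul he'0
  set x := a⁻¹ • e' with hx
  -- This is the minimality of `c₀`, rescaled by `a⁻¹`, where `‖a‖` is the minimal distance.
  have hdist : ∀ c : Fin r → L, 1 ≤ N (x + ∑ i, c i • b i) := by
    intro c
    have h1 : x + ∑ i, c i • b i = a⁻¹ • (e - ∑ i, (c₀ - a • c) i • b i) := by
      simp only [Pi.sub_apply, Pi.smul_apply, sub_smul, Finset.sum_sub_distrib, smul_eq_mul, mul_smul]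
      rw [← Finset.smul_sum, sub_sub_eq_add_sub, add_sub_right_comm, smul_add, smul_smul,
        inv_mul_cancel₀ ha0, one_smul]
    rw [h1, h.smul, norm_inv]
    have h2 := hmin (c₀ - a • c)
    have h3 : F c₀ = ‖a‖ := ha
    rw [h3] at h2
    have ha' : 0 < ‖a‖ := norm_pos_iff.2 ha0
    rw [le_inv_mul_iff₀ ha', mul_one]
    exact h2
  have hxs : x ∉ Submodule.span L (Set.range b) := by
    intro hxs
    obtain ⟨c, hc⟩ := (Submodule.mem_span_range_iff_exists_fun L).1 hxs
    have := hdist (-c)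
    simp only [Pi.neg_apply, neg_smul, Finset.sum_neg_distrib, hc, add_neg_cancel, h.zero] at this
    linarith
  refine ⟨x, ⟨linearIndependent_finSnoc.2 ⟨hb.1, hxs⟩, fun c => ?_⟩, ?_⟩
  · rw [Fin.sum_univ_castSucc]
    simp only [Fin.snoc_castSucc, Fin.snoc_last]
    constructor
    · intro hle
      have hd : ‖c (Fin.last r)‖ ≤ 1 := by
        by_cases hd0 : c (Fin.last r) = 0
        · simp [hd0]
        · have h1 := hdist (fun i => (c (Fin.last r))⁻¹ * c i.castSucc)
          have h2 : ∑ i : Fin r, c i.castSucc • b i + c (Fin.last r) • x =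
              c (Fin.last r) • (x + ∑ i, ((c (Fin.last r))⁻¹ * c i.castSucc) • b i) := by
            simp only [mul_smul]
            rw [← Finset.smul_sum, smul_add, smul_smul (c (Fin.last r)) (c (Fin.last r))⁻¹,
              mul_inv_cancel₀ hd0, one_smul, add_comm]
          rw [h2, h.smul] at hle
          nlinarith [norm_nonneg (c (Fin.last r))]
      have h3 : N (∑ i : Fin r, c i.castSucc • b i) ≤ 1 := by
        have h4 := h.sub_le (∑ i : Fin r, c i.castSucc • b i + c (Fin.last r) • x)
          (c (Fin.last r) • x)
        rw [add_sub_cancel_right] at h4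
        refine h4.trans (max_le hle ?_)
        rw [h.smul, hx1, mul_one]; exact hd
      have h5 := (hb.2 (fun i => c i.castSucc)).1 h3
      exact Fin.lastCases hd h5
    · intro hc
      refine (h.add_le _ _).trans (max_le ((hb.2 _).2 fun i => hc _) ?_)
      rw [h.smul, hx1, mul_one]; exact hc _
  · rw [Fin.range_snoc, Fin.range_snoc, Submodule.span_insert, Submodule.span_insert]
    apply le_antisymm
    · refine sup_le ?_ le_sup_right
      rw [Submodule.span_singleton_le_iff_mem, hx, he', smul_sub]
      exact sub_mem (Submodule.mem_sup_left (Submodule.smul_mem _ _ (Submodule.mem_span_singleton_self e)))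
        (Submodule.mem_sup_right (Submodule.smul_mem _ _ (hsum c₀)))
    · refine sup_le ?_ le_sup_right
      rw [Submodule.span_singleton_le_iff_mem]
      have : e = a • x + ∑ i, c₀ i • b i := by
        rw [hx, smul_smul, mul_inv_cancel₀ ha0, one_smul, he', sub_add_cancel]
      rw [this]
      exact add_mem (Submodule.mem_sup_left (Submodule.smul_mem _ _ (Submodule.mem_span_singleton_self x)))
        (Submodule.mem_sup_right (hsum c₀))

theorem IsUltrametricNorm.localNorm [ProperSpace L] (h : IsUltrametricNorm (fun a : L => ‖a‖) N) :
    LocalNorm (fun a : L => ‖a‖) N (fun _ b => IsUnitBallBasis (fun a : L => ‖a‖) N b)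
      (fun _ => 1) where
  abv_one := norm_one
  abv_mul := norm_mul
  abv_nonneg := norm_nonneg
  abv_pos a ha := norm_pos_iff.2 ha
  det_le s M c hc hM := by rw [one_mul]; exact norm_det_le_of_ultrametric M c hc hM
  indep b hb := hb.1
  le_one b hb i := by
    have := (hb.2 (Pi.single i 1)).2 fun j => by
      by_cases hj : j = i
      · subst hj; simp
      · simp [Pi.single_eq_of_ne hj]
    simpa [Pi.single_apply, ite_smul] using this
  coord_le b hb c i := by rw [hb.norm_eq h]; exact norm_le_pi_norm c i
  norm_eq b b' hb hb' c := by rw [hb.norm_eq h, hb'.norm_eq h]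
  empty b := ⟨linearIndependent_empty_type, fun c => by simp [h.zero]⟩
  extend b hb e he := hb.extend h e he

end FiniteLocalNorm

/-! ### Hermitian norms at the archimedean places -/

section InfiniteLocalNorm

variable {K : Type u} [Field K] {v : InfinitePlace K} {E : Type u} [AddCommGroup E]
  [Module v.Completion E] {N : E → ℝ}

theorem norm_extensionEmbedding (a : v.Completion) :
    ‖InfinitePlace.Completion.extensionEmbedding v a‖ = ‖a‖ := by
  have := (InfinitePlace.Completion.isometry_extensionEmbedding v).dist_eq a 0
  simpa using this

theorem exists_extensionEmbedding_eq_of_im {z : ℂ} (hz : v.IsReal → z.im = 0) :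
    ∃ a : v.Completion, InfinitePlace.Completion.extensionEmbedding v a = z := by
  rcases v.isReal_or_isComplex with hv | hv
  · obtain ⟨a, ha⟩ := InfinitePlace.Completion.surjective_extensionEmbeddingOfIsReal hv z.re
    refine ⟨a, ?_⟩
    rw [← InfinitePlace.Completion.extensionEmbeddingOfIsReal_apply hv, ha]
    exact Complex.ext rfl (hz hv).symm
  · exact InfinitePlace.Completion.surjective_extensionEmbedding_of_isComplex hv z

/-- A hermitian form defining a norm at an archimedean place. -/
theorem IsHermitianNorm.exists_form (h : IsHermitianNorm v N) : ∃ φ : E → E → ℂ,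
    (∀ x y z, φ (x + y) z = φ x z + φ y z) ∧
    (∀ a x y, φ (a • x) y = InfinitePlace.Completion.extensionEmbedding v a * φ x y) ∧
    (∀ x y, φ y x = starRingEnd ℂ (φ x y)) ∧
    (∀ x, x ≠ 0 → 0 < (φ x x).re) ∧
    (∀ x y, ∃ a : v.Completion, InfinitePlace.Completion.extensionEmbedding v a = φ x y) ∧
    (∀ x, N x = √((φ x x).re ^ v.mult)) ∧ ∀ x, 0 ≤ (φ x x).re := by
  obtain ⟨φ, hadd, hsmul, hconj, hpos, hre, hco⟩ := h
  have h0 : ∀ x, 0 ≤ (φ x x).re := by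
    intro x
    by_cases hx : x = 0
    · subst hx
      have := hsmul 0 0 0
      simp at this
      simp [this]
    · exact (hpos x hx).le
  refine ⟨φ, hadd, hsmul, hconj, hpos, fun x y => ?_, fun x => ?_, h0⟩
  · exact exists_extensionEmbedding_eq_of_im fun hv => (hre hv).1 x y
  · rcases v.isReal_or_isComplex with hv | hv
    · rw [(hre hv).2, InfinitePlace.mult_isReal ⟨v, hv⟩, pow_one]
    · rw [hco hv, InfinitePlace.mult_isComplex ⟨v, hv⟩, Real.sqrt_sq (h0 x)]

theorem sqrt_pow_mult_inj {a b : ℝ} (ha : 0 ≤ a) (hb : 0 ≤ b) :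
    √(a ^ v.mult) = √(b ^ v.mult) ↔ a = b := by
  rw [Real.sqrt_inj (pow_nonneg ha _) (pow_nonneg hb _)]
  exact pow_left_inj₀ ha hb v.mult_pos.ne'

theorem IsHermitianNorm.smul (h : IsHermitianNorm v N) (a : v.Completion) (y : E) :
    N (a • y) = ‖a‖ ^ v.mult * N y := by
  obtain ⟨φ, hadd, hsmul, hconj, hpos, hex, hN, h0⟩ := h.exists_form
  rw [hN, hN]
  have : (φ (a • y) (a • y)).re = ‖a‖ ^ 2 * (φ y y).re := by
    rw [hsmul, hconj (a • y) y, hsmul, map_mul, ← hconj y y, ← mul_assoc, Complex.mul_conj,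
      Complex.re_ofReal_mul, Complex.normSq_eq_norm_sq, norm_extensionEmbedding]
  rw [this, mul_pow, Real.sqrt_mul (by positivity), ← pow_mul, mul_comm 2, pow_mul,
    Real.sqrt_sq (by positivity)]

theorem IsHermitianNorm.pos (h : IsHermitianNorm v N) {y : E} (hy : y ≠ 0) : 0 < N y := by
  obtain ⟨φ, hadd, hsmul, hconj, hpos, hex, hN, h0⟩ := h.exists_form
  rw [hN]
  exact Real.sqrt_pos.2 (pow_pos (hpos y hy) _)

/-- Gram–Schmidt for the form `φ`. Orthonormality is known for `N` only, so the values of `φ` on `b`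
are recovered beforehand by polarisation. -/
theorem IsHermitianNorm.extend (h : IsHermitianNorm v N) {r : ℕ} (b : Fin r → E)
    (hb : IsOrthonormalFamily v N b) (e : E)
    (he : e ∉ Submodule.span v.Completion (Set.range b)) :
    ∃ x, IsOrthonormalFamily v N (Fin.snoc b x : Fin (r + 1) → E) ∧
      Submodule.span v.Completion (Set.range (Fin.snoc b x : Fin (r + 1) → E)) =
        Submodule.span v.Completion (Set.range (Fin.snoc b e : Fin (r + 1) → E)) := by
  obtain ⟨φ, hadd, hsmul, hconj, hpos, hex, hN, h0⟩ := h.exists_form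
  let σ := InfinitePlace.Completion.extensionEmbedding v
  have hadd' : ∀ x y z, φ x (y + z) = φ x y + φ x z := by
    intro x y z
    rw [hconj (y + z) x, hadd, map_add, ← hconj, ← hconj]
  have hsmul' : ∀ a x y, φ x (a • y) = starRingEnd ℂ (σ a) * φ x y := by
    intro a x y
    rw [hconj (a • y) x, hsmul, map_mul, ← hconj]
  have hq : ∀ c : Fin r → v.Completion,
      (φ (∑ i, c i • b i) (∑ i, c i • b i)).re = ∑ i, ‖c i‖ ^ 2 := by
    intro c
    have := hb c
    rw [hN] at this
    exact (sqrt_pow_mult_inj (v := v) (h0 _) (Finset.sum_nonneg fun i _ => by positivity)).1 this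
  have hself : ∀ i, φ (b i) (b i) = 1 := by
    intro i
    have h1 := hq (Pi.single i 1)
    have h2 : ∑ j, (Pi.single i 1 : Fin r → v.Completion) j • b j = b i := by
      simp [Pi.single_apply, ite_smul]
    rw [h2] at h1
    have h3 : ∑ j, ‖(Pi.single i 1 : Fin r → v.Completion) j‖ ^ 2 = 1 := by
      rw [Finset.sum_eq_single i]
      · simp
      · intro j _ hj; simp [Pi.single_eq_of_ne hj]
      · simp
    rw [h3] at h1
    have h4 : (φ (b i) (b i)).im = 0 := Complex.conj_eq_iff_im.1 (hconj (b i) (b i)).symm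
    exact Complex.ext h1 h4
  have horth : ∀ i j, i ≠ j → φ (b i) (b j) = 0 := by
    intro i j hij
    -- With `a` mapped to `φ (b i) (b j)`, both cross terms in the square of `b i + a • b j` equal
    -- `‖a‖ ^ 2`. Since the square is `1 + ‖a‖ ^ 2`, they vanish.
    obtain ⟨a, ha⟩ := hex (b i) (b j)
    have h1 := hq (Pi.single i 1 + Pi.single j a)
    have h2 : ∑ k, (Pi.single i 1 + Pi.single j a : Fin r → v.Completion) k • b k =
        b i + a • b j := by
      simp [Pi.single_apply, ite_smul, add_smul, Finset.sum_add_distrib]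
    have h3 : ∑ k, ‖(Pi.single i 1 + Pi.single j a : Fin r → v.Completion) k‖ ^ 2 =
        1 + ‖a‖ ^ 2 := by
      have : ∀ k, ‖(Pi.single i 1 + Pi.single j a : Fin r → v.Completion) k‖ ^ 2 =
          (if k = i then 1 else 0) + (if k = j then ‖a‖ ^ 2 else 0) := by
        intro k
        by_cases hk : k = i
        · subst hk; simp [hij]
        · by_cases hk' : k = j
          · subst hk'; simp [hk]
          · simp [hk, hk']
      simp_rw [this, Finset.sum_add_distrib]
      simp
    rw [h2, h3, hadd, hadd', hadd', hsmul', hsmul, hsmul, hsmul', hself, hself, hconj (b i) (b j),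
      show σ a = φ (b i) (b j) from ha] at h1
    rw [← norm_extensionEmbedding a, ha, ← Complex.normSq_eq_norm_sq] at h1
    rw [mul_comm (starRingEnd ℂ (φ (b i) (b j))) (φ (b i) (b j)), mul_one, Complex.mul_conj] at h1
    simp at h1
    exact h1
  choose a ha using fun i => hex e (b i)
  set e' := e - ∑ i, a i • b i with he'
  have hsum : ∀ c : Fin r → v.Completion,
      ∑ i, c i • b i ∈ Submodule.span v.Completion (Set.range b) := fun c =>
    Submodule.sum_mem _ fun j _ => Submodule.smul_mem _ _ (Submodule.subset_span ⟨j, rfl⟩)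
  have hφsum : ∀ (c : Fin r → v.Completion) y, φ (∑ i, c i • b i) y = ∑ i, σ (c i) * φ (b i) y := by
    intro c y
    let ψ : E →+ ℂ := AddMonoidHom.mk' (fun x => φ x y) fun x x' => hadd x x' y
    have : ψ (∑ i, c i • b i) = ∑ i, ψ (c i • b i) := map_sum ψ _ _
    refine this.trans (Finset.sum_congr rfl fun i _ => hsmul _ _ _)
  have he'b : ∀ j, φ e' (b j) = 0 := by
    intro j
    have h1 : φ e (b j) = φ e' (b j) + φ (∑ i, a i • b i) (b j) := by
      rw [← hadd, he', sub_add_cancel]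
    rw [hφsum, Finset.sum_eq_single j, hself, mul_one, show σ (a j) = φ e (b j) from ha j] at h1
    · simpa using h1
    · intro i _ hij; rw [horth i j hij, mul_zero]
    · simp
  have he'0 : e' ≠ 0 := by
    intro h0'
    apply he
    rw [sub_eq_zero.1 h0']
    exact hsum a
  have hqe := hpos e' he'0
  -- The normalising factor is a real number, so it comes from the completion even at a real place.
  obtain ⟨d, hd⟩ := exists_extensionEmbedding_eq_of_im (v := v) (z := ((√(φ e' e').re)⁻¹ : ℝ))
    fun _ => Complex.ofReal_im _
  have hd0 : d ≠ 0 := by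
    rintro rfl
    rw [map_zero] at hd
    have := Complex.ofReal_eq_zero.1 hd.symm
    rw [inv_eq_zero, Real.sqrt_eq_zero hqe.le] at this
    linarith
  set x := d • e' with hx
  have hxb : ∀ j, φ x (b j) = 0 := fun j => by rw [hx, hsmul, he'b, mul_zero]
  have hxx : (φ x x).re = 1 := by
    rw [hx, hsmul, hsmul', show σ d = _ from hd, ← mul_assoc, Complex.conj_ofReal,
      ← Complex.ofReal_mul, Complex.re_ofReal_mul, ← mul_inv, Real.mul_self_sqrt hqe.le,
      inv_mul_cancel₀ hqe.ne']
  refine ⟨x, fun c => ?_, ?_⟩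
  · rw [Fin.sum_univ_castSucc, Fin.sum_univ_castSucc]
    simp only [Fin.snoc_castSucc, Fin.snoc_last]
    rw [hN]
    congr 2
    set z := ∑ i : Fin r, c i.castSucc • b i with hz
    have hzx : φ z x = 0 := by
      rw [hz, hφsum]
      refine Finset.sum_eq_zero fun i _ => ?_
      rw [hconj x (b i), hxb, map_zero, mul_zero]
    have hxz : φ x z = 0 := by rw [hconj z x, hzx, map_zero]
    rw [hadd, hadd', hadd', hsmul' _ z x, hsmul _ x z, hsmul _ x (c (Fin.last r) • x), hsmul' _ x x,
      hzx, hxz]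
    simp only [mul_zero, add_zero, zero_add, Complex.add_re]
    rw [hq, ← mul_assoc, show InfinitePlace.Completion.extensionEmbedding v (c (Fin.last r)) =
      σ (c (Fin.last r)) from rfl, Complex.mul_conj, Complex.re_ofReal_mul, hxx, mul_one,
      Complex.normSq_eq_norm_sq, norm_extensionEmbedding]
  · rw [Fin.range_snoc, Fin.range_snoc, Submodule.span_insert, Submodule.span_insert]
    apply le_antisymm
    · refine sup_le ?_ le_sup_right
      rw [Submodule.span_singleton_le_iff_mem, hx, he', smul_sub]
      exact sub_mem (Submodule.mem_sup_left (Submodule.smul_mem _ _ (Submodule.mem_span_singleton_self e)))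
        (Submodule.mem_sup_right (Submodule.smul_mem _ _ (hsum a)))
    · refine sup_le ?_ le_sup_right
      rw [Submodule.span_singleton_le_iff_mem]
      have : e = d⁻¹ • x + ∑ i, a i • b i := by
        rw [hx, smul_smul, inv_mul_cancel₀ hd0, one_smul, he', sub_add_cancel]
      rw [this]
      exact add_mem (Submodule.mem_sup_left (Submodule.smul_mem _ _ (Submodule.mem_span_singleton_self x)))
        (Submodule.mem_sup_right (hsum a))

theorem sqrt_norm_sq_pow (a : v.Completion) : √((‖a‖ ^ 2) ^ v.mult) = ‖a‖ ^ v.mult := by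
  rw [← pow_mul, mul_comm 2, pow_mul, Real.sqrt_sq (by positivity)]

theorem IsHermitianNorm.localNorm (h : IsHermitianNorm v N) :
    LocalNorm (fun a : v.Completion => ‖a‖ ^ v.mult) N
      (fun _ b => IsOrthonormalFamily v N b) (fun s => (s.factorial : ℝ) ^ v.mult) where
  abv_one := by simp
  abv_mul a b := by rw [norm_mul, mul_pow]
  abv_nonneg a := by positivity
  abv_pos a ha := pow_pos (norm_pos_iff.2 ha) _
  det_le s M c hc hM := by
    have hm := v.mult_pos
    -- At a complex place the normalised absolute value is a square and has no triangle inequality.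
    -- Taking the root of `c` reduces the bound to the modulus, where the expansion of the
    -- determinant into `s !` terms applies.
    set d : ℝ := c ^ ((v.mult : ℝ)⁻¹) with hd
    have hd0 : 0 ≤ d := Real.rpow_nonneg hc _
    have hdc : d ^ v.mult = c := Real.rpow_inv_natCast_pow hc hm.ne'
    have hM' : ∀ i j, NormedField.toAbsoluteValue v.Completion (M i j) ≤ d := fun i j => by
      refine le_of_pow_le_pow_left₀ hm.ne' hd0 ?_
      rw [hdc]; exact hM i j
    have := Matrix.det_le hM'
    simp only [Fintype.card_fin, nsmul_eq_mul] at this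
    calc ‖M.det‖ ^ v.mult ≤ ((s.factorial : ℝ) * d ^ s) ^ v.mult :=
          pow_le_pow_left₀ (norm_nonneg _) this _
      _ = (s.factorial : ℝ) ^ v.mult * c ^ s := by
          rw [mul_pow, ← pow_mul, mul_comm s, pow_mul, hdc]
  indep b hb := by
    rw [Fintype.linearIndependent_iff]
    intro c hc i
    have h1 := hb c
    have h2 := hb 0
    simp only [Pi.zero_apply, zero_smul, Finset.sum_const_zero] at h2
    rw [hc, h2] at h1
    simp only [norm_zero, ne_eq, OfNat.ofNat_ne_zero, not_false_eq_true, zero_pow,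
      Finset.sum_const_zero] at h1
    rw [sqrt_pow_mult_inj le_rfl (Finset.sum_nonneg fun i _ => by positivity)] at h1
    have h3 := (Finset.sum_eq_zero_iff_of_nonneg (fun i _ => by positivity)).1 h1.symm i
      (Finset.mem_univ i)
    simpa using h3
  le_one b hb i := by
    have h1 := hb (Pi.single i 1)
    have h2 : ∑ j, (Pi.single i 1 : Fin _ → v.Completion) j • b j = b i := by
      simp [Pi.single_apply, ite_smul]
    have h3 : ∑ j, ‖(Pi.single i 1 : Fin _ → v.Completion) j‖ ^ 2 = 1 := by
      rw [Finset.sum_eq_single i]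
      · simp
      · intro j _ hj; simp [Pi.single_eq_of_ne hj]
      · simp
    rw [h2, h3] at h1
    simp [h1]
  coord_le b hb c i := by
    rw [hb c, ← sqrt_norm_sq_pow]
    refine Real.sqrt_le_sqrt (pow_le_pow_left₀ (by positivity) ?_ _)
    exact Finset.single_le_sum (f := fun i => ‖c i‖ ^ 2) (fun _ _ => by positivity) (Finset.mem_univ i)
  norm_eq b b' hb hb' c := by rw [hb c, hb' c]
  empty b c := by
    obtain ⟨φ, hadd, hsmul, hconj, hpos, hex, hN, h0⟩ := h.exists_form
    have := hsmul 0 0 0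
    simp only [zero_smul, map_zero, zero_mul] at this
    simp [hN, this]
  extend b hb e he := h.extend b hb e he

end InfiniteLocalNorm

/-! ### Local compactness of the completions -/

section Completions

variable {K : Type u} [Field K] [NumberField K] (w : HeightOneSpectrum (𝓞 K))

theorem norm_adicCompletion_le_one_iff (x : w.adicCompletion K) :
    ‖x‖ ≤ 1 ↔ x ∈ w.adicCompletionIntegers K :=
  Valued.toNormedField.norm_le_one_iff

theorem norm_algebraMap_lt_one_iff (k : K) :
    ‖algebraMap K (w.adicCompletion K) k‖ < 1 ↔ w.valuation K k < 1 := by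
  rw [← HeightOneSpectrum.valuedAdicCompletion_eq_valuation' w k]
  exact Valued.toNormedField.norm_lt_one_iff

theorem norm_algebraMap_le_one_iff (k : K) :
    ‖algebraMap K (w.adicCompletion K) k‖ ≤ 1 ↔ w.valuation K k ≤ 1 := by
  rw [← HeightOneSpectrum.valuedAdicCompletion_eq_valuation' w k]
  exact Valued.toNormedField.norm_le_one_iff

theorem norm_sub_le_max_of_ultrametric {L : Type*} [NormedField L] [IsUltrametricDist L]
    (x y : L) : ‖x - y‖ ≤ max ‖x‖ ‖y‖ := by
  rw [sub_eq_add_neg, ← norm_neg y]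
  exact IsUltrametricDist.norm_add_le_max _ _

/-- First `x` is approximated by an element of `K`, which is integral at `w` by the ultrametric
inequality, then this element by an algebraic integer. This makes the residue field a quotient of
the finite ring of algebraic integers modulo `w`. -/
theorem exists_norm_sub_lt_one (x : w.adicCompletion K) (hx : ‖x‖ ≤ 1) :
    ∃ n : 𝓞 K, ‖x - algebraMap K (w.adicCompletion K) n‖ < 1 := by
  have hd : DenseRange (algebraMap K (w.adicCompletion K)) :=
    HeightOneSpectrum.denseRange_algebraMap K w
  obtain ⟨k, hk⟩ := Metric.denseRange_iff.1 hd x 1 one_pos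
  rw [dist_eq_norm] at hk
  have hk1 : ‖algebraMap K (w.adicCompletion K) k‖ ≤ 1 := by
    have := norm_sub_le_max_of_ultrametric x (x - algebraMap K (w.adicCompletion K) k)
    rw [sub_sub_cancel] at this
    exact this.trans (max_le hx hk.le)
  obtain ⟨n, hn⟩ := w.exists_valuation_sub_lt_of_integer
    ((norm_algebraMap_le_one_iff w k).1 hk1) 1
  refine ⟨n, ?_⟩
  have hn' := (norm_algebraMap_lt_one_iff w _).2 hn
  have h2 : x - algebraMap K (w.adicCompletion K) k - (algebraMap K (w.adicCompletion K)
      (algebraMap (𝓞 K) K n) - algebraMap K (w.adicCompletion K) k) =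
      x - algebraMap K (w.adicCompletion K) (algebraMap (𝓞 K) K n) := by ring
  rw [← map_sub] at h2
  have h3 := norm_sub_le_max_of_ultrametric (x - algebraMap K (w.adicCompletion K) k)
    (algebraMap K (w.adicCompletion K) (algebraMap (𝓞 K) K n - k))
  rw [h2] at h3
  exact h3.trans_lt (max_lt hk hn')

theorem mem_maximalIdeal_adicCompletionIntegers_iff (x : w.adicCompletionIntegers K) :
    x ∈ maximalIdeal (w.adicCompletionIntegers K) ↔ ‖(x : w.adicCompletion K)‖ < 1 := by
  rw [Valued.toNormedField.norm_lt_one_iff]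
  exact Valuation.mem_maximalIdeal_iff _ _

theorem finite_residueField_adicCompletion :
    Finite (ResidueField (w.adicCompletionIntegers K)) := by
  let f : 𝓞 K →+* ResidueField (w.adicCompletionIntegers K) :=
    (residue (w.adicCompletionIntegers K)).comp (algebraMap (𝓞 K) (w.adicCompletionIntegers K))
  have hf : ∀ a ∈ w.asIdeal, f a = 0 := by
    intro a ha
    refine (residue_eq_zero_iff _).2 ((mem_maximalIdeal_adicCompletionIntegers_iff w _).2 ?_)
    exact (FinitePlace.norm_lt_one_iff_mem K w a).2 ha
  have hfin : Finite (𝓞 K ⧸ w.asIdeal) := w.asIdeal.finiteQuotientOfFreeOfNeBot w.ne_bot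
  refine Finite.of_surjective (Ideal.Quotient.lift w.asIdeal f hf) ?_
  refine Ideal.Quotient.lift_surjective_of_surjective _ _ fun z => ?_
  obtain ⟨x, rfl⟩ := residue_surjective z
  obtain ⟨n, hn⟩ := exists_norm_sub_lt_one w (x : w.adicCompletion K)
    ((norm_adicCompletion_le_one_iff w _).2 x.2)
  refine ⟨n, ?_⟩
  symm
  rw [← sub_eq_zero]
  change residue _ _ - residue _ _ = 0
  rw [← map_sub, residue_eq_zero_iff, mem_maximalIdeal_adicCompletionIntegers_iff]
  exact hn

/-- Local compactness is used twice: to attain distances in the ultrametric Gram–Schmidt process,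
and to bound tangent maps at a fixed place. -/
instance : ProperSpace (w.adicCompletion K) := by
  have h1 : IsDiscreteValuationRing (Valued.integer (w.adicCompletion K)) :=
    inferInstanceAs (IsDiscreteValuationRing (w.adicCompletionIntegers K))
  have h2 := finite_residueField_adicCompletion w
  exact Valued.integer.properSpace_iff_completeSpace_and_isDiscreteValuationRing_integer_and_finite_residueField.2
    ⟨inferInstance, h1, h2⟩

instance (v : InfinitePlace K) : ProperSpace v.Completion := by
  let _ : NontriviallyNormedField v.Completion :=
    { non_trivial := by
        refine ⟨2, ?_⟩
        rw [← norm_extensionEmbedding, map_ofNat]; norm_num }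
  exact ProperSpace.of_nontriviallyNormedField_of_weaklyLocallyCompactSpace v.Completion

end Completions

end

section

/-! ### Bases adapted to subspaces and to surjective maps -/

section LinearAlgebra

variable {k V W : Type*} [Field k] [AddCommGroup V] [Module k V] [AddCommGroup W] [Module k W]

theorem linearIndependent_coe_basis {ι : Type*} {F : Submodule k V} (b : Module.Basis ι k F) :
    LinearIndependent k fun i => (b i : V) :=
  b.linearIndependent.map' F.subtype (Submodule.ker_subtype F)

theorem span_coe_basis {ι : Type*} {F : Submodule k V} (b : Module.Basis ι k F) :
    Submodule.span k (Set.range fun i => (b i : V)) = F := by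
  have h1 : Set.range (fun i => (b i : V)) = F.subtype '' Set.range b := by
    rw [← Set.range_comp]; rfl
  rw [h1, ← Submodule.map_span, b.span_eq, Submodule.map_subtype_top]

theorem exists_basis_family [FiniteDimensional k V] (F : Submodule k V) :
    ∃ e : Fin (Module.finrank k F) → V, LinearIndependent k e ∧
      Submodule.span k (Set.range e) = F :=
  ⟨_, linearIndependent_coe_basis (Module.finBasis k F), span_coe_basis _⟩

theorem nonempty_basis {r : ℕ} {e : Fin r → V} (he : LinearIndependent k e) {F : Submodule k V}
    (hF : Submodule.span k (Set.range e) = F) : Nonempty (Module.Basis (Fin r) k F) :=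
  ⟨(Module.Basis.span he).map (LinearEquiv.ofEq _ _ hF)⟩

theorem span_range_append {r s : ℕ} (u : Fin r → V) (v : Fin s → V) :
    Submodule.span k (Set.range (Fin.append u v)) =
      Submodule.span k (Set.range u) ⊔ Submodule.span k (Set.range v) := by
  rw [← Submodule.span_union]
  congr 1
  ext y
  constructor
  · rintro ⟨i, rfl⟩
    refine Fin.addCases (fun i => ?_) (fun i => ?_) i
    · left; exact ⟨i, by simp⟩
    · right; exact ⟨i, by simp⟩
  · rintro (⟨i, rfl⟩ | ⟨i, rfl⟩)
    · exact ⟨Fin.castAdd s i, by simp⟩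
    · exact ⟨Fin.natAdd r i, by simp⟩

theorem linearIndependent_append {r s : ℕ} {u : Fin r → V} {v : Fin s → V}
    (hu : LinearIndependent k u) (hv : LinearIndependent k v)
    (h : Disjoint (Submodule.span k (Set.range u)) (Submodule.span k (Set.range v))) :
    LinearIndependent k (Fin.append u v) := by
  have h1 := hu.sum_type hv h
  have h2 : Fin.append u v = Sum.elim u v ∘ finSumFinEquiv.symm := by
    funext i
    refine Fin.addCases (fun i => ?_) (fun i => ?_) i <;> simp
  rw [h2]
  exact h1.comp _ finSumFinEquiv.symm.injective

/-- The added vectors are taken in a prescribed spanning set `t`. When `t` is a fixed basis, their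
norms are bounded independently of `e`, which is how the degrees of all subspaces get a common
bound. -/
theorem exists_append_basis [FiniteDimensional k V] {r : ℕ} (e : Fin r → V)
    (he : LinearIndependent k e) (t : Set V) (ht : Submodule.span k t = ⊤) :
    ∃ (s : ℕ) (f : Fin s → V), (∀ i, f i ∈ t) ∧ LinearIndependent k (Fin.append e f) ∧
      Submodule.span k (Set.range (Fin.append e f)) = ⊤ := by
  have hs : LinearIndepOn k id (Set.range e) := he.linearIndepOn_id
  obtain ⟨b, hbt, hsb, htb, hb⟩ := exists_linearIndepOn_id_extension hs
    (Set.subset_union_left (t := t))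
  have hbfin : b.Finite := LinearIndependent.setFinite hb
  have hfin : (b \ Set.range e).Finite := hbfin.subset Set.sdiff_subset
  have : Fintype ↑(b \ Set.range e) := hfin.fintype
  let q := Fintype.equivFin ↑(b \ Set.range e)
  let f : Fin (Fintype.card ↑(b \ Set.range e)) → V := fun i => (q.symm i).1
  have hfb : ∀ i, f i ∈ b \ Set.range e := fun i => (q.symm i).2
  have hmem : ∀ i, Fin.append e f i ∈ b := by
    intro i
    refine Fin.addCases (fun i => ?_) (fun i => ?_) i
    · rw [Fin.append_left]; exact hsb ⟨i, rfl⟩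
    · rw [Fin.append_right]; exact (hfb i).1
  have hinj : Function.Injective (fun i => (⟨Fin.append e f i, hmem i⟩ : b)) := by
    intro i j hij
    have hij' : Fin.append e f i = Fin.append e f j := congrArg Subtype.val hij
    revert hij'
    refine Fin.addCases (fun i => ?_) (fun i => ?_) i <;>
      refine Fin.addCases (fun j => ?_) (fun j => ?_) j
    · rw [Fin.append_left, Fin.append_left]
      intro h; rw [he.injective h]
    · rw [Fin.append_left, Fin.append_right]
      intro h; exact ((hfb j).2 ⟨i, h⟩).elim
    · rw [Fin.append_left, Fin.append_right]
      intro h; exact ((hfb i).2 ⟨j, h.symm⟩).elim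
    · rw [Fin.append_right, Fin.append_right]
      intro h; rw [q.symm.injective (Subtype.ext h)]
  refine ⟨_, f, fun i => ?_, ?_, ?_⟩
  · rcases hbt (hfb i).1 with h | h
    · exact ((hfb i).2 h).elim
    · exact h
  · exact LinearIndependent.comp hb _ hinj
  · rw [eq_top_iff, ← ht, Submodule.span_le]
    intro x hx
    refine (Submodule.span_mono ?_) (htb (Or.inr hx))
    intro y hy
    by_cases hye : y ∈ Set.range e
    · obtain ⟨i, rfl⟩ := hye
      exact ⟨Fin.castAdd _ i, by simp⟩
    · exact ⟨Fin.natAdd _ (q ⟨y, hy, hye⟩), by simp [f]⟩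

/-- A basis of the inverse image of a subspace under a surjective map, extended to a basis of the
whole space. -/
theorem exists_adapted_bases [FiniteDimensional k V] [FiniteDimensional k W] (T : V →ₗ[k] W)
    (hT : Function.Surjective T) {t : ℕ} (g : Fin t → W) (hg : LinearIndependent k g) :
    ∃ (r s : ℕ) (e : Fin r → V) (f : Fin s → V), LinearIndependent k e ∧
      Submodule.span k (Set.range e) = (Submodule.span k (Set.range g)).comap T ∧
      LinearIndependent k (Fin.append e f) ∧
      Submodule.span k (Set.range (Fin.append e f)) = ⊤ ∧
      LinearIndependent k (Fin.append g fun i => T (f i)) ∧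
      Submodule.span k (Set.range (Fin.append g fun i => T (f i))) = ⊤ := by
  obtain ⟨s, g', -, hgg, hspan⟩ := exists_append_basis g hg Set.univ (by simp)
  -- The family `g'` spans a complement of the span of `g`. Its lifts `f` span a complement of the
  -- inverse image, so that both quotients have compatible bases.
  choose f hf using fun i => hT (g' i)
  have hTf : (fun i => T (f i)) = g' := funext hf
  let F := (Submodule.span k (Set.range g)).comap T
  obtain ⟨b, hbi, hb⟩ := exists_basis_family F
  refine ⟨_, s, b, f, hbi, hb, ?_, ?_, by rwa [hTf], by rwa [hTf]⟩
  · have hg' : LinearIndependent k g' := by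
      have := hgg.comp (Fin.natAdd t) (Fin.natAdd_injective _ _)
      convert this using 1
      funext i; simp
    have hdis : Disjoint (Submodule.span k (Set.range g)) (Submodule.span k (Set.range g')) := by
      have := hgg.disjoint_span_image (s := Set.range (Fin.castAdd s)) (t := Set.range (Fin.natAdd t))
        (by
          rw [Set.disjoint_left]
          rintro _ ⟨i, rfl⟩ ⟨j, hj⟩
          have := congrArg Fin.val hj
          simp at this
          have := i.2
          omega)
      rw [← Set.range_comp, ← Set.range_comp] at this
      convert this using 3
      · funext i; simp
      · funext i; simp
    refine linearIndependent_append
      hbi ?_ ?_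
    · refine LinearIndependent.of_comp T ?_
      convert hg' using 1
      exact hTf
    · rw [hb, Submodule.disjoint_def]
      intro x hx hxf
      obtain ⟨c, rfl⟩ := (Submodule.mem_span_range_iff_exists_fun k).1 hxf
      have h2 : T (∑ i, c i • f i) = ∑ i, c i • g' i := by simp [hf]
      have h3 : ∑ i, c i • g' i = 0 := by
        refine (Submodule.disjoint_def.1 hdis) _ ?_ ?_
        · rw [← h2]; exact hx
        · exact Submodule.sum_mem _ fun j _ => Submodule.smul_mem _ _ (Submodule.subset_span ⟨j, rfl⟩)
      have h4 := Fintype.linearIndependent_iff.1 hg' c h3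
      simp [h4]
  · rw [span_range_append, hb, eq_top_iff]
    intro x _
    have hx : T x ∈ Submodule.span k (Set.range (Fin.append g g')) := hspan ▸ Submodule.mem_top
    rw [span_range_append, Submodule.mem_sup] at hx
    obtain ⟨y, hy, z, hz, hyz⟩ := hx
    obtain ⟨c, rfl⟩ := (Submodule.mem_span_range_iff_exists_fun k).1 hz
    have h2 : T (∑ i, c i • f i) = ∑ i, c i • g' i := by simp [hf]
    rw [Submodule.mem_sup]
    refine ⟨x - ∑ i, c i • f i, ?_, ∑ i, c i • f i, ?_, by abel⟩
    · change T (x - ∑ i, c i • f i) ∈ Submodule.span k (Set.range g)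
      rw [map_sub, h2, ← hyz, add_sub_cancel_right]
      exact hy
    · exact Submodule.sum_mem _ fun j _ => Submodule.smul_mem _ _ (Submodule.subset_span ⟨j, rfl⟩)

end LinearAlgebra

/-! ### Extension of scalars for tangent vectors -/

section BaseChange

variable {K : Type u} [Field K] {X Y : Scheme.{u}} {p : X ⟶ Spec (.of K)}
  {L : Type u} [Field L] [Algebra K L]

theorem stalkSpecializes_baseChange_surjective (P : Point p K) :
    Function.Surjective (X.presheaf.stalkSpecializes (pt_specializes (L := L) P)) := by
  intro a
  obtain ⟨U, hU, s, rfl⟩ := X.presheaf.exists_germ_eq a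
  have hU' : (P.baseChange L).pt ∈ U := by
    have h : (Spec.map (CommRingCat.ofHom (algebraMap K L))) (closedPoint L) = closedPoint K :=
      Subsingleton.elim (α := PrimeSpectrum K) _ _
    have : (P.baseChange L).pt = P.pt := congrArg (fun z => P.1 z) h
    rw [this]; exact hU
  exact ⟨X.presheaf.germ U _ hU' s,
    congrArg (fun f => f.hom s) (X.presheaf.germ_stalkSpecializes hU' (pt_specializes P))⟩

theorem Tangent.baseChange_sum {P : Point p K} {ι : Type*} (s : Finset ι) (c : ι → K)
    (e : ι → Tangent P) :
    Tangent.baseChange (∑ i ∈ s, c i • e i) L =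
      ∑ i ∈ s, algebraMap K L (c i) • Tangent.baseChange (e i) L := by
  classical
  have hadd : ∀ D D' : Tangent P, Tangent.baseChange (D + D') L =
      Tangent.baseChange D L + Tangent.baseChange D' L := fun D D' =>
    Subtype.ext (funext fun a => map_add (algebraMap K L) _ _)
  have hsmul : ∀ (c : K) (D : Tangent P), Tangent.baseChange (c • D) L =
      algebraMap K L c • Tangent.baseChange D L := fun c D =>
    Subtype.ext (funext fun a => map_mul (algebraMap K L) _ _)
  have hzero : Tangent.baseChange (0 : Tangent P) L = 0 :=
    Subtype.ext (funext fun a => map_zero (algebraMap K L))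
  induction s using Finset.induction_on with
  | empty => simpa using hzero
  | insert a s ha ih => rw [Finset.sum_insert ha, Finset.sum_insert ha, hadd, hsmul, ih]

/-- The base-changed derivations take values in `K`, so a `K`-linear form on `L` applied to the
coefficients of a relation gives a relation over `K`. Such forms separate the elements of `L`. -/
theorem Tangent.linearIndependent_baseChange {P : Point p K} {r : ℕ} {e : Fin r → Tangent P}
    (he : LinearIndependent K e) : LinearIndependent L fun i => Tangent.baseChange (e i) L := by
  rw [Fintype.linearIndependent_iff]
  intro c hc i
  rw [← Module.forall_dual_apply_eq_zero_iff K (c i)]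
  intro l
  have h1 : ∑ j, l (c j) • e j = 0 := by
    refine Subtype.ext (funext fun a => ?_)
    obtain ⟨a, rfl⟩ := stalkSpecializes_baseChange_surjective (L := L) P a
    have h2 := congrFun (congrArg Subtype.val hc) a
    simp only [AddSubmonoidClass.coe_finsetSum, Finset.sum_apply, SetLike.val_smul, Pi.smul_apply] at h2 ⊢
    have h3 := congrArg l h2
    rw [map_sum] at h3
    simp only [ZeroMemClass.coe_zero, Pi.zero_apply, map_zero] at h3 ⊢
    rw [← h3]
    refine Finset.sum_congr rfl fun j _ => ?_
    change l (c j) * (e j).1 _ = l (c j * algebraMap K L ((e j).1 _))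
    rw [mul_comm (c j), ← Algebra.smul_def, map_smul, smul_eq_mul, mul_comm]
  exact Fintype.linearIndependent_iff.1 he _ h1 i

end BaseChange

/-! ### Product formula -/

section ProductFormula

variable {K : Type u} [Field K] [NumberField K]

theorem finite_norm_ne_one {x : K} (hx : x ≠ 0) :
    {w : HeightOneSpectrum (𝓞 K) | ‖algebraMap K (w.adicCompletion K) x‖ ≠ 1}.Finite := by
  have h := FinitePlace.hasFiniteMulSupport hx
  refine Set.Finite.of_finite_image (f := FinitePlace.mk) (h.subset ?_) ?_
  · rintro _ ⟨w, hw, rfl⟩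
    exact hw
  · intro w _ w' _ hww
    exact FinitePlace.mk_eq_iff.1 hww

theorem finite_one_lt_norm (x : K) :
    {w : HeightOneSpectrum (𝓞 K) | ¬ ‖algebraMap K (w.adicCompletion K) x‖ ≤ 1}.Finite := by
  by_cases hx : x = 0
  · subst hx; simp
  · refine (finite_norm_ne_one hx).subset fun w hw h => hw h.le

theorem eventually_norm_le_one (x : K) : ∀ᶠ w : HeightOneSpectrum (𝓞 K) in cofinite,
    ‖algebraMap K (w.adicCompletion K) x‖ ≤ 1 := finite_one_lt_norm x

/-- The product formula, in additive form. -/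
theorem sum_log_norm_eq_zero {x : K} (hx : x ≠ 0) :
    (∑ᶠ w : HeightOneSpectrum (𝓞 K), Real.log ‖algebraMap K (w.adicCompletion K) x‖) +
      ∑ v : InfinitePlace K, Real.log (‖algebraMap K v.Completion x‖ ^ v.mult) = 0 := by
  have h := prod_abs_eq_one hx
  have hpos : ∀ w : HeightOneSpectrum (𝓞 K), 0 < ‖algebraMap K (w.adicCompletion K) x‖ :=
    fun w => norm_pos_iff.2 ((map_ne_zero _).2 hx)
  have h1 : ∏ᶠ w : FinitePlace K, w x =
      ∏ᶠ w : HeightOneSpectrum (𝓞 K), ‖algebraMap K (w.adicCompletion K) x‖ := by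
    rw [← finprod_comp_equiv FinitePlace.equivHeightOneSpectrum.symm]
    rfl
  have h2 : ∀ v : InfinitePlace K, ‖algebraMap K v.Completion x‖ = v x := by
    intro v
    exact InfinitePlace.Completion.norm_coe v ((WithAbs.equiv v.1).symm x)
  have hfin := finite_norm_ne_one hx
  rw [h1, finprod_eq_prod_of_mulSupport_subset (s := hfin.toFinset) _ (by
    intro w hw; simpa using hw)] at h
  rw [finsum_eq_sum_of_support_subset (s := hfin.toFinset) _ (by
    intro w hw
    simp only [Set.Finite.coe_toFinset]
    intro h'
    exact hw (by simp [h']))]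
  simp only [h2]
  have h3 := congrArg Real.log h
  rw [Real.log_one, Real.log_mul, Real.log_prod, Real.log_prod] at h3
  · rw [add_comm]; exact h3
  · exact fun w _ => (hpos w).ne'
  · intro v _; exact pow_ne_zero _ ((map_ne_zero v).2 hx)
  · exact Finset.prod_ne_zero_iff.2 fun v _ => pow_ne_zero _ ((map_ne_zero v).2 hx)
  · exact Finset.prod_ne_zero_iff.2 fun w _ => (hpos w).ne'

end ProductFormula

end

/-! ### Arithmetic degrees of subspaces -/

section

variable {K : Type u} [Field K] [NumberField K] {X Y : Scheme.{u}}

namespace AdelicMetric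

section

variable {p : X ⟶ Spec (.of K)} (M : AdelicMetric p) (P : Point p K)

theorem finLocalNorm (w : HeightOneSpectrum (𝓞 K)) :
    LocalNorm (fun a : w.adicCompletion K => ‖a‖) (M.finNorm w (P.baseChange _))
      (fun _ b => IsUnitBallBasis (fun a : w.adicCompletion K => ‖a‖)
        (M.finNorm w (P.baseChange _)) b) (fun _ => 1) :=
  (M.isUltrametricNorm w _).localNorm

theorem infLocalNorm (v : InfinitePlace K) :
    LocalNorm (fun a : v.Completion => ‖a‖ ^ v.mult) (M.infNorm v (P.baseChange _))
      (fun _ b => IsOrthonormalFamily v (M.infNorm v (P.baseChange _)) b)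
      (fun s => (s.factorial : ℝ) ^ v.mult) :=
  (M.isHermitianNorm v _).localNorm

/-- Every free family of vectors of `T_P X` is a basis of the unit ball of the space that it
generates at almost all finite places. -/
def AlmostAdapted : Prop :=
  ∀ (r : ℕ) (e : Fin r → Tangent P), LinearIndependent K e →
    ∀ᶠ w : HeightOneSpectrum (𝓞 K) in cofinite,
      IsUnitBallBasis (fun a : w.adicCompletion K => ‖a‖) (M.finNorm w (P.baseChange _))
        (fun i => Tangent.baseChange (e i) (w.adicCompletion K))

variable {M P}

theorem finWedgeNorm_pos (w : HeightOneSpectrum (𝓞 K)) {r : ℕ} {e : Fin r → Tangent P}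
    (he : LinearIndependent K e) : 0 < M.finWedgeNorm P w e :=
  (M.finLocalNorm P w).wedgeNorm_pos _ (Tangent.linearIndependent_baseChange he)

theorem infWedgeNorm_pos (v : InfinitePlace K) {r : ℕ} {e : Fin r → Tangent P}
    (he : LinearIndependent K e) : 0 < M.infWedgeNorm P v e :=
  (M.infLocalNorm P v).wedgeNorm_pos _ (Tangent.linearIndependent_baseChange he)

/-- An adapted family has volume 1. Without finite support the `finsum` in the degree would take the
default value 0, and sums could not be split. -/
theorem AlmostAdapted.finite_support (hA : M.AlmostAdapted P) {r : ℕ} {e : Fin r → Tangent P}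
    (he : LinearIndependent K e) :
    (Function.support fun w => Real.log (M.finWedgeNorm P w e)).Finite := by
  refine Set.Finite.subset (hA r e he) fun w hw h => hw ?_
  have h1 : M.finWedgeNorm P w e = 1 := (M.finLocalNorm P w).wedgeNorm_adapted h
  simp [h1]

/-- At each place the volume is multiplied by the absolute value of the determinant of the change of
basis, an element of `K`. The product formula cancels these factors. -/
theorem AlmostAdapted.wedgeDegree_eq (hA : M.AlmostAdapted P) {r : ℕ} {e e' : Fin r → Tangent P}
    (he : LinearIndependent K e) (he' : LinearIndependent K e')
    (hspan : Submodule.span K (Set.range e') ≤ Submodule.span K (Set.range e)) :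
    M.wedgeDegree P e' = M.wedgeDegree P e := by
  obtain ⟨h, hh⟩ := exists_matrix_of_mem_span (L := K) (e := e') (b := e)
    (fun i => hspan (Submodule.subset_span ⟨i, rfl⟩))
  have hdet := det_ne_zero_of_indep he' hh
  have key : ∀ (L : Type u) [Field L] [Algebra K L],
      (∀ i, Tangent.baseChange (e' i) L =
        ∑ j, (h.map (algebraMap K L)) i j • Tangent.baseChange (e j) L) ∧
      (h.map (algebraMap K L)).det = algebraMap K L h.det := by
    intro L _ _
    refine ⟨fun i => ?_, ?_⟩
    · rw [hh i, Tangent.baseChange_sum]; rfl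
    · rw [RingHom.map_det]; rfl
  have hfin : ∀ w : HeightOneSpectrum (𝓞 K), M.finWedgeNorm P w e' =
      ‖algebraMap K (w.adicCompletion K) h.det‖ * M.finWedgeNorm P w e := by
    intro w
    obtain ⟨h1, h2⟩ := key (w.adicCompletion K)
    have := (M.finLocalNorm P w).wedgeNorm_mul (Tangent.linearIndependent_baseChange he) h1
      (by rw [h2]; exact (map_ne_zero _).2 hdet)
    rw [h2] at this
    exact this
  have hinf : ∀ v : InfinitePlace K, M.infWedgeNorm P v e' =
      ‖algebraMap K v.Completion h.det‖ ^ v.mult * M.infWedgeNorm P v e := by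
    intro v
    obtain ⟨h1, h2⟩ := key v.Completion
    have := (M.infLocalNorm P v).wedgeNorm_mul (Tangent.linearIndependent_baseChange he) h1
      (by rw [h2]; exact (map_ne_zero _).2 hdet)
    rw [h2] at this
    exact this
  have hprod := sum_log_norm_eq_zero hdet
  have h1 : ∑ᶠ w, Real.log (M.finWedgeNorm P w e') =
      (∑ᶠ w : HeightOneSpectrum (𝓞 K), Real.log ‖algebraMap K (w.adicCompletion K) h.det‖) +
        ∑ᶠ w, Real.log (M.finWedgeNorm P w e) := by
    rw [← finsum_add_distrib _ (hA.finite_support he)]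
    · refine finsum_congr fun w => ?_
      rw [hfin, Real.log_mul (norm_ne_zero_iff.2 ((map_ne_zero _).2 hdet))
        (finWedgeNorm_pos w he).ne']
    · refine (finite_norm_ne_one hdet).subset fun w hw h => hw (by simp [h])
  have h2 : ∑ v, Real.log (M.infWedgeNorm P v e') =
      ∑ v : InfinitePlace K, Real.log (‖algebraMap K v.Completion h.det‖ ^ v.mult) +
        ∑ v, Real.log (M.infWedgeNorm P v e) := by
    rw [← Finset.sum_add_distrib]
    refine Finset.sum_congr rfl fun v _ => ?_
    rw [hinf, Real.log_mul (pow_ne_zero _ (norm_ne_zero_iff.2 ((map_ne_zero _).2 hdet)))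
        (infWedgeNorm_pos v he).ne']
  rw [wedgeDegree, wedgeDegree, h1, h2]
  linarith

theorem AlmostAdapted.degree_eq (hA : M.AlmostAdapted P) {r : ℕ} {e : Fin r → Tangent P}
    (he : LinearIndependent K e) : M.degree P (Submodule.span K (Set.range e)) =
      M.wedgeDegree P e := by
  have aux : ∀ (F : Submodule K (Tangent P)) (r : ℕ) (e : Fin r → Tangent P),
      r = Module.finrank K F → LinearIndependent K e → Submodule.span K (Set.range e) = F →
      M.degree P F = M.wedgeDegree P e := by
    rintro F r e rfl he hF
    have hne := nonempty_basis he hF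
    rw [degree, dif_pos hne]
    exact hA.wedgeDegree_eq he (linearIndependent_coe_basis _)
      ((span_coe_basis hne.some).le.trans hF.ge)
  refine aux _ r e ?_ he rfl
  have := finrank_span_eq_card he
  simpa using this.symm

theorem wedgeDegree_zero (e : Fin 0 → Tangent P) :
    M.wedgeDegree P e = 0 := by
  have h1 : ∀ w, M.finWedgeNorm P w e = 1 := fun w =>
    (M.finLocalNorm P w).wedgeNorm_adapted ((M.finLocalNorm P w).empty _)
  have h2 : ∀ v, M.infWedgeNorm P v e = 1 := fun v =>
    (M.infLocalNorm P v).wedgeNorm_adapted ((M.infLocalNorm P v).empty _)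
  simp [wedgeDegree, h1, h2]

theorem AlmostAdapted.degree_bot (hA : M.AlmostAdapted P) : M.degree P ⊥ = 0 := by
  have h := hA.degree_eq (e := (Fin.elim0 : Fin 0 → Tangent P)) linearIndependent_empty_type
  rw [wedgeDegree_zero] at h
  simpa using h

/-- Comparison of two degrees, term by term. -/
theorem degree_le_aux {a b c : HeightOneSpectrum (𝓞 K) → ℝ} {a' b' c' : InfinitePlace K → ℝ}
    (ha : a.support.Finite) (hb : b.support.Finite) (hc : c.support.Finite)
    (h : ∀ w, a w ≤ b w + c w) (h' : ∀ v, a' v ≤ b' v + c' v) :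
    (∑ᶠ w, a w) + ∑ v, a' v ≤ ((∑ᶠ w, b w) + ∑ v, b' v) + ((∑ᶠ w, c w) + ∑ v, c' v) := by
  have h1 : ∑ᶠ w, a w ≤ (∑ᶠ w, b w) + ∑ᶠ w, c w := by
    rw [← finsum_add_distrib hb hc]
    exact finsum_le_finsum' ha ((hb.union hc).subset (Function.support_add _ _)) h
  have h2 : ∑ v, a' v ≤ ∑ v, b' v + ∑ v, c' v := by
    rw [← Finset.sum_add_distrib]
    exact Finset.sum_le_sum fun v _ => h' v
  linarith

/-- A basis of `F` is completed by vectors of a fixed basis `ε`. At each place the volume of the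
completed family is at most that of the basis of `F` times a power of a bound for `ε`, up to a
factorial, so `F` has degree at most that of the whole space plus a constant. This makes the
supremum in `polygonFun` a genuine one. -/
theorem AlmostAdapted.exists_degree_le (hA : M.AlmostAdapted P)
    [FiniteDimensional K (Tangent P)] : ∃ B : ℝ, ∀ F, M.degree P F ≤ B := by
  obtain ⟨m, hm, ε, hε, hεs⟩ : ∃ m, m = Module.finrank K (⊤ : Submodule K (Tangent P)) ∧
      ∃ ε : Fin m → Tangent P, LinearIndependent K ε ∧ Submodule.span K (Set.range ε) = ⊤ :=
    ⟨_, rfl, exists_basis_family _⟩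
  -- A bound for the norms of `ε` which is at least 1 everywhere. Norms not exceeding 1 are dropped
  -- from the sum so that `c w` is exactly 1 at almost all places, and the sum of the logarithms is
  -- finite.
  let c : HeightOneSpectrum (𝓞 K) → ℝ := fun w =>
    1 + ∑ i, if M.finNorm w (P.baseChange _) (Tangent.baseChange (ε i) (w.adicCompletion K)) ≤ 1
      then 0 else M.finNorm w (P.baseChange _) (Tangent.baseChange (ε i) (w.adicCompletion K))
  have hN : ∀ w y, 0 ≤ M.finNorm w (P.baseChange _) y := fun w y => (M.isUltrametricNorm w _).nonneg y
  have hc1 : ∀ w, 1 ≤ c w := by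
    intro w
    refine le_add_of_nonneg_right (Finset.sum_nonneg fun i _ => ?_)
    split_ifs
    · exact le_rfl
    · exact hN _ _
  have hcN : ∀ w i, M.finNorm w (P.baseChange _) (Tangent.baseChange (ε i) (w.adicCompletion K)) ≤ c w := by
    intro w i
    by_cases h : M.finNorm w (P.baseChange _) (Tangent.baseChange (ε i) (w.adicCompletion K)) ≤ 1
    · exact h.trans (hc1 w)
    · have := Finset.single_le_sum (f := fun i =>
        if M.finNorm w (P.baseChange _) (Tangent.baseChange (ε i) (w.adicCompletion K)) ≤ 1
        then 0 else M.finNorm w (P.baseChange _) (Tangent.baseChange (ε i) (w.adicCompletion K)))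
        (fun i _ => by split_ifs; exacts [le_rfl, hN _ _]) (Finset.mem_univ i)
      simp only [if_neg h] at this
      exact this.trans (le_add_of_nonneg_left zero_le_one)
  have hcfin : {w | c w ≠ 1}.Finite := by
    refine Set.Finite.subset (hA _ ε hε) fun w hw h => hw ?_
    have : ∀ i, M.finNorm w (P.baseChange _) (Tangent.baseChange (ε i) (w.adicCompletion K)) ≤ 1 :=
      fun i => (M.finLocalNorm P w).le_one _ h i
    simp [c, this]
  let d : InfinitePlace K → ℝ := fun v =>
    1 + ∑ i, M.infNorm v (P.baseChange _) (Tangent.baseChange (ε i) v.Completion)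
  have hNv : ∀ v y, 0 ≤ M.infNorm v (P.baseChange _) y := by
    intro v y
    obtain ⟨φ, -, -, -, -, -, hN, -⟩ := (M.isHermitianNorm v (P.baseChange _)).exists_form
    rw [hN]; exact Real.sqrt_nonneg _
  have hd1 : ∀ v, 1 ≤ d v := fun v =>
    le_add_of_nonneg_right (Finset.sum_nonneg fun i _ => hNv v _)
  have hdN : ∀ v i, M.infNorm v (P.baseChange _) (Tangent.baseChange (ε i) v.Completion) ≤ d v := by
    intro v i
    exact (Finset.single_le_sum (f := fun i => M.infNorm v (P.baseChange _)
      (Tangent.baseChange (ε i) v.Completion)) (fun i _ => hNv _ _) (Finset.mem_univ i)).trans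
      (le_add_of_nonneg_left zero_le_one)
  refine ⟨M.degree P ⊤ + ((∑ᶠ w, m * Real.log (c w)) +
    ∑ v : InfinitePlace K, (Real.log ((m.factorial : ℝ) ^ v.mult) + m * Real.log (d v))), fun F => ?_⟩
  obtain ⟨e, he, hspan⟩ := exists_basis_family F
  obtain ⟨s, f, hf, hef, hspan'⟩ := exists_append_basis e he (Set.range ε) hεs
  choose j hj using hf
  have hs : s ≤ m := by
    have := hef.fintype_card_le_finrank
    simp only [Fintype.card_fin] at this
    rw [hm, finrank_top]; omega
  have h1 : M.degree P F = M.wedgeDegree P e :=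
    (congrArg _ hspan.symm).trans (hA.degree_eq he)
  have h2 : M.degree P ⊤ = M.wedgeDegree P (Fin.append e f) := by rw [← hA.degree_eq hef, hspan']
  have happ : ∀ (L : Type u) [Field L] [Algebra K L],
      (fun i => Tangent.baseChange (Fin.append e f i) L) =
        Fin.append (fun i => Tangent.baseChange (e i) L) (fun i => Tangent.baseChange (f i) L) := by
    intro L _ _
    funext i
    refine Fin.addCases (fun i => ?_) (fun i => ?_) i <;> simp
  have h3 := degree_le_aux (K := K) (a := fun w => Real.log (M.finWedgeNorm P w (Fin.append e f)))
    (b := fun w => Real.log (M.finWedgeNorm P w e)) (c := fun w => m * Real.log (c w))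
    (a' := fun v => Real.log (M.infWedgeNorm P v (Fin.append e f)))
    (b' := fun v => Real.log (M.infWedgeNorm P v e))
    (c' := fun v => Real.log ((m.factorial : ℝ) ^ v.mult) + m * Real.log (d v))
    (hA.finite_support hef) (hA.finite_support he)
    (hcfin.subset fun w hw h => hw (by simp [h])) (fun w => ?_) (fun v => ?_)
  · rw [h1, h2, wedgeDegree, wedgeDegree]
    linarith
  · have hef' := Tangent.linearIndependent_baseChange (L := w.adicCompletion K) hef
    rw [happ] at hef'
    have := (M.finLocalNorm P w).wedgeNorm_append_le _ _ hef' (C := c w)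
      (zero_le_one.trans (hc1 w)) (fun i => by rw [← hj i]; exact hcN w _)
    rw [← happ] at this
    have h4 : M.finWedgeNorm P w (Fin.append e f) ≤ c w ^ s * M.finWedgeNorm P w e := by
      rw [one_mul] at this; exact this
    have hpos := finWedgeNorm_pos (M := M) w he
    have hc0 : 0 < c w := zero_lt_one.trans_le (hc1 w)
    have h5 := Real.log_le_log (finWedgeNorm_pos w hef) h4
    rw [Real.log_mul (pow_ne_zero _ hc0.ne') hpos.ne', Real.log_pow] at h5
    have h6 : (s : ℝ) * Real.log (c w) ≤ m * Real.log (c w) :=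
      mul_le_mul_of_nonneg_right (by exact_mod_cast hs) (Real.log_nonneg (hc1 w))
    linarith
  · have hef' := Tangent.linearIndependent_baseChange (L := v.Completion) hef
    rw [happ] at hef'
    have := (M.infLocalNorm P v).wedgeNorm_append_le _ _ hef' (C := d v)
      (zero_le_one.trans (hd1 v)) (fun i => by rw [← hj i]; exact hdN v _)
    rw [← happ] at this
    have h4 : M.infWedgeNorm P v (Fin.append e f) ≤
        (s.factorial : ℝ) ^ v.mult * d v ^ s * M.infWedgeNorm P v e := this
    have hpos := infWedgeNorm_pos (M := M) v he
    have hd0 : 0 < d v := zero_lt_one.trans_le (hd1 v)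
    have hs0 : (0 : ℝ) < (s.factorial : ℝ) ^ v.mult := pow_pos (by exact_mod_cast Nat.factorial_pos s) _
    have h5 := Real.log_le_log (infWedgeNorm_pos v hef) h4
    rw [Real.log_mul (mul_ne_zero hs0.ne' (pow_ne_zero _ hd0.ne')) hpos.ne',
      Real.log_mul hs0.ne' (pow_ne_zero _ hd0.ne'), Real.log_pow (d v) s] at h5
    have h6 : (s : ℝ) * Real.log (d v) ≤ m * Real.log (d v) :=
      mul_le_mul_of_nonneg_right (by exact_mod_cast hs) (Real.log_nonneg (hd1 v))
    have h7 : Real.log ((s.factorial : ℝ) ^ v.mult) ≤ Real.log ((m.factorial : ℝ) ^ v.mult) :=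
      Real.log_le_log hs0 (pow_le_pow_left₀ (by positivity)
        (by exact_mod_cast Nat.factorial_le hs) _)
    linarith

end

/-! ### Degrees of quotients under a bounded surjection -/

section Quotient

variable {p : X ⟶ Spec (.of K)} {q : Y ⟶ Spec (.of K)} {MX : AdelicMetric p} {MY : AdelicMetric q}
  {P : Point p K} {Q : Point q K}

/-- The inequality between the degrees of quotients of `T_P X` and `T_Q Y` under a surjective linear
map whose norms at all places are bounded. -/
theorem AlmostAdapted.exists_comap_degree_le (hX : MX.AlmostAdapted P) (hY : MY.AlmostAdapted Q)
    [FiniteDimensional K (Tangent P)] [FiniteDimensional K (Tangent Q)]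
    (T : Tangent P →ₗ[K] Tangent Q) (hT : Function.Surjective T)
    (Tfin : ∀ w : HeightOneSpectrum (𝓞 K), Tangent (P.baseChange (w.adicCompletion K))
      →ₗ[w.adicCompletion K] Tangent (Q.baseChange (w.adicCompletion K)))
    (Tinf : ∀ v : InfinitePlace K, Tangent (P.baseChange v.Completion)
      →ₗ[v.Completion] Tangent (Q.baseChange v.Completion))
    (hTfin : ∀ w D, Tfin w (Tangent.baseChange D _) = Tangent.baseChange (T D) _)
    (hTinf : ∀ v D, Tinf v (Tangent.baseChange D _) = Tangent.baseChange (T D) _)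
    (c : HeightOneSpectrum (𝓞 K) → ℝ) (d : InfinitePlace K → ℝ) (hc1 : ∀ w, 1 ≤ c w)
    (hd1 : ∀ v, 1 ≤ d v) (hcfin : {w | c w ≠ 1}.Finite)
    (hc : ∀ w y, MY.finNorm w _ (Tfin w y) ≤ c w * MX.finNorm w _ y)
    (hd : ∀ v y, MY.infNorm v _ (Tinf v y) ≤ d v * MX.infNorm v _ y)
    (G : Submodule K (Tangent Q)) (hG : G ≠ ⊤) :
    ∃ F : Submodule K (Tangent P), ∃ s : ℕ, 0 < s ∧
      Module.finrank K F + s = Module.finrank K (Tangent P) ∧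
      Module.finrank K G + s = Module.finrank K (Tangent Q) ∧
      MX.degree P ⊤ - MX.degree P F ≤ MY.degree Q ⊤ - MY.degree Q G +
        s * ((∑ᶠ w, Real.log (c w)) + ∑ v : InfinitePlace K,
          (Real.log (((Module.finrank K (Tangent Q)).factorial : ℝ) ^ v.mult) +
            Real.log (d v))) := by
  obtain ⟨g, hg, hspanG⟩ := exists_basis_family G
  obtain ⟨r, s, e, f, he, hspanF, hef, hspan, hgf, hspan'⟩ := exists_adapted_bases T hT g hg
  have hrs : r + s = Module.finrank K (Tangent P) := by
    have := finrank_span_eq_card hef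
    rw [hspan, finrank_top] at this
    simpa using this.symm
  have hgs : Module.finrank K G + s = Module.finrank K (Tangent Q) := by
    have := finrank_span_eq_card hgf
    rw [hspan', finrank_top] at this
    simpa using this.symm
  have hr : Module.finrank K (Submodule.span K (Set.range e)) = r := by
    simpa using finrank_span_eq_card he
  have hs0 : 0 < s := by
    rcases Nat.eq_zero_or_pos s with rfl | h
    · exact (hG (Submodule.eq_top_of_finrank_eq (by simpa using hgs))).elim
    · exact h
  refine ⟨Submodule.span K (Set.range e), s, hs0, by rw [hr, hrs], hgs, ?_⟩
  have hs1 : (1 : ℝ) ≤ s := by exact_mod_cast hs0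
  set n := Module.finrank K (Tangent Q) with hn
  have hsn : s ≤ n := by omega
  have hdG : MY.degree Q G = MY.wedgeDegree Q g := by
    refine (congrArg _ hspanG.symm).trans (hY.degree_eq hg)
  rw [hdG, ← hspan, ← hspan', hX.degree_eq hef, hX.degree_eq he, hY.degree_eq hgf]
  have happ : ∀ (L : Type u) [Field L] [Algebra K L],
      (fun i => Tangent.baseChange (Fin.append e f i) L) =
        Fin.append (fun i => Tangent.baseChange (e i) L) (fun i => Tangent.baseChange (f i) L) := by
    intro L _ _
    funext i
    refine Fin.addCases (fun i => ?_) (fun i => ?_) i <;> simp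
  have happ' : ∀ (L : Type u) [Field L] [Algebra K L]
      (T' : Tangent (P.baseChange L) →ₗ[L] Tangent (Q.baseChange L))
      (_ : ∀ D, T' (Tangent.baseChange D L) = Tangent.baseChange (T D) L),
      (fun i => Tangent.baseChange (Fin.append g (fun i => T (f i)) i) L) =
        Fin.append (fun i => Tangent.baseChange (g i) L)
          (fun i => T' (Tangent.baseChange (f i) L)) := by
    intro L _ _ T' hT'
    funext i
    refine Fin.addCases (fun i => ?_) (fun i => ?_) i <;> simp [hT']
  have hTe : ∀ (L : Type u) [Field L] [Algebra K L]
      (T' : Tangent (P.baseChange L) →ₗ[L] Tangent (Q.baseChange L))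
      (_ : ∀ D, T' (Tangent.baseChange D L) = Tangent.baseChange (T D) L) (i : Fin r),
      T' (Tangent.baseChange (e i) L) ∈
        Submodule.span L (Set.range fun i => Tangent.baseChange (g i) L) := by
    intro L _ _ T' hT' i
    have h1 : T (e i) ∈ Submodule.span K (Set.range g) := by
      have : e i ∈ Submodule.span K (Set.range e) := Submodule.subset_span ⟨i, rfl⟩
      rw [hspanF] at this
      exact this
    obtain ⟨x, hx⟩ := (Submodule.mem_span_range_iff_exists_fun K).1 h1
    rw [hT', ← hx, Tangent.baseChange_sum]
    exact Submodule.sum_mem _ fun j _ => Submodule.smul_mem _ _ (Submodule.subset_span ⟨j, rfl⟩)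
  -- At each place the volume of the family `T (f i)` modulo `g` is compared with that of `f` modulo
  -- `e`. The inequality is kept in multiplied-out form, so that each side is a sum of logarithms of
  -- volumes.
  have h3 := degree_le_aux (K := K)
    (a := fun w => Real.log (MY.finWedgeNorm Q w (Fin.append g fun i => T (f i))) +
      Real.log (MX.finWedgeNorm P w e))
    (b := fun w => Real.log (MY.finWedgeNorm Q w g) +
      Real.log (MX.finWedgeNorm P w (Fin.append e f))) (c := fun w => s * Real.log (c w))
    (a' := fun v => Real.log (MY.infWedgeNorm Q v (Fin.append g fun i => T (f i))) +
      Real.log (MX.infWedgeNorm P v e))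
    (b' := fun v => Real.log (MY.infWedgeNorm Q v g) +
      Real.log (MX.infWedgeNorm P v (Fin.append e f)))
    (c' := fun v => s * (Real.log ((n.factorial : ℝ) ^ v.mult) + Real.log (d v)))
    (((hY.finite_support hgf).union (hX.finite_support he)).subset (Function.support_add _ _))
    (((hY.finite_support hg).union (hX.finite_support hef)).subset (Function.support_add _ _))
    (hcfin.subset fun w hw h => hw (by simp [h])) (fun w => ?_) (fun v => ?_)
  · rw [finsum_add_distrib (hY.finite_support hgf) (hX.finite_support he),
      finsum_add_distrib (hY.finite_support hg) (hX.finite_support hef),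
      Finset.sum_add_distrib, Finset.sum_add_distrib, ← Finset.mul_sum, ← mul_finsum] at h3
    rw [wedgeDegree, wedgeDegree, wedgeDegree, wedgeDegree, mul_add]
    linarith
  · have hef' := Tangent.linearIndependent_baseChange (L := w.adicCompletion K) hef
    have hgf' := Tangent.linearIndependent_baseChange (L := w.adicCompletion K) hgf
    rw [happ] at hef'
    rw [happ' _ (Tfin w) (hTfin w)] at hgf'
    have := (MX.finLocalNorm P w).wedgeNorm_quotient_le (MY.finLocalNorm Q w) (Tfin w)
      (zero_le_one.trans (hc1 w)) (hc w) _ _ _ hef' hgf' (hTe _ (Tfin w) (hTfin w))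
    rw [← happ, ← happ' _ (Tfin w) (hTfin w), one_mul] at this
    have h4 : MY.finWedgeNorm Q w (Fin.append g fun i => T (f i)) * MX.finWedgeNorm P w e ≤
      c w ^ s * (MY.finWedgeNorm Q w g * MX.finWedgeNorm P w (Fin.append e f)) := this
    have p1 := finWedgeNorm_pos (M := MY) w hgf
    have p2 := finWedgeNorm_pos (M := MX) w he
    have p3 := finWedgeNorm_pos (M := MY) w hg
    have p4 := finWedgeNorm_pos (M := MX) w hef
    have hc0 : 0 < c w := zero_lt_one.trans_le (hc1 w)
    have h5 := Real.log_le_log (mul_pos p1 p2) h4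
    rw [Real.log_mul (pow_ne_zero _ hc0.ne') (mul_pos p3 p4).ne', Real.log_pow,
      Real.log_mul p1.ne' p2.ne', Real.log_mul p3.ne' p4.ne'] at h5
    linarith
  · have hef' := Tangent.linearIndependent_baseChange (L := v.Completion) hef
    have hgf' := Tangent.linearIndependent_baseChange (L := v.Completion) hgf
    rw [happ] at hef'
    rw [happ' _ (Tinf v) (hTinf v)] at hgf'
    have := (MX.infLocalNorm P v).wedgeNorm_quotient_le (MY.infLocalNorm Q v) (Tinf v)
      (zero_le_one.trans (hd1 v)) (hd v) _ _ _ hef' hgf' (hTe _ (Tinf v) (hTinf v))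
    rw [← happ, ← happ' _ (Tinf v) (hTinf v)] at this
    have h4 : MY.infWedgeNorm Q v (Fin.append g fun i => T (f i)) * MX.infWedgeNorm P v e ≤
      (s.factorial : ℝ) ^ v.mult * d v ^ s *
        (MY.infWedgeNorm Q v g * MX.infWedgeNorm P v (Fin.append e f)) := this
    have p1 := infWedgeNorm_pos (M := MY) v hgf
    have p2 := infWedgeNorm_pos (M := MX) v he
    have p3 := infWedgeNorm_pos (M := MY) v hg
    have p4 := infWedgeNorm_pos (M := MX) v hef
    have hd0 : 0 < d v := zero_lt_one.trans_le (hd1 v)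
    have hs0' : (0 : ℝ) < (s.factorial : ℝ) ^ v.mult :=
      pow_pos (by exact_mod_cast Nat.factorial_pos s) _
    have h5 := Real.log_le_log (mul_pos p1 p2) h4
    rw [Real.log_mul (mul_ne_zero hs0'.ne' (pow_ne_zero _ hd0.ne')) (mul_pos p3 p4).ne',
      Real.log_mul hs0'.ne' (pow_ne_zero _ hd0.ne'), Real.log_pow (d v) s,
      Real.log_mul p1.ne' p2.ne', Real.log_mul p3.ne' p4.ne'] at h5
    -- Replacing `s !` by `n !` makes the constant independent of `G`. As `1 ≤ s` and this logarithm
    -- is nonnegative, it may also be multiplied by `s`.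
    have h7 : Real.log ((s.factorial : ℝ) ^ v.mult) ≤ Real.log ((n.factorial : ℝ) ^ v.mult) :=
      Real.log_le_log hs0' (pow_le_pow_left₀ (by positivity)
        (by exact_mod_cast Nat.factorial_le hsn) _)
    have h8 : 0 ≤ Real.log ((n.factorial : ℝ) ^ v.mult) :=
      Real.log_nonneg (one_le_pow₀ (by exact_mod_cast Nat.factorial_pos n))
    nlinarith

end Quotient

end AdelicMetric

end

/-! ### Newton polygon and last slope -/

section

namespace AdelicMetric

variable {K : Type u} [Field K] [NumberField K] {X : Scheme.{u}} {p : X ⟶ Spec (.of K)}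
  (M : AdelicMetric p) (P : Point p K)

theorem newtonPolygon_subset_of_le {a b : ℝ}
    (h : ∀ F, M.degree P F ≤ a + b * (Module.finrank K F : ℝ)) :
    ∀ z ∈ M.newtonPolygon P, z.2 ≤ a + b * z.1 := by
  have hconv : Convex ℝ {z : ℝ × ℝ | z.2 ≤ a + b * z.1} := by
    intro z hz z' hz' s t hs ht hst
    simp only [Set.mem_ofPred_eq, Prod.snd_add, Prod.smul_snd, smul_eq_mul, Prod.fst_add,
      Prod.smul_fst] at hz hz' ⊢
    have : a = s * a + t * a := by rw [← add_mul, hst, one_mul]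
    nlinarith [mul_le_mul_of_nonneg_left hz hs, mul_le_mul_of_nonneg_left hz' ht]
  intro z hz
  refine (convexHull_min ?_ hconv) hz
  rintro _ ⟨F, rfl⟩
  exact h F

theorem finrank_lt_of_ne_top [FiniteDimensional K (Tangent P)] {F : Submodule K (Tangent P)}
    (hF : F ≠ ⊤) : Module.finrank K F + 1 ≤ Module.finrank K (Tangent P) :=
  Submodule.finrank_lt hF

/-- Every proper subspace has dimension smaller by at least 1, and degrees are bounded by `B`. So a
line through the last vertex, descending steeply enough, passes above all the other points. It
bounds every vertical slice and shows that the polygon ends at the last vertex. -/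
theorem exists_newtonPolygon_le [FiniteDimensional K (Tangent P)]
    (hB : ∃ B : ℝ, ∀ F, M.degree P F ≤ B) : ∃ b : ℝ, ∀ z ∈ M.newtonPolygon P,
      z.2 ≤ M.degree P ⊤ + b * (Module.finrank K (Tangent P) - z.1) := by
  obtain ⟨B, hB⟩ := hB
  set b := max 0 (B - M.degree P ⊤) with hb
  refine ⟨b, fun z hz => ?_⟩
  have := M.newtonPolygon_subset_of_le P
    (a := M.degree P ⊤ + b * Module.finrank K (Tangent P)) (b := -b) (fun F => ?_) z hz
  · linarith
  · by_cases hF : F = ⊤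
    · subst hF
      rw [finrank_top]; linarith
    · have h1 : (Module.finrank K F : ℝ) + 1 ≤ Module.finrank K (Tangent P) := by
        exact_mod_cast finrank_lt_of_ne_top P hF
      have h2 : B - M.degree P ⊤ ≤ b := le_max_right _ _
      have h3 : 0 ≤ b := le_max_left _ _
      have h4 := hB F
      nlinarith

theorem convex_newtonPolygon : Convex ℝ (M.newtonPolygon P) := convex_convexHull ℝ _

theorem mem_newtonPolygon (F : Submodule K (Tangent P)) :
    ((Module.finrank K F : ℝ), M.degree P F) ∈ M.newtonPolygon P :=
  subset_convexHull ℝ _ ⟨F, rfl⟩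

theorem polygonFun_finrank [FiniteDimensional K (Tangent P)]
    (hB : ∃ B : ℝ, ∀ F, M.degree P F ≤ B) :
    M.polygonFun P (Module.finrank K (Tangent P)) = M.degree P ⊤ := by
  obtain ⟨b, hb⟩ := M.exists_newtonPolygon_le P hB
  refine IsGreatest.csSup_eq ⟨?_, fun y hy => ?_⟩
  · have := M.mem_newtonPolygon P ⊤
    rw [finrank_top] at this
    exact this
  · have := hb _ hy
    simpa using this

/-- The last slope is at most the slope of any quotient. -/
theorem mul_slope_le [FiniteDimensional K (Tangent P)] (hB : ∃ B : ℝ, ∀ F, M.degree P F ≤ B)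
    (F : Submodule K (Tangent P)) {s : ℕ} (hs : 0 < s)
    (hF : Module.finrank K F + s = Module.finrank K (Tangent P)) :
    s * M.slope P (Module.finrank K (Tangent P)) ≤ M.degree P ⊤ - M.degree P F := by
  obtain ⟨b, hb⟩ := M.exists_newtonPolygon_le P hB
  have hs' : (0 : ℝ) < s := by exact_mod_cast hs
  have hs1 : (1 : ℝ) ≤ s := by exact_mod_cast hs
  have hF' : (Module.finrank K F : ℝ) = Module.finrank K (Tangent P) - s := by
    rw [← hF]; push_cast; ring
  -- This is the point of abscissa `dim - 1` on the segment from the point of `F`, of abscissa `dim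
  -- - s`, to the last vertex, whence the weight `s⁻¹`.
  have hmem : ((Module.finrank K (Tangent P) : ℝ) - 1,
      (s : ℝ)⁻¹ * M.degree P F + (1 - (s : ℝ)⁻¹) * M.degree P ⊤) ∈ M.newtonPolygon P := by
    have h1 := M.mem_newtonPolygon P F
    have h2 := M.mem_newtonPolygon P ⊤
    have h3 := M.convex_newtonPolygon P h1 h2 (a := (s : ℝ)⁻¹) (b := 1 - (s : ℝ)⁻¹)
      (inv_nonneg.2 hs'.le) (sub_nonneg.2 (inv_le_one_of_one_le₀ hs1)) (by ring)
    convert h3 using 1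
    rw [hF', finrank_top]
    ext
    · simp; field_simp; ring
    · simp
  have hle : (s : ℝ)⁻¹ * M.degree P F + (1 - (s : ℝ)⁻¹) * M.degree P ⊤ ≤
      M.polygonFun P (Module.finrank K (Tangent P) - 1) := by
    refine le_csSup ⟨M.degree P ⊤ + b, ?_⟩ hmem
    intro y hy
    have := hb _ hy
    simpa using this
  rw [slope, M.polygonFun_finrank P hB]
  have h5 : s * ((s : ℝ)⁻¹ * M.degree P F + (1 - (s : ℝ)⁻¹) * M.degree P ⊤) =
      M.degree P F + (s - 1) * M.degree P ⊤ := by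
    field_simp
  have h6 := mul_le_mul_of_nonneg_left hle hs'.le
  rw [h5] at h6
  linarith

/-- The last slope is the smallest slope of a quotient. -/
theorem le_slope [FiniteDimensional K (Tangent P)] (hB : ∃ B : ℝ, ∀ F, M.degree P F ≤ B)
    (hpos : 0 < Module.finrank K (Tangent P)) {l : ℝ}
    (h : ∀ (F : Submodule K (Tangent P)) (s : ℕ), F ≠ ⊤ →
      Module.finrank K F + s = Module.finrank K (Tangent P) →
      s * l ≤ M.degree P ⊤ - M.degree P F) :
    l ≤ M.slope P (Module.finrank K (Tangent P)) := by
  rw [slope, M.polygonFun_finrank P hB]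
  have h1 : M.polygonFun P (Module.finrank K (Tangent P) - 1) ≤ M.degree P ⊤ - l := by
    refine csSup_le ?_ fun y hy => ?_
    -- The supremum is bounded by the bounds of its elements only over a nonempty slice. The segment
    -- from the point of `⊥` to that of `⊤` provides an element.
    · have h1 := M.mem_newtonPolygon P ⊥
      have h2 := M.mem_newtonPolygon P ⊤
      have hm1 : (1 : ℝ) ≤ Module.finrank K (Tangent P) := by exact_mod_cast hpos
      have h3 := M.convex_newtonPolygon P h1 h2 (a := (Module.finrank K (Tangent P) : ℝ)⁻¹)
        (b := 1 - (Module.finrank K (Tangent P) : ℝ)⁻¹)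
        (by positivity) (sub_nonneg.2 (inv_le_one_of_one_le₀ hm1)) (by ring)
      refine ⟨(Module.finrank K (Tangent P) : ℝ)⁻¹ * M.degree P ⊥ +
        (1 - (Module.finrank K (Tangent P) : ℝ)⁻¹) * M.degree P ⊤, ?_⟩
      change ((_ : ℝ), (_ : ℝ)) ∈ M.newtonPolygon P
      convert h3 using 1
      rw [finrank_bot, finrank_top]
      ext
      · simp only [CharP.cast_eq_zero, Prod.smul_mk, smul_eq_mul, mul_zero, Prod.mk_add_mk, zero_add]
        field_simp
      · rfl
    -- The hypothesis says that all points lie below the line of slope `l` through the last vertex,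
    -- and hence so does their convex hull.
    · have := M.newtonPolygon_subset_of_le P
        (a := M.degree P ⊤ - l * Module.finrank K (Tangent P)) (b := l) (fun F => ?_) _ hy
      · simp only at this
        linarith
      · by_cases hF : F = ⊤
        · subst hF
          rw [finrank_top]; linarith
        · obtain ⟨s, hs⟩ := Nat.exists_eq_add_of_le (Submodule.finrank_le F)
          have h2 := h F s hF hs.symm
          rw [hs]; push_cast
          linarith
  linarith

theorem mul_slope_le_height [FiniteDimensional K (Tangent P)]
    (hB : ∃ B : ℝ, ∀ F, M.degree P F ≤ B) (h0 : M.degree P ⊥ = 0)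
    (hpos : 0 < Module.finrank K (Tangent P)) :
    (Module.finrank K (Tangent P) : ℕ) * M.slope P (Module.finrank K (Tangent P)) ≤
      M.height P := by
  have := M.mul_slope_le P hB ⊥ hpos (by rw [finrank_bot, zero_add])
  rw [h0, sub_zero] at this
  exact this

end AdelicMetric

/-! ### From slopes to freeness -/

section Freeness

/-- The comparison of freenesses deduced from a comparison of slopes. -/
theorem freeness_le {m n : ℕ} (hm : 0 < m) (hn : 0 < n) {μ ν h k C : ℝ} (hC : 0 ≤ C)
    (hμν : μ ≤ ν + C) (hh : 0 < h) (hk : n * ν ≤ k) :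
    (if 0 < μ then m * μ / h else 0) ≤
      m * k / (n * h) * (if 0 < ν then n * ν / k else 0) + m * C / h := by
  have hm' : (0 : ℝ) < m := by exact_mod_cast hm
  have hn' : (0 : ℝ) < n := by exact_mod_cast hn
  have hC' : 0 ≤ m * C / h := by positivity
  by_cases hν : 0 < ν
  -- The inequality `n * ν ≤ k` makes the height `k` positive when `ν` is, so it cancels against the
  -- denominator of the freeness.
  · have hk0 : 0 < k := lt_of_lt_of_le (by positivity) hk
    have h1 : m * k / (n * h) * (n * ν / k) = m * ν / h := by field_simp
    rw [if_pos hν, h1]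
    split_ifs
    · rw [← add_div, ← mul_add]
      exact div_le_div_of_nonneg_right (mul_le_mul_of_nonneg_left hμν hm'.le) hh.le
    · positivity
  -- If `ν ≤ 0` the main term disappears, and `μ ≤ C` is enough.
  · rw [if_neg hν, mul_zero, zero_add]
    split_ifs
    · exact div_le_div_of_nonneg_right (mul_le_mul_of_nonneg_left (by linarith) hm'.le) hh.le
    · exact hC'

end Freeness

end

section

/-! ### Derivations over a ring homomorphism -/

section Der

/-- The map `δ : A → C` is a derivation over the ring homomorphism `ev : A → C`. -/
structure IsDer {A C : Type*} [CommRing A] [CommRing C] (ev : A →+* C) (δ : A → C) : Prop where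
  map_add : ∀ a b, δ (a + b) = δ a + δ b
  leibniz : ∀ a b, δ (a * b) = ev a * δ b + ev b * δ a

namespace IsDer

variable {A B C : Type*} [CommRing A] [CommRing B] [CommRing C] {ev : A →+* C} {δ δ' : A → C}

theorem map_zero (h : IsDer ev δ) : δ 0 = 0 := by
  have := h.map_add 0 0
  rwa [add_zero, left_eq_add] at this

theorem map_one (h : IsDer ev δ) : δ 1 = 0 := by
  have := h.leibniz 1 1
  rwa [mul_one, _root_.map_one, one_mul, left_eq_add] at this

theorem comp (h : IsDer ev δ) (f : B →+* A) : IsDer (ev.comp f) (δ ∘ f) where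
  map_add a b := by simp [h.map_add]
  leibniz a b := by simp [h.leibniz]

/-- The ring homomorphism to the dual numbers defined by a derivation. -/
def toHom (h : IsDer ev δ) : A →+* TrivSqZeroExt C C where
  toFun a := TrivSqZeroExt.inl (ev a) + TrivSqZeroExt.inr (δ a)
  map_one' := by simp [h.map_one]
  map_zero' := by simp [h.map_zero]
  map_add' a b := by ext <;> simp [h.map_add]
  map_mul' a b := by ext <;> simp [h.leibniz, mul_comm]

/-- A derivation extends to a localization. -/
theorem exists_extension [Algebra A B] (S : Submonoid A) [IsLocalization S B] {ev : B →+* C}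
    {δ : A → C} (h : IsDer (ev.comp (algebraMap A B)) δ) :
    ∃ D : B → C, IsDer ev D ∧ ∀ a, D (algebraMap A B a) = δ a := by
  -- A dual number is invertible as soon as its constant part is, so the homomorphism to the dual
  -- numbers extends to the localization; its second component is the extended derivation.
  have hu : ∀ s : S, IsUnit (h.toHom s) := fun s => by
    rw [TrivSqZeroExt.isUnit_iff_isUnit_fst]
    simpa [toHom] using (IsLocalization.map_units B s).map ev
  let F : B →+* TrivSqZeroExt C C := IsLocalization.lift (M := S) hu
  have hF : ∀ a, F (algebraMap A B a) = h.toHom a := fun a => IsLocalization.lift_eq hu a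
  have hev : (TrivSqZeroExt.fstHom C C C).toRingHom.comp F = ev := by
    refine IsLocalization.ringHom_ext S (RingHom.ext fun a => ?_)
    simp [hF, toHom]
  have hev' : ∀ b, (F b).fst = ev b := fun b => congrArg (fun f => f b) hev
  refine ⟨fun b => (F b).snd, ⟨fun a b => by simp, fun a b => ?_⟩, fun a => by simp [hF, toHom]⟩
  simp [hev', mul_comm]

theorem eq_of_mul_unit (h : IsDer ev δ) (h' : IsDer ev δ') {a s : A} (hs : IsUnit (ev s))
    (h1 : δ s = δ' s) (h2 : δ (s * a) = δ' (s * a)) : δ a = δ' a := by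
  rw [h.leibniz, h'.leibniz, h1] at h2
  exact hs.mul_left_cancel (by linear_combination h2)

theorem ext_of_isLocalization [Algebra A B] (S : Submonoid A) [IsLocalization S B] {ev : B →+* C}
    {D D' : B → C} (h : IsDer ev D) (h' : IsDer ev D')
    (heq : ∀ a, D (algebraMap A B a) = D' (algebraMap A B a)) : D = D' := by
  funext b
  obtain ⟨⟨a, s⟩, hs⟩ := IsLocalization.surj S b
  refine h.eq_of_mul_unit h' ((IsLocalization.map_units B s).map ev) (heq _) ?_
  rw [mul_comm, hs, heq]

/-- A derivation is determined by its values on generators. -/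
theorem eval₂ {R σ : Type*} [CommRing R] (h : IsDer ev δ) (c : R →+* A) (hc : ∀ r, δ (c r) = 0)
    (g : σ → A) (F : MvPolynomial σ R) :
    δ (MvPolynomial.eval₂ c g F) = ∑ i ∈ F.vars,
      ev (MvPolynomial.eval₂ c g (MvPolynomial.pderiv i F)) * δ (g i) := by
  classical
  suffices H : ∀ s : Finset σ, F.vars ⊆ s → δ (MvPolynomial.eval₂ c g F) = ∑ i ∈ s,
      ev (MvPolynomial.eval₂ c g (MvPolynomial.pderiv i F)) * δ (g i) from H _ subset_rfl
  -- The variables of a sum or a product are awkward to control, so the induction is carried out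
  -- over all large enough index sets. Extra indices contribute zero partial derivatives.
  have key : ∀ F : MvPolynomial σ R, ∃ t : Finset σ, ∀ s : Finset σ, t ⊆ s →
      δ (MvPolynomial.eval₂ c g F) = ∑ i ∈ s,
        ev (MvPolynomial.eval₂ c g (MvPolynomial.pderiv i F)) * δ (g i) := by
    intro F
    induction F using MvPolynomial.induction_on with
    | C a => exact ⟨∅, fun s _ => by simp [hc]⟩
    | add p q hp hq =>
      obtain ⟨t, ht⟩ := hp
      obtain ⟨t', ht'⟩ := hq
      refine ⟨t ∪ t', fun s hs => ?_⟩
      rw [MvPolynomial.eval₂_add, h.map_add, ht s (Finset.union_subset_left hs),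
        ht' s (Finset.union_subset_right hs), ← Finset.sum_add_distrib]
      exact Finset.sum_congr rfl fun i _ => by
        rw [_root_.map_add, MvPolynomial.eval₂_add, _root_.map_add, add_mul]
    | mul_X p j hp =>
      obtain ⟨t, ht⟩ := hp
      refine ⟨insert j t, fun s hs => ?_⟩
      rw [MvPolynomial.eval₂_mul, h.leibniz, ht s ((Finset.subset_insert _ _).trans hs),
        MvPolynomial.eval₂_X]
      have hj : j ∈ s := hs (Finset.mem_insert_self _ _)
      simp only [Derivation.leibniz, MvPolynomial.pderiv_X, smul_eq_mul, MvPolynomial.eval₂_add,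
        MvPolynomial.eval₂_mul, MvPolynomial.eval₂_X, _root_.map_add, _root_.map_mul, add_mul,
        Finset.sum_add_distrib, Finset.mul_sum]
      congr 1
      · rw [Finset.sum_eq_single j]
        · simp
        · intro i _ hij
          simp [hij.symm]
        · exact fun h => absurd hj h
      · exact Finset.sum_congr rfl fun i _ => by ring
  intro s hs
  obtain ⟨t, ht⟩ := key F
  rw [ht (t ∪ s) Finset.subset_union_left]
  refine (Finset.sum_subset Finset.subset_union_right fun i _ hi => ?_).symm
  rw [MvPolynomial.pderiv_eq_zero_of_notMem_vars fun h => hi (hs h)]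
  simp

end IsDer

end Der

/-! ### Values of functions and of tangent vectors at points -/

section Germs

variable {K : Type u} [Field K] {X Y : Scheme.{u}} {p : X ⟶ Spec (.of K)} {q : Y ⟶ Spec (.of K)}
  {L : Type u} [Field L] [Algebra K L]

theorem map_const (p : X ⟶ Spec (.of K)) {U V : X.Opens} (h : V ≤ U) (c : K) :
    X.presheaf.map (homOfLE h).op (const p U c) = const p V c :=
  congrArg (fun f => f.hom ((Scheme.ΓSpecIso (.of K)).inv.hom c))
    (Scheme.Hom.appLE_map p (U := ⊤) (V := U) (V' := V) le_top (homOfLE h).op)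

theorem germ_const (p : X ⟶ Spec (.of K)) (U : X.Opens) (x : X) (hx : x ∈ U) (c : K) :
    X.presheaf.germ U x hx (const p U c) = constGerm p x c := by
  rw [← map_const p (le_top : U ≤ ⊤)]
  exact TopCat.Presheaf.germ_res_apply _ _ _ _ _

theorem appLE_const (φ : X ⟶ Y) (hφ : φ ≫ q = p) (U : Y.Opens) (V : X.Opens) (h : V ≤ φ ⁻¹ᵁ U)
    (c : K) : φ.appLE U V h (const q U c) = const p V c := by
  subst hφ
  exact congrArg (fun f => f.hom ((Scheme.ΓSpecIso (.of K)).inv.hom c))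
    (Scheme.Hom.appLE_comp_appLE φ q ⊤ U V le_top h)

theorem Point.eval_constGerm (P : Point p L) (c : K) :
    P.eval (constGerm p P.pt c) = algebraMap K L c := by
  obtain ⟨P, hP⟩ := P
  have h1 := stalkMap_constGerm (q := p) P hP (closedPoint L) c
  refine (congrArg (stalkClosedPointIso (.of L)).hom h1).trans ?_
  have h2 := congrArg (fun f => f.hom (const (Spec.map (CommRingCat.ofHom (algebraMap K L))) ⊤ c))
    (germ_stalkClosedPointIso_hom (.of L))
  refine h2.trans ?_
  have h3 := congrArg (fun f => f.hom ((Scheme.ΓSpecIso (.of K)).inv.hom c))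
    (Scheme.ΓSpecIso_naturality (CommRingCat.ofHom (algebraMap K L)))
  have h4 : (Scheme.ΓSpecIso (.of K)).hom ((Scheme.ΓSpecIso (.of K)).inv.hom c) = c :=
    congrArg (fun f => f.hom c) (Scheme.ΓSpecIso (.of K)).inv_hom_id
  refine Eq.trans ?_ (h3.trans (congrArg (algebraMap K L) h4))
  exact congrArg (fun g => (Scheme.ΓSpecIso (.of L)).hom.hom
    (g.hom ((Scheme.ΓSpecIso (.of K)).inv.hom c)))
    (Scheme.Hom.app_eq_appLE (Spec.map (CommRingCat.ofHom (algebraMap K L))) (U := ⊤)).symm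

/-- The evaluation at `P` of functions on a neighbourhood of `P`. -/
def Point.ev (P : Point p L) (U : X.Opens) (hU : P.pt ∈ U) : Γ(X, U) →+* L :=
  P.eval.comp (X.presheaf.germ U P.pt hU).hom

theorem Point.ev_const (P : Point p L) (U : X.Opens) (hU : P.pt ∈ U) (c : K) :
    P.ev U hU (const p U c) = algebraMap K L c :=
  (congrArg P.eval (germ_const p U P.pt hU c)).trans (P.eval_constGerm c)

theorem Point.ev_res (P : Point p L) {U V : X.Opens} (h : V ≤ U) (hV : P.pt ∈ V) (f : Γ(X, U)) :
    P.ev V hV (X.presheaf.map (homOfLE h).op f) = P.ev U (h hV) f :=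
  congrArg P.eval (TopCat.Presheaf.germ_res_apply _ _ _ _ _)

theorem Point.mem_basicOpen_iff (P : Point p L) (U : X.Opens) (hU : P.pt ∈ U) (f : Γ(X, U)) :
    P.pt ∈ X.basicOpen f ↔ P.ev U hU f ≠ 0 := by
  rw [X.mem_basicOpen f P.pt hU]
  have h := Scheme.isLocalHom_stalkClosedPointTo' P.1
  rw [← isUnit_iff_ne_zero]
  exact ⟨fun hu => hu.map P.eval, fun hu => h.map_nonunit _ hu⟩

/-- The derivation of the functions on a neighbourhood of `P` defined by a tangent vector. -/
def Tangent.ev {P : Point p L} (y : Tangent P) (U : X.Opens) (hU : P.pt ∈ U) : Γ(X, U) → L :=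
  fun f => y.1 (X.presheaf.germ U P.pt hU f)

namespace Tangent

variable {P : Point p L}

theorem isDer (y : Tangent P) : IsDer P.eval y.1 := ⟨y.2.1, y.2.2.1⟩

theorem isDer_ev (y : Tangent P) (U : X.Opens) (hU : P.pt ∈ U) : IsDer (P.ev U hU) (ev y U hU) :=
  (isDer y).comp (X.presheaf.germ U P.pt hU).hom

theorem ev_const (y : Tangent P) (U : X.Opens) (hU : P.pt ∈ U) (c : K) :
    ev y U hU (const p U c) = 0 :=
  (congrArg y.1 (germ_const p U P.pt hU c)).trans (y.2.2.2 c)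

theorem ev_res (y : Tangent P) {U V : X.Opens} (h : V ≤ U) (hV : P.pt ∈ V) (f : Γ(X, U)) :
    ev y V hV (X.presheaf.map (homOfLE h).op f) = ev y U (h hV) f :=
  congrArg y.1 (TopCat.Presheaf.germ_res_apply _ _ _ _ _)

theorem ev_smul (a : L) (y : Tangent P) (U : X.Opens) (hU : P.pt ∈ U) (f : Γ(X, U)) :
    ev (a • y) U hU f = a * ev y U hU f := rfl

theorem ev_add (y z : Tangent P) (U : X.Opens) (hU : P.pt ∈ U) (f : Γ(X, U)) :
    ev (y + z) U hU f = ev y U hU f + ev z U hU f := rfl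

theorem ev_sum {ι : Type*} (s : Finset ι) (y : ι → Tangent P) (U : X.Opens) (hU : P.pt ∈ U)
    (f : Γ(X, U)) : ev (∑ i ∈ s, y i) U hU f = ∑ i ∈ s, ev (y i) U hU f := by
  classical
  induction s using Finset.induction_on with
  | empty => rfl
  | insert a s ha ih => rw [Finset.sum_insert ha, Finset.sum_insert ha, ev_add, ih]

theorem ext_ev {y z : Tangent P} (h : ∀ U hU f, ev y U hU f = ev z U hU f) : y = z := by
  refine Subtype.ext (funext fun a => ?_)
  obtain ⟨U, hU, s, rfl⟩ := X.presheaf.exists_germ_eq a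
  exact h U hU s

/-- Tangent vectors at `P` are derivations of the functions on an affine neighbourhood of `P`. -/
theorem ext_of_isAffineOpen {W : X.Opens} (hW : IsAffineOpen W) (hP : P.pt ∈ W) {y z : Tangent P}
    (h : ∀ f, ev y W hP f = ev z W hP f) : y = z := by
  let : Algebra Γ(X, W) (X.presheaf.stalk P.pt) := (X.presheaf.germ W P.pt hP).hom.toAlgebra
  have := hW.isLocalization_stalk ⟨P.pt, hP⟩
  exact Subtype.ext ((isDer y).ext_of_isLocalization (B := X.presheaf.stalk P.pt)
    (hW.primeIdealOf ⟨P.pt, hP⟩).asIdeal.primeCompl (isDer z) h)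

/-- The stalk at `P` is a localization of the ring of functions on `W`, to which derivations extend.
-/
theorem exists_of_isDer {W : X.Opens} (hW : IsAffineOpen W) (hP : P.pt ∈ W) {δ : Γ(X, W) → L}
    (h : IsDer (P.ev W hP) δ) (hc : ∀ c, δ (const p W c) = 0) :
    ∃ y : Tangent P, ∀ f, ev y W hP f = δ f := by
  let : Algebra Γ(X, W) (X.presheaf.stalk P.pt) := (X.presheaf.germ W P.pt hP).hom.toAlgebra
  have := hW.isLocalization_stalk ⟨P.pt, hP⟩
  obtain ⟨D, hD, hDδ⟩ := IsDer.exists_extension (B := X.presheaf.stalk P.pt)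
    (hW.primeIdealOf ⟨P.pt, hP⟩).asIdeal.primeCompl (ev := P.eval) h
  refine ⟨⟨D, hD.map_add, hD.leibniz, fun c => ?_⟩, hDδ⟩
  have h1 := hDδ (const p W c)
  rw [hc] at h1
  exact (congrArg D (germ_const p W P.pt hP c)).symm.trans h1

theorem ev_tangentMap (φ : X ⟶ Y) (hφ : φ ≫ q = p) (y : Tangent P) (U : Y.Opens)
    (hU : (P.map φ hφ).pt ∈ U) (f : Γ(Y, U)) :
    ev (tangentMap φ hφ P y) U hU f = ev y (φ ⁻¹ᵁ U) hU (φ.app U f) :=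
  congrArg y.1 (Scheme.Hom.germ_stalkMap_apply φ U P.pt hU f)

end Tangent

theorem Point.ev_map (φ : X ⟶ Y) (hφ : φ ≫ q = p) (P : Point p L) (U : Y.Opens)
    (hU : (P.map φ hφ).pt ∈ U) (f : Γ(Y, U)) :
    (P.map φ hφ).ev U hU f = P.ev (φ ⁻¹ᵁ U) hU (φ.app U f) := by
  have h1 : ∀ a, (P.map φ hφ).eval a = P.eval (φ.stalkMap P.pt a) := fun a =>
    congrArg (fun f => f.hom a) (Scheme.stalkClosedPointTo_comp (R := .of L) P.1 φ)
  exact (h1 _).trans (congrArg P.eval (Scheme.Hom.germ_stalkMap_apply φ U P.pt hU f))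

theorem Point.pt_baseChange (P : Point p K) : (P.baseChange L).pt = P.pt :=
  congrArg (fun z => P.1 z) (Subsingleton.elim (α := PrimeSpectrum K) _ _)

theorem Point.ev_baseChange (P : Point p K) (U : X.Opens) (hU : (P.baseChange L).pt ∈ U)
    (hU' : P.pt ∈ U) (f : Γ(X, U)) :
    (P.baseChange L).ev U hU f = algebraMap K L (P.ev U hU' f) :=
  (eval_baseChange P _).trans (congrArg (fun a => algebraMap K L (P.eval a))
    (congrArg (fun g => g.hom f) (X.presheaf.germ_stalkSpecializes hU (pt_specializes P))))

theorem Tangent.ev_baseChange {P : Point p K} (y : Tangent P) (U : X.Opens)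
    (hU : (P.baseChange L).pt ∈ U) (hU' : P.pt ∈ U) (f : Γ(X, U)) :
    Tangent.ev (Tangent.baseChange y L) U hU f = algebraMap K L (Tangent.ev y U hU' f) :=
  congrArg (fun a => algebraMap K L (y.1 a))
    (congrArg (fun g => g.hom f) (X.presheaf.germ_stalkSpecializes hU (pt_specializes P)))

theorem Point.eq_Spec_map_ev (P : Point p L) {W : X.Opens} (hW : IsAffineOpen W) (hP : P.pt ∈ W) :
    P.1 = Spec.map (CommRingCat.ofHom (P.ev W hP)) ≫ hW.fromSpec := by
  have h1 := Scheme.Spec_stalkClosedPointTo_fromSpecStalk (R := .of L) P.1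
  have h2 := hW.fromSpecStalk_eq_fromSpecStalk hP
  exact h1.symm.trans ((congrArg (Spec.map (Scheme.stalkClosedPointTo (R := .of L) P.1) ≫ ·)
    h2.symm).trans ((Category.assoc _ _ _).symm.trans
      (congrArg (· ≫ hW.fromSpec) (Spec.map_comp (X.presheaf.germ W P.pt hP) _).symm)))

theorem fromSpec_comp_eq (p : X ⟶ Spec (.of K)) {W : X.Opens} (hW : IsAffineOpen W) :
    hW.fromSpec ≫ p = Spec.map (CommRingCat.ofHom (const p W)) := by
  have h2 := IsAffineOpen.SpecMap_appLE_fromSpec p (isAffineOpen_top (Spec (.of K))) hW le_top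
  rw [← h2, IsAffineOpen.fromSpec_top, Scheme.isoSpec_Spec_inv, ← Spec.map_comp]
  rfl

/-- A `K`-homomorphism `Γ(X, W) → L`, for `W` affine, is the evaluation at a point. -/
theorem Point.exists_of_ringHom {W : X.Opens} (hW : IsAffineOpen W) (ψ : Γ(X, W) →+* L)
    (hψ : ∀ c, ψ (const p W c) = algebraMap K L c) :
    ∃ (P : Point p L) (hP : P.pt ∈ W), P.ev W hP = ψ := by
  have h1 : (Spec.map (CommRingCat.ofHom ψ) ≫ hW.fromSpec) ≫ p =
      Spec.map (CommRingCat.ofHom (algebraMap K L)) := by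
    rw [Category.assoc, fromSpec_comp_eq, ← Spec.map_comp]
    exact congrArg (fun f => Spec.map (CommRingCat.ofHom f)) (RingHom.ext hψ)
  let P : Point p L := ⟨Spec.map (CommRingCat.ofHom ψ) ≫ hW.fromSpec, h1⟩
  have hP : P.pt ∈ W := by
    rw [← SetLike.mem_coe, ← hW.range_fromSpec]
    exact ⟨Spec.map (CommRingCat.ofHom ψ) (closedPoint L), rfl⟩
  refine ⟨P, hP, ?_⟩
  have h2 := P.eq_Spec_map_ev hW hP
  have h3 := Spec.map_injective ((cancel_mono hW.fromSpec).1 h2)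
  exact (congrArg CommRingCat.Hom.hom h3).symm

end Germs

end

section

/-! ### Derivations and Kähler differentials -/

section Kaehler

variable {k A L : Type*} [CommRing k] [CommRing A] [Algebra k A] [CommRing L]

/-- A derivation over `ev` factors through the module of differentials. -/
theorem IsDer.exists_lift {ev : A →+* L} {δ : A → L} (h : IsDer ev δ)
    (hc : ∀ c, δ (algebraMap k A c) = 0) :
    ∃ l : Ω[A⁄k] →+ L, (∀ (a : A) ω, l (a • ω) = ev a * l ω) ∧
      ∀ f, l (KaehlerDifferential.D k A f) = δ f := by
  let _ : Module A L := Module.compHom L ev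
  have hs : ∀ (a : A) (x : L), a • x = ev a * x := fun _ _ => rfl
  let _ : Module k L := Module.compHom L (ev.comp (algebraMap k A))
  have hs' : ∀ (a : k) (x : L), a • x = ev (algebraMap k A a) * x := fun _ _ => rfl
  have : IsScalarTower k A L := ⟨fun a b x => by
    rw [hs, hs', hs, Algebra.smul_def, map_mul, mul_assoc]⟩
  let D : Derivation k A L :=
    { toFun := δ
      map_add' := h.map_add
      map_smul' := fun c a => by
        rw [Algebra.smul_def, h.leibniz, hc, mul_zero, add_zero]; rfl
      map_one_eq_zero' := h.map_one
      leibniz' := fun a b => h.leibniz a b }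
  exact ⟨D.liftKaehlerDifferential.toAddMonoidHom, fun a ω => D.liftKaehlerDifferential.map_smul a ω,
    fun f => D.liftKaehlerDifferential_comp_D f⟩

theorem IsDer.lift_ext {ev : A →+* L} {l l' : Ω[A⁄k] →+ L}
    (hl : ∀ (a : A) ω, l (a • ω) = ev a * l ω) (hl' : ∀ (a : A) ω, l' (a • ω) = ev a * l' ω)
    (h : ∀ f, l (KaehlerDifferential.D k A f) = l' (KaehlerDifferential.D k A f)) : l = l' := by
  ext ω
  have hω : ω ∈ Submodule.span A (Set.range (KaehlerDifferential.D k A)) := by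
    rw [KaehlerDifferential.span_range_derivation]; trivial
  induction hω using Submodule.span_induction with
  | mem x hx => obtain ⟨f, rfl⟩ := hx; exact h f
  | zero => simp
  | add x y _ _ hx hy => rw [_root_.map_add, _root_.map_add, hx, hy]
  | smul a x _ hx => rw [hl, hl', hx]

/-- On a smooth algebra generated by `g₁, …, gₛ`, the differentials are the
`df = ∑ Dⱼ(f) dgⱼ` for suitable derivations `Dⱼ`. -/
theorem exists_derivations [Algebra.FormallySmooth k A] {s : ℕ} (g : Fin s → A)
    (hg : Function.Surjective (MvPolynomial.eval₂Hom (algebraMap k A) g)) :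
    ∃ D : Fin s → Derivation k A A, ∀ f,
      KaehlerDifferential.D k A f = ∑ j, D j f • KaehlerDifferential.D k A (g j) := by
  let π : (Fin s → A) →ₗ[A] Ω[A⁄k] :=
    Fintype.linearCombination A (fun j => KaehlerDifferential.D k A (g j))
  have hπ : Function.Surjective π := by
    rw [← LinearMap.range_eq_top, ← top_le_iff, ← KaehlerDifferential.span_range_derivation,
      Submodule.span_le]
    rintro _ ⟨f, rfl⟩
    obtain ⟨F, rfl⟩ := hg f
    induction F using MvPolynomial.induction_on with
    | C a => simp
    | add p q hp hq => rw [map_add, map_add]; exact Submodule.add_mem _ hp hq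
    | mul_X p j hp =>
      rw [map_mul, Derivation.leibniz]
      refine Submodule.add_mem _ (Submodule.smul_mem _ _ ⟨Pi.single j 1, ?_⟩)
        (Submodule.smul_mem _ _ hp)
      simp [π, Fintype.linearCombination_apply_single]
  -- Formal smoothness makes the module of differentials projective, so the surjection from the free
  -- module on the `dgⱼ` splits. The coordinates of a splitting give the derivations.
  obtain ⟨σ, hσ⟩ := Module.projective_lifting_property π LinearMap.id hπ
  refine ⟨fun j => ((LinearMap.proj j).comp σ).compDer (KaehlerDifferential.D k A), fun f => ?_⟩
  have := congrArg (fun t => t (KaehlerDifferential.D k A f)) hσ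
  simpa [π, Fintype.linearCombination_apply] using this.symm

end Kaehler

/-! ### Tangent spaces of smooth schemes -/

section Smooth

variable {K : Type u} [Field K] {X Y : Scheme.{u}} {p : X ⟶ Spec (.of K)} {q : Y ⟶ Spec (.of K)}
  {L : Type u} [Field L] [Algebra K L]

/-- The functions `g₁, …, gₛ` generate the `K`-algebra of functions on `W`. -/
def Generates (p : X ⟶ Spec (.of K)) (W : X.Opens) {s : ℕ} (g : Fin s → Γ(X, W)) : Prop :=
  Function.Surjective (MvPolynomial.eval₂Hom (const p W) g)

/-- The `D j` act as partial derivatives although the `g j` are generators and need not be local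
coordinates. They are chosen once over `K` and serve for points over every extension, hence at all
places simultaneously. -/
theorem exists_frame_expansion (hp : Smooth p) {W : X.Opens} (hW : IsAffineOpen W) {s : ℕ}
    {g : Fin s → Γ(X, W)} (hg : Generates p W g) :
    ∃ D : Fin s → Γ(X, W) → Γ(X, W), (∀ j, IsDer (RingHom.id _) (D j)) ∧
      (∀ j c, D j (const p W c) = 0) ∧
      ∀ (L : Type u) [Field L] [Algebra K L] (P : Point p L) (hP : P.pt ∈ W) (y : Tangent P)
        (f : Γ(X, W)), Tangent.ev y W hP f = ∑ j, P.ev W hP (D j f) * Tangent.ev y W hP (g j) := by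
  let _ : Algebra K Γ(X, W) := (const p W).toAlgebra
  have hs : (const p W).Smooth := by
    have h1 := hp.smooth_appLE (isAffineOpen_top _) hW le_top
    have h2 : Function.Bijective (Scheme.ΓSpecIso (.of K)).inv.hom :=
      ConcreteCategory.bijective_of_isIso (Scheme.ΓSpecIso (.of K)).inv
    exact RingHom.Smooth.comp (RingHom.Smooth.of_bijective h2) h1
  have hs' : Algebra.FormallySmooth K Γ(X, W) := hs.1
  obtain ⟨D, hD⟩ := exists_derivations (k := K) g hg
  refine ⟨fun j => D j, fun j => ⟨fun a b => map_add _ _ _, fun a b => (D j).leibniz a b⟩,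
    fun j c => (D j).map_algebraMap c, fun L _ _ P hP y f => ?_⟩
  obtain ⟨l, hl, hl'⟩ := (Tangent.isDer_ev y W hP).exists_lift (k := K)
    (fun c => Tangent.ev_const y W hP c)
  rw [← hl', hD f, map_sum]
  exact Finset.sum_congr rfl fun j _ => by rw [hl, hl']

/-- A tangent vector is a linear form on the differentials, semilinear along evaluation at `P`; its
coordinates are its values on the basis `b`. -/
theorem finrank_tangent_aux (P : Point p L) {W : X.Opens} (hW : IsAffineOpen W) (hP : P.pt ∈ W)
    [Algebra K Γ(X, W)] (halg : ∀ c, algebraMap K Γ(X, W) c = const p W c) {m : ℕ}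
    (b : Module.Basis (Fin m) Γ(X, W) (Ω[Γ(X, W)⁄K])) :
    Nonempty (Tangent P ≃ₗ[L] (Fin m → L)) := by
  have hl : ∀ y : Tangent P, ∃ l : Ω[Γ(X, W)⁄K] →+ L, (∀ (a : Γ(X, W)) ω,
      l (a • ω) = P.ev W hP a * l ω) ∧
      ∀ f, l (KaehlerDifferential.D K Γ(X, W) f) = Tangent.ev y W hP f := fun y =>
    (Tangent.isDer_ev y W hP).exists_lift (k := K) fun c => by rw [halg, Tangent.ev_const]
  choose l hl hl' using hl
  have hadd : ∀ y z, l (y + z) = l y + l z := fun y z =>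
    IsDer.lift_ext (hl _) (fun a ω => by simp [hl, mul_add]) fun f => by
      simp [hl', Tangent.ev_add]
  have hsmul : ∀ (a : L) y, l (a • y) = (AddMonoidHom.mulLeft a).comp (l y) := fun a y =>
    IsDer.lift_ext (hl _) (fun a ω => by simp [hl, mul_left_comm]) fun f => by
      simp [hl', Tangent.ev_smul]
  let Φ : Tangent P →ₗ[L] (Fin m → L) :=
    { toFun := fun y j => l y (b j)
      map_add' := fun y z => by funext j; simp [hadd]
      map_smul' := fun a y => by funext j; simp [hsmul] }
  refine ⟨LinearEquiv.ofBijective Φ ⟨fun y z hyz => ?_, fun c => ?_⟩⟩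
  · refine Tangent.ext_of_isAffineOpen hW hP fun f => ?_
    rw [← hl', ← hl', ← b.sum_repr (KaehlerDifferential.D K Γ(X, W) f), map_sum, map_sum]
    exact Finset.sum_congr rfl fun j _ => by rw [hl, hl]; exact congrArg _ (congrFun hyz j)
  · let l' : Ω[Γ(X, W)⁄K] →+ L :=
      { toFun := fun ω => ∑ j, P.ev W hP (b.repr ω j) * c j
        map_zero' := by simp
        map_add' := fun x y => by simp [add_mul, Finset.sum_add_distrib] }
    have h1 : ∀ (a : Γ(X, W)) ω, l' (a • ω) = P.ev W hP a * l' ω := fun a ω => by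
      simp [l', Finset.mul_sum, mul_assoc]
    obtain ⟨y, hy⟩ := Tangent.exists_of_isDer hW hP
      (δ := fun f => l' (KaehlerDifferential.D K Γ(X, W) f))
      ⟨fun a b => by simp, fun a b => by simp [h1]⟩ fun c => by
        rw [← halg, Derivation.map_algebraMap, map_zero]
    refine ⟨y, funext fun j => ?_⟩
    have h2 : l y = l' := IsDer.lift_ext (hl y) h1 fun f => by rw [hl', hy]
    change l y (b j) = c j
    rw [h2]
    simp [l', Finsupp.single_apply]

theorem nonempty_tangent_equiv {m : ℕ} (hp : SmoothOfRelativeDimension m p) (P : Point p L) :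
    Nonempty (Tangent P ≃ₗ[L] (Fin m → L)) := by
  obtain ⟨U, hU, W, hW, hPW, e, h⟩ := hp.exists_isStandardSmoothOfRelativeDimension P.pt
  -- The spectrum of a field has a single point.
  have hU : U = ⊤ := by
    refine top_le_iff.1 fun x _ => ?_
    have : x = p P.pt := Subsingleton.elim (α := PrimeSpectrum K) _ _
    rw [this]; exact e hPW
  subst hU
  have hs : (const p W).IsStandardSmoothOfRelativeDimension m := by
    have h2 : Function.Bijective (Scheme.ΓSpecIso (.of K)).inv.hom :=
      ConcreteCategory.bijective_of_isIso (Scheme.ΓSpecIso (.of K)).inv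
    have h3 := h.comp
      (RingHom.IsStandardSmoothOfRelativeDimension.equiv (RingEquiv.ofBijective _ h2))
    exact h3
  let _ : Algebra K Γ(X, W) := (const p W).toAlgebra
  have hs' : Algebra.IsStandardSmoothOfRelativeDimension m K Γ(X, W) := hs
  have : Nontrivial Γ(X, W) := (P.ev W hPW).domain_nontrivial
  have hr := Algebra.IsStandardSmoothOfRelativeDimension.rank_kaehlerDifferential (R := K) (S := Γ(X, W)) m
  have := Algebra.IsStandardSmoothOfRelativeDimension.isStandardSmooth m (R := K) (S := Γ(X, W))
  have hf : Module.finrank Γ(X, W) (Ω[Γ(X, W)⁄K]) = m := by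
    rw [Module.finrank, hr, Cardinal.toNat_natCast]
  exact finrank_tangent_aux P hW hPW (fun _ => rfl) (Module.finBasisOfFinrankEq _ _ hf)

theorem finrank_tangent {m : ℕ} (hp : SmoothOfRelativeDimension m p) (P : Point p L) :
    Module.finrank L (Tangent P) = m := by
  obtain ⟨e⟩ := nonempty_tangent_equiv hp P
  rw [e.finrank_eq, Module.finrank_fin_fun]

theorem finiteDimensional_tangent {m : ℕ} (hp : SmoothOfRelativeDimension m p) (P : Point p L) :
    FiniteDimensional L (Tangent P) := by
  obtain ⟨e⟩ := nonempty_tangent_equiv hp P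
  exact Module.Finite.equiv e.symm

end Smooth

end

section

/-! ### Vector fields on integral schemes -/

section Fields

variable {K : Type u} [Field K] {X Y : Scheme.{u}} {p : X ⟶ Spec (.of K)} {q : Y ⟶ Spec (.of K)}
  {L : Type u} [Field L] [Algebra K L]

theorem genericPoint_mem [IsIntegral X] {U : X.Opens} {x : X} (hx : x ∈ U) : genericPoint X ∈ U :=
  ((genericPoint_spec X).mem_open_set_iff U.isOpen).2 ⟨x, trivial, hx⟩

/-- On an integral scheme, a germ at the generic point which is locally a section is a section. -/
theorem exists_section_of_forall_exists [IsIntegral X] {V : X.Opens} (hV : genericPoint X ∈ V)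
    (F : X.presheaf.stalk (genericPoint X))
    (h : ∀ x ∈ V, ∃ (U : X.Opens) (_ : x ∈ U) (_ : U ≤ V) (hU : genericPoint X ∈ U) (s : Γ(X, U)),
      X.presheaf.germ U _ hU s = F) :
    ∃ s : Γ(X, V), X.presheaf.germ V _ hV s = F := by
  choose U hxU hUV hU s hs using h
  obtain ⟨t, ht, -⟩ := X.sheaf.existsUnique_gluing' (fun x : V => U x.1 x.2) V
    (fun x => homOfLE (hUV x.1 x.2))
    (fun x hx => TopologicalSpace.Opens.mem_iSup.2 ⟨⟨x, hx⟩, hxU x hx⟩)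
    (fun x => s x.1 x.2) (fun x y => by
      refine germ_injective_of_isIntegral X (U := U x.1 x.2 ⊓ U y.1 y.2) (genericPoint X)
        ⟨hU x.1 x.2, hU y.1 y.2⟩ ?_
      refine (TopCat.Presheaf.germ_res_apply _ _ _ _ _).trans ((hs _ _).trans ?_)
      exact ((TopCat.Presheaf.germ_res_apply _ _ _ _ _).trans (hs _ _)).symm)
  refine ⟨t, ?_⟩
  have h1 := ht ⟨_, hV⟩
  rw [← hs _ hV, ← h1]
  exact (TopCat.Presheaf.germ_res_apply _ _ _ _ _).symm

theorem eq_of_isEmpty {V : X.Opens} (h : ∀ x, x ∉ V) (s t : Γ(X, V)) : s = t := by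
  have : V = ⊥ := by
    ext x; simpa using h x
  subst this
  have : Subsingleton Γ(X, ⊥) := inferInstance
  exact Subsingleton.elim _ _

/-- A derivation of the functions on an affine open subset extends to a vector field. -/
theorem exists_vectorField [IsIntegral X] {W : X.Opens} (hW : IsAffineOpen W)
    (hWg : genericPoint X ∈ W) {δ : Γ(X, W) → Γ(X, W)} (h : IsDer (RingHom.id _) δ)
    (hc : ∀ c, δ (const p W c) = 0) :
    ∃ D : VectorField p W, ∀ f, D.app W le_rfl f = δ f := by
  let η := genericPoint X
  let gW := (X.presheaf.germ W η hWg).hom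
  let : Algebra Γ(X, W) (X.presheaf.stalk η) := gW.toAlgebra
  have := hW.isLocalization_stalk ⟨η, hWg⟩
  -- The derivation is first extended to the function field. Sections over a nonempty open subset
  -- inject there, so every identity can be checked at the generic point.
  obtain ⟨D, hD, hDδ⟩ := IsDer.exists_extension (B := X.presheaf.stalk η) (C := X.presheaf.stalk η)
    (hW.primeIdealOf ⟨η, hWg⟩).asIdeal.primeCompl (ev := RingHom.id _) (δ := fun f => gW (δ f))
    ⟨fun a b => by simp [h.map_add], fun a b => by
      rw [h.leibniz, map_add, map_mul, map_mul]; rfl⟩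
  have hDδ : ∀ f, D (gW f) = gW (δ f) := hDδ
  have hres : ∀ {U : X.Opens} (hU : U ≤ W) (hη : η ∈ U) (f : Γ(X, W)),
      X.presheaf.germ U η hη (X.presheaf.map (homOfLE hU).op f) = gW f :=
    fun hU hη f => TopCat.Presheaf.germ_res_apply _ _ _ _ _
  have key : ∀ (V : X.Opens) (hV : V ≤ W) (f : Γ(X, V)), ∃ s : Γ(X, V), ∀ hη : η ∈ V,
      X.presheaf.germ V η hη s = D (X.presheaf.germ V η hη f) := by
    intro V hV f
    by_cases hη : η ∈ V
    swap
    · exact ⟨0, fun h => absurd h hη⟩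
    obtain ⟨s, hs⟩ := exists_section_of_forall_exists hη (D (X.presheaf.germ V η hη f)) (by
      intro x hx
      obtain ⟨a, haV, hxa⟩ := hW.exists_basicOpen_le ⟨x, hx⟩ (hV hx)
      have hηa : η ∈ X.basicOpen a := genericPoint_mem hxa
      have haW : X.basicOpen a ≤ W := X.basicOpen_le a
      have := hW.isLocalization_basicOpen a
      -- On a small basic open subset `f` is `b / a ^ n`, and the quotient rule exhibits `D f` as a
      -- section there.
      obtain ⟨⟨b, ⟨_, n, rfl⟩⟩, hb⟩ := IsLocalization.surj (Submonoid.powers a)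
        (X.presheaf.map (homOfLE haV).op f)
      have hb : X.presheaf.map (homOfLE haV).op f * X.presheaf.map (homOfLE haW).op (a ^ n) =
        X.presheaf.map (homOfLE haW).op b := hb
      have hu : IsUnit (X.presheaf.map (homOfLE haW).op (a ^ n)) :=
        IsLocalization.map_units (M := Submonoid.powers a) Γ(X, X.basicOpen a) ⟨_, n, rfl⟩
      obtain ⟨u, hu'⟩ := hu
      refine ⟨X.basicOpen a, hxa, haV, hηa, ↑u⁻¹ * (X.presheaf.map (homOfLE haW).op (δ b) -
        X.presheaf.map (homOfLE haV).op f * X.presheaf.map (homOfLE haW).op (δ (a ^ n))), ?_⟩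
      have h1 : X.presheaf.germ V η hη f * gW (a ^ n) = gW b := by
        have := congrArg (X.presheaf.germ (X.basicOpen a) η hηa) hb
        rw [map_mul, hres, hres] at this
        rw [← this]
        exact congrArg (· * _) (TopCat.Presheaf.germ_res_apply _ _ _ _ _).symm
      have h2 := congrArg D h1
      rw [hD.leibniz, hDδ, hDδ] at h2
      have h3 : IsUnit (X.presheaf.germ (X.basicOpen a) η hηa u) :=
        u.isUnit.map (X.presheaf.germ (X.basicOpen a) η hηa).hom
      refine h3.mul_left_cancel ?_
      rw [← map_mul, Units.mul_inv_cancel_left, map_sub, map_mul, hres, hres, hu', hres]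
      have h4 : X.presheaf.germ (X.basicOpen a) η hηa (X.presheaf.map (homOfLE haV).op f) =
        X.presheaf.germ V η hη f := TopCat.Presheaf.germ_res_apply _ _ _ _ _
      rw [h4]
      simp only [RingHom.id_apply] at h2
      linear_combination -h2)
    exact ⟨s, fun _ => hs⟩
  choose A hA using key
  have hext : ∀ {V : X.Opens} {s t : Γ(X, V)},
      (∀ hη : η ∈ V, X.presheaf.germ V η hη s = X.presheaf.germ V η hη t) → s = t := by
    intro V s t hst
    by_cases hη : η ∈ V
    · exact germ_injective_of_isIntegral X η hη (hst hη)
    · exact eq_of_isEmpty (fun x hx => hη (genericPoint_mem hx)) _ _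
  refine ⟨⟨A, fun V hV f g => hext fun hη => ?_, fun V hV f g => hext fun hη => ?_,
    fun V hV c => hext fun hη => ?_, fun V U hV hU f => hext fun hη => ?_⟩,
    fun f => hext fun hη => ?_⟩
  · rw [map_add, hA, hA, hA, map_add, hD.map_add]
  · rw [map_add, map_mul, map_mul, hA, hA, hA, map_mul, hD.leibniz]; rfl
  · rw [hA, germ_const, ← germ_const p W η hWg, map_zero]
    exact (hDδ _).trans (by rw [hc, map_zero])
  · rw [hA]
    refine (congrArg D (TopCat.Presheaf.germ_res_apply _ _ _ _ _)).trans ?_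
    exact ((TopCat.Presheaf.germ_res_apply _ _ _ _ _).trans (hA _ _ _ _)).symm
  · rw [hA]; exact hDδ f

/-- To be a combination of vector fields can be checked on an affine neighbourhood. -/
theorem isCombination_of_isAffineOpen {U W : X.Opens} (hW : IsAffineOpen W) (hWU : W ≤ U) {r : ℕ}
    {d : Fin r → VectorField p U} {P : Point p L} (hP : P.pt ∈ W) {c : Fin r → L} {y : Tangent P}
    (h : ∀ f, Tangent.ev y W hP f = ∑ a, c a * P.ev W hP ((d a).app W hWU f)) :
    IsCombination d c y := by
  intro V hV hPV f
  obtain ⟨a, haV, hPa⟩ := hW.exists_basicOpen_le ⟨P.pt, hPV⟩ hP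
  have haW : X.basicOpen a ≤ W := X.basicOpen_le a
  have := hW.isLocalization_basicOpen a
  have hder : ∀ (B : X.Opens) (hB : B ≤ U) (hPB : P.pt ∈ B), IsDer (P.ev B hPB)
      (fun f => ∑ a, c a * P.ev B hPB ((d a).app B hB f)) := fun B hB hPB =>
    ⟨fun f g => by simp [(d _).map_add, mul_add, Finset.sum_add_distrib], fun f g => by
      simp only [(d _).leibniz, map_add, map_mul, mul_add, Finset.sum_add_distrib, Finset.mul_sum]
      congr 1 <;> exact Finset.sum_congr rfl fun _ _ => by ring⟩
  -- On a basic open subset of `W` inside `V` both sides are derivations, and the functions there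
  -- are a localization of those on `W`.
  have h1 := (Tangent.isDer_ev y _ hPa).ext_of_isLocalization (A := Γ(X, W))
    (B := Γ(X, X.basicOpen a)) (Submonoid.powers a) (hder _ (haW.trans hWU) hPa) (fun f => by
      have h2 : algebraMap Γ(X, W) Γ(X, X.basicOpen a) f = X.presheaf.map (homOfLE haW).op f := rfl
      rw [h2, Tangent.ev_res, h]
      exact Finset.sum_congr rfl fun i _ => by rw [(d i).map_res, Point.ev_res])
  have h3 := congrFun h1 (X.presheaf.map (homOfLE haV).op f)
  rw [Tangent.ev_res] at h3
  refine h3.trans (Finset.sum_congr rfl fun i _ => ?_)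
  rw [(d i).map_res V _ hV haV, Point.ev_res]
  rfl

end Fields

end

/-! ### Bounds for functions at points with bounded coordinates -/

section

theorem norm_eval₂_le_one {L R σ : Type*} [NormedField L] [IsUltrametricDist L] [CommRing R]
    (c : R →+* L) (x : σ → L) (F : MvPolynomial σ R) (hF : ∀ d ∈ F.support, ‖c (F.coeff d)‖ ≤ 1)
    (hx : ∀ i, ‖x i‖ ≤ 1) : ‖MvPolynomial.eval₂ c x F‖ ≤ 1 := by
  rw [MvPolynomial.eval₂_eq]
  refine IsUltrametricDist.norm_sum_le_of_forall_le_of_nonneg zero_le_one fun d hd => ?_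
  rw [norm_mul, norm_prod]
  refine mul_le_one₀ (hF d hd) (Finset.prod_nonneg fun _ _ => norm_nonneg _)
    (Finset.prod_le_one (fun _ _ => norm_nonneg _) fun i _ => ?_)
  rw [norm_pow]
  exact pow_le_one₀ (norm_nonneg _) (hx i)

section Bounds

variable {K : Type u} [Field K] {X Y : Scheme.{u}} {p : X ⟶ Spec (.of K)} {q : Y ⟶ Spec (.of K)}

theorem Point.ev_eval₂ {L : Type u} [Field L] [Algebra K L] (P : Point p L) {W : X.Opens}
    (hP : P.pt ∈ W) {s : ℕ} (g : Fin s → Γ(X, W)) (F : MvPolynomial (Fin s) K) :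
    P.ev W hP (MvPolynomial.eval₂ (const p W) g F) =
      MvPolynomial.eval₂ (algebraMap K L) (fun j => P.ev W hP (g j)) F := by
  rw [MvPolynomial.eval₂_comp_left (P.ev W hP)]
  congr 1
  ext c
  exact P.ev_const W hP c

theorem Generates.exists_norm_ev_le {W : X.Opens} {s : ℕ} {g : Fin s → Γ(X, W)}
    (hg : Generates p W g) (L : Type u) [NormedField L] [Algebra K L] (γ : ℝ) (f : Γ(X, W)) :
    ∃ B, ∀ (P : Point p L) (hP : P.pt ∈ W), (∀ j, ‖P.ev W hP (g j)‖ ≤ γ) → ‖P.ev W hP f‖ ≤ B := by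
  obtain ⟨F, rfl⟩ := hg f
  induction F using MvPolynomial.induction_on with
  | C a =>
    exact ⟨‖algebraMap K L a‖, fun P hP _ => by simp [Point.ev_const]⟩
  | add F G hF hG =>
    obtain ⟨B, hB⟩ := hF
    obtain ⟨B', hB'⟩ := hG
    refine ⟨B + B', fun P hP h => ?_⟩
    rw [map_add, map_add]
    exact (norm_add_le _ _).trans (add_le_add (hB P hP h) (hB' P hP h))
  | mul_X F j hF =>
    obtain ⟨B, hB⟩ := hF
    refine ⟨B * γ, fun P hP h => ?_⟩
    rw [map_mul, map_mul, norm_mul, MvPolynomial.coe_eval₂Hom, MvPolynomial.eval₂_X]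
    exact mul_le_mul (hB P hP h) (h j) (norm_nonneg _) ((norm_nonneg _).trans (hB P hP h))

theorem Generates.exists_norm_tangent_ev_le {W : X.Opens} {s : ℕ} {g : Fin s → Γ(X, W)}
    (hg : Generates p W g) (L : Type u) [NormedField L] [Algebra K L] (γ : ℝ) (f : Γ(X, W)) :
    ∃ B, ∀ (P : Point p L) (hP : P.pt ∈ W) (y : Tangent P), (∀ j, ‖P.ev W hP (g j)‖ ≤ γ) →
      (∀ j, ‖Tangent.ev y W hP (g j)‖ ≤ 1) → ‖Tangent.ev y W hP f‖ ≤ B := by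
  obtain ⟨F, rfl⟩ := hg f
  induction F using MvPolynomial.induction_on with
  | C a =>
    exact ⟨0, fun P hP y _ _ => by simp [Tangent.ev_const]⟩
  | add F G hF hG =>
    obtain ⟨B, hB⟩ := hF
    obtain ⟨B', hB'⟩ := hG
    refine ⟨B + B', fun P hP y h h' => ?_⟩
    rw [map_add, (Tangent.isDer_ev y W hP).map_add]
    exact (norm_add_le _ _).trans (add_le_add (hB P hP y h h') (hB' P hP y h h'))
  | mul_X F j hF =>
    obtain ⟨B, hB⟩ := hF
    obtain ⟨B', hB'⟩ := hg.exists_norm_ev_le L γ (MvPolynomial.eval₂Hom (const p W) g F)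
    refine ⟨B' * 1 + γ * B, fun P hP y h h' => ?_⟩
    rw [map_mul, (Tangent.isDer_ev y W hP).leibniz, MvPolynomial.coe_eval₂Hom,
      MvPolynomial.eval₂_X]
    refine (norm_add_le _ _).trans (add_le_add ?_ ?_)
    · rw [norm_mul]
      exact mul_le_mul (hB' P hP h) (h' j) (norm_nonneg _) ((norm_nonneg _).trans (hB' P hP h))
    · rw [norm_mul]
      exact mul_le_mul (h j) (hB P hP y h h') (norm_nonneg _) ((norm_nonneg _).trans (h j))

/-- Write `f` as a polynomial in the generators. Its finitely many coefficients are integral at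
almost all places, and the exceptional set does not depend on the point. -/
theorem Generates.eventually_norm_ev_le [NumberField K] {W : X.Opens} {s : ℕ} {g : Fin s → Γ(X, W)}
    (hg : Generates p W g) (f : Γ(X, W)) :
    ∀ᶠ w : HeightOneSpectrum (𝓞 K) in cofinite, ∀ (P : Point p (w.adicCompletion K))
      (hP : P.pt ∈ W), (∀ j, ‖P.ev W hP (g j)‖ ≤ 1) → ‖P.ev W hP f‖ ≤ 1 := by
  obtain ⟨F, rfl⟩ := hg f
  have h1 : ∀ᶠ w : HeightOneSpectrum (𝓞 K) in cofinite, ∀ d ∈ F.support,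
      ‖algebraMap K (w.adicCompletion K) (F.coeff d)‖ ≤ 1 :=
    (Filter.eventually_all_finset _).2 fun d _ => eventually_norm_le_one _
  filter_upwards [h1] with w hw P hP h
  rw [MvPolynomial.coe_eval₂Hom, Point.ev_eval₂]
  exact norm_eval₂_le_one _ _ _ hw h

theorem exists_generates [LocallyOfFiniteType p] {W : X.Opens} (hW : IsAffineOpen W) :
    ∃ (s : ℕ) (g : Fin s → Γ(X, W)), Generates p W g := by
  have h1 := p.finiteType_appLE (isAffineOpen_top _) hW le_top
  have h2 : Function.Surjective (Scheme.ΓSpecIso (.of K)).inv.hom :=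
    (ConcreteCategory.bijective_of_isIso (Scheme.ΓSpecIso (.of K)).inv).2
  have h3 : (const p W).FiniteType := h1.comp (RingHom.FiniteType.of_surjective _ h2)
  let : Algebra K Γ(X, W) := (const p W).toAlgebra
  obtain ⟨s, F, hF⟩ := Algebra.FiniteType.iff_quotient_mvPolynomial''.1
    (show Algebra.FiniteType K Γ(X, W) from h3)
  refine ⟨s, fun j => F (MvPolynomial.X j), fun f => ?_⟩
  obtain ⟨G, rfl⟩ := hF f
  refine ⟨G, ?_⟩
  conv_rhs => rw [MvPolynomial.aeval_unique F]
  rfl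

end Bounds

/-! ### Models and norms at almost all finite places -/

section Model

variable {K : Type u} [Field K] [NumberField K] {X : Scheme.{u}} {p : X ⟶ Spec (.of K)}

namespace TangentModel

variable {S : Set (HeightOneSpectrum (𝓞 K))} (M : TangentModel p S)

theorem exists_generators {Z : M.V.Opens} (hZ : IsAffineOpen Z) :
    ∃ (ρ : S.integer K →+* Γ(M.V, Z)) (s : ℕ) (h : Fin s → Γ(M.V, Z)),
      Function.Surjective (MvPolynomial.eval₂Hom ρ h) ∧
      ∀ (W : X.Opens) (hW : W ≤ M.incl ⁻¹ᵁ Z) (c : S.integer K),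
        M.incl.appLE Z W hW (ρ c) = const p W (algebraMap (S.integer K) K c) := by
  have := M.proper
  let ρ : S.integer K →+* Γ(M.V, Z) :=
    (M.hom.appLE ⊤ Z le_top).hom.comp (Scheme.ΓSpecIso (.of (S.integer K))).inv.hom
  have h1 := M.hom.finiteType_appLE (isAffineOpen_top _) hZ le_top
  have h2 : Function.Surjective (Scheme.ΓSpecIso (.of (S.integer K))).inv.hom :=
    (ConcreteCategory.bijective_of_isIso (Scheme.ΓSpecIso (.of (S.integer K))).inv).2
  have h3 : ρ.FiniteType := h1.comp (RingHom.FiniteType.of_surjective _ h2)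
  let : Algebra (S.integer K) Γ(M.V, Z) := ρ.toAlgebra
  obtain ⟨s, F, hF⟩ := Algebra.FiniteType.iff_quotient_mvPolynomial''.1
    (show Algebra.FiniteType (S.integer K) Γ(M.V, Z) from h3)
  refine ⟨ρ, s, fun j => F (MvPolynomial.X j), fun f => ?_, fun W hW c => ?_⟩
  · obtain ⟨G, rfl⟩ := hF f
    refine ⟨G, ?_⟩
    conv_rhs => rw [MvPolynomial.aeval_unique F]
    rfl
  · have h4 := Scheme.Hom.appLE_comp_appLE M.incl M.hom ⊤ Z W le_top hW
    have h5 : ∀ (f : X ⟶ Spec (.of (S.integer K))) (_ : f = p ≫ Spec.map (CommRingCat.ofHom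
        (algebraMap (S.integer K) K))), f.appLE ⊤ W le_top =
        (Spec.map (CommRingCat.ofHom (algebraMap (S.integer K) K))).appLE ⊤ ⊤ le_top ≫
          p.appLE ⊤ W le_top := by
      rintro _ rfl
      exact (Scheme.Hom.appLE_comp_appLE p _ ⊤ ⊤ W le_top le_top).symm
    have h6 := Scheme.ΓSpecIso_inv_naturality (CommRingCat.ofHom (algebraMap (S.integer K) K))
    have h7 := congrArg (fun f => f.hom ((Scheme.ΓSpecIso (.of (S.integer K))).inv.hom c))
      (h4.trans (h5 _ M.isPullback.w))
    refine h7.trans ?_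
    have h8 := congrArg (fun f => (p.appLE ⊤ W le_top).hom (f.hom c)) h6
    refine Eq.trans ?_ h8.symm
    exact congrArg (fun f => (p.appLE ⊤ W le_top).hom
      (f.hom ((Scheme.ΓSpecIso (.of (S.integer K))).inv.hom c)))
      (Scheme.Hom.app_eq_appLE (Spec.map (CommRingCat.ofHom (algebraMap (S.integer K) K)))
        (U := ⊤)).symm

/-- At almost all places, the points with integral coordinates on an affine open subset extend to
integral points of the model. -/
theorem eventually_exists_integral_point (hS : S.Finite) {Z : M.V.Opens} (hZ : IsAffineOpen Z)
    {W : X.Opens} (hW : IsAffineOpen W) (hWZ : W ≤ M.incl ⁻¹ᵁ Z) {s : ℕ} {g : Fin s → Γ(X, W)}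
    (hg : Generates p W g) :
    ∀ᶠ w : HeightOneSpectrum (𝓞 K) in cofinite, ∀ (P : Point p (w.adicCompletion K))
      (hP : P.pt ∈ W), (∀ j, ‖P.ev W hP (g j)‖ ≤ 1) →
      ∃ x : Spec (.of (w.adicCompletionIntegers K)) ⟶ M.V,
        Spec.map (CommRingCat.ofHom
          (algebraMap (w.adicCompletionIntegers K) (w.adicCompletion K))) ≫ x = P.1 ≫ M.incl ∧
        x (closedPoint (w.adicCompletionIntegers K)) ∈ Z := by
  obtain ⟨ρ, t, h, hh, hρ⟩ := M.exists_generators hZ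
  have h1 : ∀ᶠ w : HeightOneSpectrum (𝓞 K) in cofinite, ∀ i, ∀ (P : Point p (w.adicCompletion K))
      (hP : P.pt ∈ W), (∀ j, ‖P.ev W hP (g j)‖ ≤ 1) →
        ‖P.ev W hP (M.incl.appLE Z W hWZ (h i))‖ ≤ 1 :=
    Filter.eventually_all.2 fun i => hg.eventually_norm_ev_le _
  have h2 : ∀ᶠ w : HeightOneSpectrum (𝓞 K) in cofinite, w ∉ S :=
    hS.eventually_cofinite_notMem
  filter_upwards [h1, h2] with w hw hwS P hP hPg
  -- The functions on `Z` are polynomials in the `h i` over the `S`-integers, so evaluation at `P`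
  -- takes them into the integers at `w`. The resulting ring homomorphism is the integral point
  -- sought.
  let ev : Γ(M.V, Z) →+* w.adicCompletion K := (P.ev W hP).comp (M.incl.appLE Z W hWZ).hom
  have h3 : ∀ z, ev z ∈ w.adicCompletionIntegers K := by
    intro z
    rw [← norm_adicCompletion_le_one_iff]
    obtain ⟨F, rfl⟩ := hh z
    rw [MvPolynomial.coe_eval₂Hom, MvPolynomial.eval₂_comp_left ev]
    refine norm_eval₂_le_one _ _ _ (fun d _ => ?_) fun i => hw i P hP hPg
    have h4 : ev (ρ (F.coeff d)) = algebraMap K (w.adicCompletion K)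
        (algebraMap (S.integer K) K (F.coeff d)) :=
      (congrArg (P.ev W hP) (hρ W hWZ (F.coeff d))).trans (P.ev_const W hP _)
    change ‖ev (ρ (F.coeff d))‖ ≤ 1
    rw [h4, norm_algebraMap_le_one_iff]
    exact Set.integer_valuation_le_one S K (F.coeff d) hwS
  let ψ : Γ(M.V, Z) →+* w.adicCompletionIntegers K := ev.codRestrict _ h3
  refine ⟨Spec.map (CommRingCat.ofHom ψ) ≫ hZ.fromSpec, ?_, ?_⟩
  · rw [P.eq_Spec_map_ev hW hP, Category.assoc, ← IsAffineOpen.SpecMap_appLE_fromSpec M.incl hZ hW hWZ,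
      ← Category.assoc, ← Category.assoc, ← Spec.map_comp, ← Spec.map_comp]
    rfl
  · rw [← SetLike.mem_coe, ← hZ.range_fromSpec]
    exact ⟨Spec.map (CommRingCat.ofHom ψ) (closedPoint _), rfl⟩

end TangentModel

/-- Near each point, the norms of an adelic metric are, at almost all places, given by the
coordinates on an affine open subset. -/
theorem AdelicMetric.exists_nhds_eventually_norm_le_one_iff [IsIntegral X] (hp : Smooth p)
    (M : AdelicMetric p) (x : X) :
    ∃ O : X.Opens, x ∈ O ∧ ∀ (W : X.Opens), IsAffineOpen W → W ≤ O → genericPoint X ∈ W →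
      ∀ (s : ℕ) (g : Fin s → Γ(X, W)), Generates p W g →
        (∀ f : Γ(X, W), ∀ᶠ w : HeightOneSpectrum (𝓞 K) in cofinite,
          ∀ (P : Point p (w.adicCompletion K)) (hP : P.pt ∈ W), (∀ j, ‖P.ev W hP (g j)‖ ≤ 1) →
          ∀ y : Tangent P, M.finNorm w P y ≤ 1 → ‖Tangent.ev y W hP f‖ ≤ 1) ∧
        ∀ᶠ w : HeightOneSpectrum (𝓞 K) in cofinite,
          ∀ (P : Point p (w.adicCompletion K)) (hP : P.pt ∈ W), (∀ j, ‖P.ev W hP (g j)‖ ≤ 1) →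
          ∀ y : Tangent P, (∀ j, ‖Tangent.ev y W hP (g j)‖ ≤ 1) → M.finNorm w P y ≤ 1 := by
  obtain ⟨S, hS, T, hT⟩ := M.exists_model
  have hx : T.incl x ∈ ⨆ i, T.U i := by rw [T.cover]; trivial
  obtain ⟨i, hi⟩ := TopologicalSpace.Opens.mem_iSup.1 hx
  obtain ⟨_, ⟨Z, hZ, rfl⟩, hxZ, hZU⟩ :=
    T.V.isBasis_affineOpens.exists_subset_of_mem_open hi (T.U i).isOpen
  refine ⟨T.incl ⁻¹ᵁ Z, hxZ, fun W hW hWZ hWg s g hg => ?_⟩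
  have hWU : W ≤ T.incl ⁻¹ᵁ T.U i := fun z hz => hZU (hWZ hz)
  have h2 : ∀ᶠ w : HeightOneSpectrum (𝓞 K) in cofinite, w ∉ S := hS.eventually_cofinite_notMem
  have h3 := T.eventually_exists_integral_point hS hZ hW hWZ hg
  have h4 : ∀ᶠ w : HeightOneSpectrum (𝓞 K) in cofinite,
      ∀ (P : Point p (w.adicCompletion K)) (hP : P.pt ∈ W), (∀ j, ‖P.ev W hP (g j)‖ ≤ 1) →
      ∀ y : Tangent P, M.finNorm w P y ≤ 1 ↔ ∃ c : Fin T.r → w.adicCompletionIntegers K,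
        IsCombination (T.frame i) (fun a => (c a : w.adicCompletion K)) y := by
    filter_upwards [h2, h3] with w hwS hw P hP hPg y
    obtain ⟨x, hx, hxZ⟩ := hw P hP hPg
    exact hT w hwS P x hx i (hZU hxZ) y
  constructor
  -- A vector of norm at most 1 is an integral combination of the frame, and the derivatives of `f`
  -- along the frame are fixed functions on `W`, integral at almost all places.
  · intro f
    have h5 : ∀ᶠ w : HeightOneSpectrum (𝓞 K) in cofinite, ∀ a, ∀ (P : Point p (w.adicCompletion K))
        (hP : P.pt ∈ W), (∀ j, ‖P.ev W hP (g j)‖ ≤ 1) →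
        ‖P.ev W hP ((T.frame i a).app W hWU f)‖ ≤ 1 :=
      Filter.eventually_all.2 fun a => hg.eventually_norm_ev_le _
    filter_upwards [h4, h5] with w hw hw' P hP hPg y hy
    obtain ⟨c, hc⟩ := (hw P hP hPg y).1 hy
    have h6 : Tangent.ev y W hP f =
        ∑ a, (c a : w.adicCompletion K) * P.ev W hP ((T.frame i a).app W hWU f) := hc W hWU hP f
    rw [h6]
    refine IsUltrametricDist.norm_sum_le_of_forall_le_of_nonneg zero_le_one fun a _ => ?_
    rw [norm_mul]
    exact mul_le_one₀ ((norm_adicCompletion_le_one_iff w _).2 (c a).2) (norm_nonneg _)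
      (hw' a P hP hPg)
  -- Conversely, the derivations `D j` are extended to vector fields and expanded in the frame. The
  -- coefficients `G j a` are functions on `W` independent of the place, and the coordinates of `y`
  -- in the frame are integral combinations of the values of `y` on the generators.
  · obtain ⟨D, hD, hDc, hDe⟩ := exists_frame_expansion hp hW hg
    choose η hη using fun j => exists_vectorField hW hWg (hD j) (hDc j)
    choose G hG _ using fun j => T.isFrame i W hWU (η j)
    have h5 : ∀ᶠ w : HeightOneSpectrum (𝓞 K) in cofinite, ∀ j a,
        ∀ (P : Point p (w.adicCompletion K)) (hP : P.pt ∈ W), (∀ j, ‖P.ev W hP (g j)‖ ≤ 1) →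
        ‖P.ev W hP (G j a)‖ ≤ 1 :=
      Filter.eventually_all.2 fun j => Filter.eventually_all.2 fun a => hg.eventually_norm_ev_le _
    filter_upwards [h4, h5] with w hw hw' P hP hPg y hy
    rw [hw P hP hPg]
    have h6 : ∀ a, ‖∑ j, P.ev W hP (G j a) * Tangent.ev y W hP (g j)‖ ≤ 1 := fun a => by
      refine IsUltrametricDist.norm_sum_le_of_forall_le_of_nonneg zero_le_one fun j _ => ?_
      rw [norm_mul]
      exact mul_le_one₀ (hw' j a P hP hPg) (norm_nonneg _) (hy j)
    refine ⟨fun a => ⟨_, (norm_adicCompletion_le_one_iff w _).1 (h6 a)⟩, ?_⟩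
    refine isCombination_of_isAffineOpen hW hWU hP fun f => ?_
    have h7 : ∀ j, D j f = ∑ a, G j a * (T.frame i a).app W hWU f := fun j => by
      have := hG j W le_rfl f
      rw [hη] at this
      rw [this]
      refine Finset.sum_congr rfl fun a _ => congrArg (· * _) ?_
      exact congrArg (fun t => t.hom (G j a)) (X.presheaf.map_id _)
    rw [hDe _ P hP y f]
    simp only [h7, map_sum, map_mul, Finset.sum_mul]
    rw [Finset.sum_comm]
    exact Finset.sum_congr rfl fun a _ => Finset.sum_congr rfl fun j _ => by ring

end Model

end

/-! ### Rational bases are adapted at almost all places -/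

section

theorem exists_right_inverse_of_linearIndependent {k : Type*} [Field k] {r s : ℕ}
    (A : Matrix (Fin r) (Fin s) k) (hA : LinearIndependent k (fun i => A i)) :
    ∃ B : Matrix (Fin s) (Fin r) k, A * B = 1 := by
  obtain ⟨g, hg⟩ := LinearMap.exists_leftInverse_of_injective
    (Fintype.linearCombination k (fun i => A i)) (LinearMap.ker_eq_bot.2
      (linearIndependent_iff_injective_fintypeLinearCombination.1 hA))
  refine ⟨Matrix.of fun j i => g (Pi.single j 1) i, ?_⟩
  ext i i'
  have h1 := congrArg (fun t => t (Pi.single i 1) i') hg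
  simp only [LinearMap.comp_apply, Fintype.linearCombination_apply_single, one_smul,
    LinearMap.id_apply] at h1
  rw [Matrix.one_apply, Matrix.mul_apply]
  rw [Pi.single_apply] at h1
  have h2 : A i = ∑ j, A i j • (Pi.single j 1 : Fin s → k) := by
    ext j
    simp [Finset.sum_apply, Pi.single_apply]
  rw [h2, map_sum, Finset.sum_apply] at h1
  simpa [eq_comm] using h1

theorem Tangent.ext_of_generates {K : Type u} [Field K] {X : Scheme.{u}} {p : X ⟶ Spec (.of K)}
    {L : Type u} [Field L] [Algebra K L] {P : Point p L} {W : X.Opens}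
    (hW : IsAffineOpen W) (hP : P.pt ∈ W) {s : ℕ} {g : Fin s → Γ(X, W)} (hg : Generates p W g)
    {y z : Tangent P} (h : ∀ j, Tangent.ev y W hP (g j) = Tangent.ev z W hP (g j)) : y = z := by
  refine Tangent.ext_of_isAffineOpen hW hP fun f => ?_
  obtain ⟨F, rfl⟩ := hg f
  rw [MvPolynomial.coe_eval₂Hom, (Tangent.isDer_ev y W hP).eval₂ _ (Tangent.ev_const y W hP),
    (Tangent.isDer_ev z W hP).eval₂ _ (Tangent.ev_const z W hP)]
  exact Finset.sum_congr rfl fun j _ => by rw [h]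

section Almost

variable {K : Type u} [Field K] [NumberField K] {X : Scheme.{u}} {p : X ⟶ Spec (.of K)}

/-- The values of a free family on generators form a matrix `A` over `K` with a right inverse `B`,
and both are integral at almost all places. There, `A` shows that integral coefficients give norm at
most 1, and `B` recovers the coefficients from the values on generators, which are integral when the
norm is at most 1. -/
theorem AdelicMetric.almostAdapted [IsIntegral X] (hp : Smooth p) (M : AdelicMetric p)
    (P : Point p K) : M.AlmostAdapted P := by
  intro r e he
  obtain ⟨O, hO, h⟩ := M.exists_nhds_eventually_norm_le_one_iff hp P.pt
  obtain ⟨_, ⟨W, hW, rfl⟩, hPW, hWO⟩ := X.isBasis_affineOpens.exists_subset_of_mem_open hO O.isOpen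
  have hPW : P.pt ∈ W := hPW
  obtain ⟨s, g, hg⟩ := exists_generates (p := p) hW
  obtain ⟨h1, h2⟩ := h W hW hWO (genericPoint_mem hPW) s g hg
  let A : Matrix (Fin r) (Fin s) K := fun i j => Tangent.ev (e i) W hPW (g j)
  have hA : LinearIndependent K (fun i => A i) := by
    let Φ : Tangent P →ₗ[K] (Fin s → K) :=
      { toFun := fun y j => Tangent.ev y W hPW (g j)
        map_add' := fun _ _ => rfl
        map_smul' := fun _ _ => rfl }
    exact he.map' Φ (LinearMap.ker_eq_bot.2 fun y z hyz =>
      Tangent.ext_of_generates hW hPW hg fun j => congrFun hyz j)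
  obtain ⟨B, hB⟩ := exists_right_inverse_of_linearIndependent A hA
  have h3 : ∀ᶠ w : HeightOneSpectrum (𝓞 K) in cofinite, ∀ j,
      ‖algebraMap K (w.adicCompletion K) (P.ev W hPW (g j))‖ ≤ 1 :=
    Filter.eventually_all.2 fun j => eventually_norm_le_one _
  have h4 : ∀ᶠ w : HeightOneSpectrum (𝓞 K) in cofinite, ∀ i j,
      ‖algebraMap K (w.adicCompletion K) (A i j)‖ ≤ 1 :=
    Filter.eventually_all.2 fun i => Filter.eventually_all.2 fun j => eventually_norm_le_one _
  have h5 : ∀ᶠ w : HeightOneSpectrum (𝓞 K) in cofinite, ∀ j i,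
      ‖algebraMap K (w.adicCompletion K) (B j i)‖ ≤ 1 :=
    Filter.eventually_all.2 fun i => Filter.eventually_all.2 fun j => eventually_norm_le_one _
  have h1' : ∀ᶠ w : HeightOneSpectrum (𝓞 K) in cofinite, ∀ j,
      ∀ (P : Point p (w.adicCompletion K)) (hP : P.pt ∈ W), (∀ j, ‖P.ev W hP (g j)‖ ≤ 1) →
      ∀ y : Tangent P, M.finNorm w P y ≤ 1 → ‖Tangent.ev y W hP (g j)‖ ≤ 1 :=
    Filter.eventually_all.2 fun j => h1 (g j)
  filter_upwards [h1', h2, h3, h4, h5] with w hw1 hw2 hw3 hw4 hw5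
  have hP' : (P.baseChange (w.adicCompletion K)).pt ∈ W := by rwa [P.pt_baseChange]
  have hPg : ∀ j, ‖(P.baseChange (w.adicCompletion K)).ev W hP' (g j)‖ ≤ 1 := fun j => by
    rw [P.ev_baseChange W hP' hPW]; exact hw3 j
  refine ⟨Tangent.linearIndependent_baseChange he, fun c => ?_⟩
  have hz : ∀ j, Tangent.ev (∑ i, c i • Tangent.baseChange (e i) (w.adicCompletion K)) W hP' (g j) =
      ∑ i, c i * algebraMap K (w.adicCompletion K) (A i j) := fun j => by
    rw [Tangent.ev_sum]
    exact Finset.sum_congr rfl fun i _ => by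
      rw [Tangent.ev_smul, Tangent.ev_baseChange _ W hP' hPW]
  constructor
  · intro hN i
    have h6 : c i = ∑ j, Tangent.ev (∑ i, c i • Tangent.baseChange (e i) (w.adicCompletion K))
        W hP' (g j) * algebraMap K (w.adicCompletion K) (B j i) := by
      have h7 : ∀ i', ∑ j, algebraMap K (w.adicCompletion K) (A i' j) *
          algebraMap K (w.adicCompletion K) (B j i) = if i' = i then 1 else 0 := fun i' => by
        have := congrArg (algebraMap K (w.adicCompletion K)) (congrFun (congrFun hB i') i)
        rw [Matrix.mul_apply, Matrix.one_apply, map_sum] at this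
        simp only [map_mul] at this
        rw [this]
        split_ifs <;> simp
      simp only [hz, Finset.sum_mul]
      rw [Finset.sum_comm]
      simp only [mul_assoc, ← Finset.mul_sum, h7]
      simp
    rw [h6]
    refine IsUltrametricDist.norm_sum_le_of_forall_le_of_nonneg zero_le_one fun j _ => ?_
    rw [norm_mul]
    exact mul_le_one₀ (hw1 j _ hP' hPg _ hN) (norm_nonneg _) (hw5 j i)
  · intro hc
    refine hw2 _ hP' hPg _ fun j => ?_
    rw [hz]
    refine IsUltrametricDist.norm_sum_le_of_forall_le_of_nonneg zero_le_one fun i _ => ?_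
    rw [norm_mul]
    exact mul_le_one₀ (hc i) (norm_nonneg _) (hw4 i j)

end Almost

/-! ### Compactness and boundedness of tangent maps at one place -/

section Compactness

variable {K : Type u} [Field K] {X Y : Scheme.{u}} {p : X ⟶ Spec (.of K)} {q : Y ⟶ Spec (.of K)}

/-- The part of the total space of the tangent bundle over an open subset, with the topology
defined by the chart. -/
def ChartSpace (p : X ⟶ Spec (.of K)) (L : Type u) [Field L] [Algebra K L] (W : X.Opens) : Type u :=
  {t : TangentBundle p L // t.point.pt ∈ W}

/-- The coordinates of a point of the total space over an open subset. -/
def ChartSpace.chart {L : Type u} [Field L] [Algebra K L] {W : X.Opens} (t : ChartSpace p L W) :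
    Γ(X, W) → L × L :=
  tangentChart p L W t

/-- The map between total spaces defined by a morphism. -/
def ChartSpace.map {L : Type u} [Field L] [Algebra K L] (φ : X ⟶ Y) (hφ : φ ≫ q = p) {W : X.Opens}
    {V : Y.Opens} (hWV : W ≤ φ ⁻¹ᵁ V) (t : ChartSpace p L W) : ChartSpace q L V :=
  ⟨⟨t.1.point.map φ hφ, tangentMap φ hφ t.1.point t.1.vec⟩, hWV t.2⟩

instance (L : Type u) [Field L] [Algebra K L] [TopologicalSpace L] (W : X.Opens) :
    TopologicalSpace (ChartSpace p L W) :=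
  TopologicalSpace.induced ChartSpace.chart inferInstance

/-- A continuous function on the total space of the tangent bundle is continuous in the charts. -/
theorem continuous_chart {L : Type u} [Field L] [Algebra K L] [TopologicalSpace L]
    {N : TangentBundle p L → ℝ} (hN : Continuous N) {W : X.Opens} (hW : IsAffineOpen W) :
    Continuous (fun t : ChartSpace p L W => N t.1) := by
  have h1 := continuous_iSup_dom.1 hN ⟨W, hW⟩
  exact continuous_coinduced_dom.1 h1

theorem continuous_tangentMap_chart {L : Type u} [Field L] [Algebra K L] [TopologicalSpace L]
    (φ : X ⟶ Y) (hφ : φ ≫ q = p) {W : X.Opens} {V : Y.Opens} (hWV : W ≤ φ ⁻¹ᵁ V) :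
    Continuous (ChartSpace.map (L := L) φ hφ hWV) := by
  refine continuous_induced_rng.2 (continuous_pi fun f => ?_)
  have h1 : Continuous fun x : Γ(X, W) → L × L => x (φ.appLE V W hWV f) := continuous_apply _
  have h2 := h1.comp (continuous_induced_dom : Continuous (ChartSpace.chart (p := p) (L := L) (W := W)))
  have h3 : ∀ t : ChartSpace p L W,
      t.chart (φ.appLE V W hWV f) = (t.map φ hφ hWV).chart f := fun t => by
    refine Prod.ext ?_ ?_
    · exact (t.1.point.ev_res hWV t.2 (φ.app V f)).trans
        (Point.ev_map φ hφ t.1.point V (hWV t.2) f).symm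
    · exact (Tangent.ev_res t.1.vec hWV t.2 (φ.app V f)).trans
        (Tangent.ev_tangentMap φ hφ t.1.vec V (hWV t.2) f).symm
  exact (continuous_congr h3).1 h2

/-- Seen in the product of copies of `L × L` indexed by the functions on `W`, the set is cut out by
closed conditions, and bounds on generators bound each coordinate. Tychonoff's theorem applies. -/
theorem isCompact_chart {L : Type u} [NormedField L] [ProperSpace L] [Algebra K L]
    {W : X.Opens} (hW : IsAffineOpen W) {s : ℕ} {g : Fin s → Γ(X, W)} (hg : Generates p W g)
    (γ : ℝ) {A : Set (Fin s → L)} (hA : IsClosed A) (hA1 : ∀ x ∈ A, ∀ j, ‖x j‖ ≤ 1) :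
    IsCompact {t : ChartSpace p L W | (∀ j, ‖t.1.point.ev W t.2 (g j)‖ ≤ γ) ∧
        (fun j => Tangent.ev t.1.vec W t.2 (g j)) ∈ A} := by
  have hind : Topology.IsInducing (ChartSpace.chart (p := p) (L := L) (W := W)) := ⟨rfl⟩
  rw [hind.isCompact_iff]
  choose B hB using hg.exists_norm_ev_le L γ
  choose B' hB' using hg.exists_norm_tangent_ev_le L γ
  -- The first four conditions say that the first components form a `K`-homomorphism and the second
  -- ones a derivation over it. Since `W` is affine, every such pair comes from a point and a
  -- tangent vector.
  let Ω : Set (Γ(X, W) → L × L) := {x | (∀ a b, x (a + b) = x a + x b) ∧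
    (∀ a b, (x (a * b)).1 = (x a).1 * (x b).1) ∧
    (∀ a b, (x (a * b)).2 = (x a).1 * (x b).2 + (x b).1 * (x a).2) ∧
    (∀ c, x (const p W c) = (algebraMap K L c, 0)) ∧
    (∀ j, ‖(x (g j)).1‖ ≤ γ) ∧ (fun j => (x (g j)).2) ∈ A}
  have h1 : ∀ t : ChartSpace p L W, t.chart = fun f =>
      (t.1.point.ev W t.2 f, Tangent.ev t.1.vec W t.2 f) := fun t => rfl
  have himg : ChartSpace.chart '' {t : ChartSpace p L W | (∀ j, ‖t.1.point.ev W t.2 (g j)‖ ≤ γ) ∧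
        (fun j => Tangent.ev t.1.vec W t.2 (g j)) ∈ A} = Ω := by
    ext x
    constructor
    · rintro ⟨t, ⟨ht1, ht2⟩, rfl⟩
      rw [h1]
      refine ⟨fun a b => Prod.ext (map_add _ _ _) ((Tangent.isDer_ev _ _ _).map_add _ _),
        fun a b => map_mul _ _ _, fun a b => (Tangent.isDer_ev _ _ _).leibniz _ _,
        fun c => Prod.ext (Point.ev_const _ _ _ _) (Tangent.ev_const _ _ _ _), ht1, ht2⟩
    · rintro ⟨hadd, hmul, hleib, hc, hx1, hx2⟩
      let ψ : Γ(X, W) →+* L :=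
        { toFun := fun f => (x f).1
          map_one' := by
            have := hc 1
            rw [map_one, map_one] at this
            rw [this]
          map_zero' := by
            have := hc 0
            rw [map_zero, map_zero] at this
            rw [this]
          map_add' := fun a b => congrArg Prod.fst (hadd a b)
          map_mul' := hmul }
      obtain ⟨P, hP, hψ⟩ := Point.exists_of_ringHom hW ψ fun c => congrArg Prod.fst (hc c)
      have hψ' : ∀ f, P.ev W hP f = (x f).1 := fun f => congrArg (fun ψ => ψ f) hψ
      obtain ⟨y, hy⟩ := Tangent.exists_of_isDer hW hP (δ := fun f => (x f).2)
        ⟨fun a b => congrArg Prod.snd (hadd a b), fun a b => by rw [hψ', hψ', hleib]⟩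
        fun c => congrArg Prod.snd (hc c)
      refine ⟨⟨⟨P, y⟩, hP⟩, ⟨fun j => ?_, ?_⟩, ?_⟩
      · exact (congrArg norm (hψ' (g j))).trans_le (hx1 j)
      · simpa only [hy] using hx2
      · exact funext fun f => Prod.ext (hψ' f) (hy f)
  rw [himg]
  have hclosed : IsClosed Ω := by
    have e : ∀ f, Continuous fun x : Γ(X, W) → L × L => x f := fun f => continuous_apply f
    have e1 : ∀ f, Continuous fun x : Γ(X, W) → L × L => (x f).1 := fun f => (e f).fst
    have e2 : ∀ f, Continuous fun x : Γ(X, W) → L × L => (x f).2 := fun f => (e f).snd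
    simp only [Ω, Set.ofPred_and, Set.ofPred_forall]
    refine IsClosed.inter (isClosed_iInter fun a => isClosed_iInter fun b =>
      isClosed_eq (e _) ((e _).add (e _))) (IsClosed.inter (isClosed_iInter fun a =>
      isClosed_iInter fun b => isClosed_eq (e1 _) ((e1 _).mul (e1 _))) (IsClosed.inter
      (isClosed_iInter fun a => isClosed_iInter fun b => isClosed_eq (e2 _)
        (((e1 _).mul (e2 _)).add ((e1 _).mul (e2 _)))) (IsClosed.inter
      (isClosed_iInter fun c => isClosed_eq (e _) continuous_const) (IsClosed.inter
      (isClosed_iInter fun j => isClosed_le (e1 _).norm continuous_const) ?_))))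
    exact hA.preimage (continuous_pi fun j => e2 _)
  refine IsCompact.of_isClosed_subset (isCompact_univ_pi fun f =>
    (isCompact_closedBall (0 : L) (B f)).prod (isCompact_closedBall (0 : L) (B' f))) hclosed ?_
  rw [← himg]
  rintro _ ⟨t, ⟨ht1, ht2⟩, rfl⟩ f -
  refine ⟨?_, ?_⟩
  · rw [mem_closedBall_zero_iff]
    exact hB f _ _ ht1
  · rw [mem_closedBall_zero_iff]
    exact hB' f _ _ _ ht1 (hA1 _ ht2)

/-- Comparison of the norms of a tangent vector and of its image, at the points with bounded
coordinates in an affine open subset. -/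
theorem exists_norm_tangentMap_le {L : Type u} [NormedField L] [ProperSpace L] [Algebra K L]
    {NX : TangentBundle p L → ℝ} {NY : TangentBundle q L → ℝ} (hNX : Continuous NX)
    (hNY : Continuous NY) (e : ℕ) (he : e ≠ 0)
    (hXs : ∀ (P : Point p L) (a : L) (y : Tangent P), NX ⟨P, a • y⟩ = ‖a‖ ^ e * NX ⟨P, y⟩)
    (hYs : ∀ (P : Point q L) (a : L) (y : Tangent P), NY ⟨P, a • y⟩ = ‖a‖ ^ e * NY ⟨P, y⟩)
    (hX0 : ∀ (P : Point p L) (y : Tangent P), y ≠ 0 → 0 < NX ⟨P, y⟩)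
    (φ : X ⟶ Y) (hφ : φ ≫ q = p) {W : X.Opens} (hW : IsAffineOpen W) {V : Y.Opens}
    (hV : IsAffineOpen V) (hWV : W ≤ φ ⁻¹ᵁ V) {s : ℕ} {g : Fin s → Γ(X, W)}
    (hg : Generates p W g) (γ : ℝ) :
    ∃ C, ∀ (P : Point p L) (hP : P.pt ∈ W), (∀ j, ‖P.ev W hP (g j)‖ ≤ γ) → ∀ y : Tangent P,
      NY ⟨P.map φ hφ, tangentMap φ hφ P y⟩ ≤ C * NX ⟨P, y⟩ := by
  -- Instead of a unit sphere: every nonzero vector reaches `A` when divided by its largest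
  -- coordinate, `A` is closed, and it avoids the zero section, where the ratio of the norms is
  -- undefined.
  let A : Set (Fin s → L) := {x | (∀ j, ‖x j‖ ≤ 1) ∧ ∃ j, x j = 1}
  have hA : IsClosed A := by
    have h1 : A = (⋂ j, {x | ‖x j‖ ≤ 1}) ∩ ⋃ j, {x | x j = 1} := by ext; simp [A]
    rw [h1]
    exact (isClosed_iInter fun j => isClosed_le (continuous_apply j).norm continuous_const).inter
      (isClosed_iUnion_of_finite fun j => isClosed_eq (continuous_apply j) continuous_const)
  have hc := isCompact_chart (p := p) hW hg γ hA fun x hx => hx.1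
  have hx := continuous_chart hNX hW
  have hy : Continuous fun t : ChartSpace p L W =>
      NY ⟨t.1.point.map φ hφ, tangentMap φ hφ t.1.point t.1.vec⟩ :=
    (continuous_chart hNY hV).comp (continuous_tangentMap_chart φ hφ hWV)
  have hpos : ∀ t ∈ {t : ChartSpace p L W |
      (∀ j, ‖t.1.point.ev W t.2 (g j)‖ ≤ γ) ∧
        (fun j => Tangent.ev t.1.vec W t.2 (g j)) ∈ A}, 0 < NX t.1 := by
    rintro t ⟨-, -, j, hj⟩
    refine hX0 _ _ fun h0 => ?_
    have : Tangent.ev t.1.vec W t.2 (g j) = 0 := by rw [h0]; rfl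
    exact zero_ne_one (this.symm.trans hj)
  obtain ⟨C, hC⟩ := hc.bddAbove_image (f := fun t : ChartSpace p L W =>
    NY ⟨t.1.point.map φ hφ, tangentMap φ hφ t.1.point t.1.vec⟩ / NX t.1)
    (hy.continuousOn.div hx.continuousOn fun t ht => (hpos t ht).ne')
  refine ⟨C, fun P hP hPg y => ?_⟩
  by_cases hy0 : ∀ j, Tangent.ev y W hP (g j) = 0
  · have : y = 0 := Tangent.ext_of_generates hW hP hg fun j => by rw [hy0]; rfl
    subst this
    have h1 := hXs P 0 0
    have h2 := hYs (P.map φ hφ) 0 0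
    rw [zero_smul, norm_zero, zero_pow he, zero_mul] at h1 h2
    rw [map_zero, h1, h2, mul_zero]
  · push Not at hy0
    obtain ⟨j₁, hj₁⟩ := hy0
    have : Nonempty (Fin s) := ⟨j₁⟩
    obtain ⟨j₀, hj₀⟩ := Finite.exists_max fun j => ‖Tangent.ev y W hP (g j)‖
    set a := Tangent.ev y W hP (g j₀) with ha
    have ha0 : a ≠ 0 := fun h => hj₁ (norm_le_zero_iff.1 ((hj₀ j₁).trans (by rw [h, norm_zero])))
    let t : ChartSpace p L W := ⟨⟨P, a⁻¹ • y⟩, hP⟩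
    have ht : t ∈ {t : ChartSpace p L W |
      (∀ j, ‖t.1.point.ev W t.2 (g j)‖ ≤ γ) ∧
        (fun j => Tangent.ev t.1.vec W t.2 (g j)) ∈ A} := by
      refine ⟨hPg, fun j => ?_, j₀, inv_mul_cancel₀ ha0⟩
      change ‖a⁻¹ * Tangent.ev y W hP (g j)‖ ≤ 1
      rw [norm_mul, norm_inv, inv_mul_le_iff₀ (norm_pos_iff.2 ha0), mul_one]
      exact hj₀ j
    have h1 := hC ⟨t, ht, rfl⟩
    have h2 : 0 < NX t.1 := hpos t ht
    rw [div_le_iff₀ h2] at h1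
    have h3 : y = a • (a⁻¹ • y) := by rw [smul_smul, mul_inv_cancel₀ ha0, one_smul]
    rw [h3, map_smul, hXs, hYs, mul_left_comm]
    exact mul_le_mul_of_nonneg_left h1 (by positivity)

end Compactness

end

section

/-! ### Standard charts of projective space -/

section ProjSpace

open HomogeneousLocalization

attribute [local instance] MvPolynomial.gradedAlgebra

variable {K : Type u} [Field K] {N : ℕ}

/-- The grading of the ring of polynomials in `N + 1` variables. -/
abbrev projGrading (K : Type u) [Field K] (N : ℕ) :
    ℕ → Submodule K (MvPolynomial (Fin (N + 1)) K) :=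
  MvPolynomial.homogeneousSubmodule (Fin (N + 1)) K

theorem X_mem_homogeneousSubmodule (i : Fin (N + 1)) :
    (MvPolynomial.X i : MvPolynomial (Fin (N + 1)) K) ∈ (projGrading K N) 1 :=
  MvPolynomial.isHomogeneous_X K i

/-- The function `xᵢ / xⱼ` on the standard open subset `xⱼ ≠ 0`. -/
def projCoord (i j : Fin (N + 1)) : Away (projGrading K N) (MvPolynomial.X j : MvPolynomial (Fin (N + 1)) K) :=
  Away.mk (projGrading K N) (X_mem_homogeneousSubmodule j) 1 (MvPolynomial.X i) (X_mem_homogeneousSubmodule i)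

theorem val_projCoord (i j : Fin (N + 1)) : (projCoord (K := K) i j).val =
    Localization.mk (MvPolynomial.X i : MvPolynomial (Fin (N + 1)) K)
      (⟨MvPolynomial.X j ^ 1, 1, rfl⟩ :
        Submonoid.powers (MvPolynomial.X j : MvPolynomial (Fin (N + 1)) K)) := rfl

/-- The constants in the ring of functions on a standard open subset. -/
def projConst (j : Fin (N + 1)) :
    K →+* Away (projGrading K N) (MvPolynomial.X j : MvPolynomial (Fin (N + 1)) K) :=
  (fromZeroRingHom (projGrading K N) _).comp (algebraMap K ((projGrading K N) 0))

/-- For `F` homogeneous of degree `n`, the fraction `F / Xⱼ ^ n` is `F` evaluated at the quotients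
`Xᵢ / Xⱼ`. -/
theorem surjective_eval₂_projCoord (j : Fin (N + 1)) :
    Function.Surjective (MvPolynomial.eval₂Hom (projConst (K := K) j) (fun i => projCoord i j)) := by
  intro z
  obtain ⟨n, F, hF, rfl⟩ := Away.mk_surjective (projGrading K N) (X_mem_homogeneousSubmodule j) z
  refine ⟨F, HomogeneousLocalization.val_injective _ ?_⟩
  have hF' : F.IsHomogeneous n := by simpa using hF
  let S := Submonoid.powers (MvPolynomial.X j : MvPolynomial (Fin (N + 1)) K)
  let v : Away (projGrading K N) (MvPolynomial.X j : MvPolynomial (Fin (N + 1)) K) →+* Localization S :=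
    algebraMap _ _
  have hv : ∀ z, v z = z.val := fun z => rfl
  let a : Localization S := algebraMap _ _ (MvPolynomial.X j : MvPolynomial (Fin (N + 1)) K)
  have ha : IsUnit a := IsLocalization.map_units (M := S) (Localization S) ⟨_, 1, pow_one _⟩
  rw [← hv, MvPolynomial.coe_eval₂Hom, MvPolynomial.eval₂_eq, map_sum, Away.val_mk]
  refine (ha.pow n).mul_left_cancel ?_
  have h1 : a ^ n * Localization.mk F (⟨MvPolynomial.X j ^ n, n, rfl⟩ : S) =
      algebraMap (MvPolynomial (Fin (N + 1)) K) (Localization S) F := by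
    rw [Localization.mk_eq_mk', ← map_pow]
    exact IsLocalization.mk'_spec' (Localization S) F (⟨MvPolynomial.X j ^ n, n, rfl⟩ : S)
  have h2 : ∀ i, a * v (projCoord i j) =
      algebraMap _ _ (MvPolynomial.X i : MvPolynomial (Fin (N + 1)) K) := fun i => by
    rw [hv, val_projCoord, Localization.mk_eq_mk']
    have := IsLocalization.mk'_spec' (Localization S)
      (MvPolynomial.X i : MvPolynomial (Fin (N + 1)) K)
      (⟨MvPolynomial.X j ^ 1, 1, rfl⟩ : S)
    have e : a = algebraMap _ _ (MvPolynomial.X j ^ 1 : MvPolynomial (Fin (N + 1)) K) := by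
      rw [pow_one]
    rw [e]
    exact this
  rw [h1]
  conv_rhs => rw [F.as_sum, map_sum]
  rw [Finset.mul_sum]
  refine Finset.sum_congr rfl fun d hd => ?_
  have h3 : n = ∑ i, d i := by
    have := hF' (MvPolynomial.mem_support_iff.1 hd)
    rw [← this, Finsupp.weight_apply, Finsupp.sum_fintype _ _ (by simp)]
    simp
  have h4 : ∏ i ∈ d.support, projCoord (K := K) i j ^ d i = ∏ i, projCoord i j ^ d i :=
    Finset.prod_subset (Finset.subset_univ _) fun i _ hi => by simp [Finsupp.notMem_support_iff.1 hi]
  rw [h4, map_mul, map_prod, MvPolynomial.monomial_eq, Finsupp.prod_fintype _ _ (by simp), map_mul,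
    map_prod, mul_left_comm]
  congr 1
  rw [h3, ← Finset.prod_pow_eq_pow_sum, ← Finset.prod_mul_distrib]
  exact Finset.prod_congr rfl fun i _ => by rw [map_pow, ← mul_pow, h2, map_pow]

/-- The standard open subset `xⱼ ≠ 0`. -/
abbrev projOpen (K : Type u) [Field K] {N : ℕ} (j : Fin (N + 1)) : (Proj (projGrading K N)).Opens :=
  Proj.basicOpen (projGrading K N) (MvPolynomial.X j)

theorem isAffineOpen_projOpen (j : Fin (N + 1)) : IsAffineOpen (projOpen K j) :=
  Proj.isAffineOpen_basicOpen (projGrading K N) _ (X_mem_homogeneousSubmodule j) one_pos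

theorem iSup_projOpen : ⨆ j, projOpen (N := N) K j = ⊤ := by
  refine Proj.iSup_basicOpen_eq_top' (projGrading K N) _ (fun j => ⟨1, X_mem_homogeneousSubmodule j⟩) ?_
  rw [← top_le_iff]
  intro F _
  induction F using MvPolynomial.induction_on with
  | C c => exact Subalgebra.algebraMap_mem _ (algebraMap K ((projGrading K N) 0) c)
  | add F G hF hG => exact add_mem (hF trivial) (hG trivial)
  | mul_X F i hF => exact mul_mem (hF trivial) (Algebra.subset_adjoin ⟨i, rfl⟩)

/-- The section `xᵢ / xⱼ` over the standard open subset `xⱼ ≠ 0`. -/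
def projSection (i j : Fin (N + 1)) : Γ(Proj (projGrading K N), projOpen K j) :=
  Proj.awayToSection (projGrading K N) (MvPolynomial.X j) (projCoord i j)

theorem awayToSection_projConst (j : Fin (N + 1)) (c : K) :
    Proj.awayToSection (projGrading K N) (MvPolynomial.X j) (projConst j c) =
      const (projSpaceHom K N) (projOpen K j) c := by
  have h1 := fromSpec_comp_eq (projSpaceHom K N) (isAffineOpen_projOpen j)
  have h2 : Spec.map (Proj.awayToSection (projGrading K N) (MvPolynomial.X j)) ≫
      Proj.awayι (projGrading K N) (MvPolynomial.X j) (X_mem_homogeneousSubmodule j) one_pos =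
        (isAffineOpen_projOpen (K := K) j).fromSpec := by
    rw [← cancel_epi (isAffineOpen_projOpen j).isoSpec.hom, IsAffineOpen.isoSpec_hom,
      IsAffineOpen.toSpecΓ_fromSpec, ← Category.assoc]
    have h3 : (projOpen K j).toSpecΓ ≫ Spec.map (Proj.awayToSection (projGrading K N) (MvPolynomial.X j)) =
      (Proj.basicOpenIsoSpec (projGrading K N) (MvPolynomial.X j) (X_mem_homogeneousSubmodule j) one_pos).hom := rfl
    rw [h3, ← Proj.basicOpenIsoSpec_inv_ι, Iso.hom_inv_id_assoc]
  rw [← h2, projSpaceHom, Category.assoc, Proj.awayι_toSpecZero_assoc, ← Spec.map_comp,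
    ← Spec.map_comp] at h1
  exact congrArg (fun f => f.hom c) (Spec.map_injective h1)

theorem generates_projSection (j : Fin (N + 1)) :
    Generates (projSpaceHom K N) (projOpen K j) (fun i => projSection i j) := by
  intro f
  have h1 : Function.Surjective (Proj.awayToSection (projGrading K N) (MvPolynomial.X j)) :=
    (ConcreteCategory.bijective_of_isIso
      (Proj.basicOpenIsoAway (projGrading K N) (MvPolynomial.X j) (X_mem_homogeneousSubmodule j) one_pos).hom).2
  obtain ⟨z, rfl⟩ := h1 f
  obtain ⟨F, rfl⟩ := surjective_eval₂_projCoord j z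
  refine ⟨F, ?_⟩
  rw [MvPolynomial.coe_eval₂Hom, MvPolynomial.coe_eval₂Hom]
  refine Eq.trans ?_ (MvPolynomial.eval₂_comp_left
    (Proj.awayToSection (projGrading K N) (MvPolynomial.X j)).hom _ _ F).symm
  congr 1
  ext c
  exact (awayToSection_projConst j c).symm

theorem projSection_self (j : Fin (N + 1)) : projSection (K := K) j j = 1 := by
  have : projCoord (K := K) j j = 1 := by
    refine HomogeneousLocalization.val_injective _ ?_
    rw [val_projCoord, HomogeneousLocalization.val_one, Localization.mk_eq_mk',
      IsLocalization.mk'_eq_iff_eq_mul]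
    simp
  rw [projSection, this, map_one]

theorem val_projSection (i j : Fin (N + 1)) (x : ProjectiveSpectrum (projGrading K N))
    (hx : MvPolynomial.X j ∉ x.asHomogeneousIdeal) :
    ((projSection i j).1 ⟨x, hx⟩).val = Localization.mk (MvPolynomial.X i)
      (⟨MvPolynomial.X j ^ 1, fun h => hx (x.isPrime.mem_of_pow_mem 1 h)⟩ :
        x.asHomogeneousIdeal.toIdeal.primeCompl) := rfl

/-- If the fraction `X k / X j` is invertible in the local ring at `x`, its numerator lies outside
the prime ideal of `x`. -/
theorem basicOpen_projSection_le (k j : Fin (N + 1)) :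
    (Proj (projGrading K N)).basicOpen (projSection (K := K) k j) ≤ projOpen K k := by
  intro x hx
  have hxj : x ∈ projOpen K j := (Proj (projGrading K N)).basicOpen_le _ hx
  have h1 := ((Proj (projGrading K N)).mem_basicOpen (projSection k j) x hxj).1 hx
  have h2 := h1.map (Proj.stalkIso (projGrading K N) x).hom.hom
  have h3 : (Proj.stalkIso (projGrading K N) x).hom.hom ((Proj (projGrading K N)).presheaf.germ _ x hxj (projSection k j)) =
      (projSection k j).1 ⟨x, hxj⟩ := Proj.stalkIso'_germ (projGrading K N) _ x hxj _
  rw [h3] at h2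
  let x' : ProjectiveSpectrum (projGrading K N) := x
  have h4 : IsUnit (Localization.mk (MvPolynomial.X k)
      (⟨MvPolynomial.X j ^ 1, fun h => hxj (x'.isPrime.mem_of_pow_mem 1 h)⟩ :
        x'.asHomogeneousIdeal.toIdeal.primeCompl)) :=
    (HomogeneousLocalization.isUnit_iff_isUnit_val _ x'.asHomogeneousIdeal.toIdeal _).2 h2
  rw [Localization.mk_eq_mk', IsLocalization.AtPrime.isUnit_mk'_iff] at h4
  exact h4

theorem projSection_cocycle (i j k : Fin (N + 1)) :
    (Proj (projGrading K N)).presheaf.map (homOfLE (inf_le_left : projOpen K j ⊓ projOpen K k ≤ _)).op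
        (projSection i j) =
      (Proj (projGrading K N)).presheaf.map (homOfLE (inf_le_right : projOpen K j ⊓ projOpen K k ≤ _)).op
        (projSection i k) *
      (Proj (projGrading K N)).presheaf.map (homOfLE (inf_le_left : projOpen K j ⊓ projOpen K k ≤ _)).op
        (projSection k j) := by
  refine Subtype.ext (funext fun x => HomogeneousLocalization.val_injective _ ?_)
  refine (val_projSection i j x.1 x.2.1).trans (Eq.trans ?_
    (HomogeneousLocalization.val_mul _ _).symm)
  refine Eq.trans ?_ (congrArg₂ (· * ·) (val_projSection i k x.1 x.2.2)
    (val_projSection k j x.1 x.2.1)).symm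
  change _ = Localization.mk _ _ * Localization.mk _ _
  rw [Localization.mk_mul, Localization.mk_eq_mk_iff, Localization.r_iff_exists]
  exact ⟨1, by simp; ring⟩

/-- A closed subvariety of the projective space has standard affine charts with coordinates the
quotients of homogeneous coordinates. -/
theorem IsNice.exists_charts {X : Scheme.{u}} {p : X ⟶ Spec (.of K)} (hp : IsNice p) :
    ∃ (N : ℕ) (U : Fin (N + 1) → X.Opens) (t : ∀ _ j : Fin (N + 1), Γ(X, U j)),
      (∀ j, IsAffineOpen (U j)) ∧ ⨆ j, U j = ⊤ ∧ (∀ j, Generates p (U j) (fun i => t i j)) ∧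
      (∀ j, t j j = 1) ∧ (∀ k j, X.basicOpen (t k j) ≤ U k) ∧
      ∀ i j k, X.presheaf.map (homOfLE (inf_le_left : U j ⊓ U k ≤ _)).op (t i j) =
        X.presheaf.map (homOfLE (inf_le_right : U j ⊓ U k ≤ _)).op (t i k) *
        X.presheaf.map (homOfLE (inf_le_left : U j ⊓ U k ≤ _)).op (t k j) := by
  obtain ⟨N, i, hi, hip⟩ := hp.projective
  refine ⟨N, fun j => i ⁻¹ᵁ projOpen K j, fun k j => i.app (projOpen K j) (projSection k j),
    fun j => (isAffineOpen_projOpen j).preimage i, ?_, fun j f => ?_, fun j => ?_, fun k j => ?_,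
    fun a j k => ?_⟩
  · rw [← Scheme.Hom.preimage_iSup, iSup_projOpen, Scheme.Hom.preimage_top]
  · obtain ⟨f, rfl⟩ := i.app_surjective (projOpen K j) (isAffineOpen_projOpen j) f
    obtain ⟨F, rfl⟩ := generates_projSection j f
    refine ⟨F, ?_⟩
    rw [MvPolynomial.coe_eval₂Hom, MvPolynomial.coe_eval₂Hom]
    refine Eq.trans ?_ (MvPolynomial.eval₂_comp_left (i.app (projOpen K j)).hom _ _ F).symm
    congr 1
    ext c
    have := appLE_const i hip (projOpen K j) (i ⁻¹ᵁ projOpen K j) le_rfl c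
    rw [← Scheme.Hom.app_eq_appLE] at this
    exact this.symm
  · exact (congrArg (i.app (projOpen K j)) (projSection_self j)).trans (map_one _)
  · rw [← Scheme.preimage_basicOpen]
    exact i.preimage_mono (basicOpen_projSection_le k j)
  · have h := congrArg (i.app (projOpen K j ⊓ projOpen K k)) (projSection_cocycle a j k)
    rw [map_mul] at h
    have e : ∀ {V W : (Proj (projGrading K N)).Opens} (hVW : V ≤ W) (f),
        i.app V ((Proj (projGrading K N)).presheaf.map (homOfLE hVW).op f) =
        X.presheaf.map (homOfLE (i.preimage_mono hVW)).op (i.app W f) := fun hVW f =>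
      congrArg (fun g => g.hom f) (i.naturality (homOfLE hVW).op)
    refine (e _ _).symm.trans (h.trans ?_)
    exact congrArg₂ (· * ·) (e _ _) (e _ _)

end ProjSpace

end

section

/-! ### Finite affine covers with bounded coordinates -/

section BoundedCover

variable {K : Type u} [Field K] {X : Scheme.{u}} {p : X ⟶ Spec (.of K)}

/-- Each point has coordinates bounded by `1` in one of the standard charts. -/
theorem exists_chart_norm_le_one {N : ℕ} {U : Fin (N + 1) → X.Opens}
    {t : ∀ _ j : Fin (N + 1), Γ(X, U j)} (hU : ⨆ j, U j = ⊤) (ht : ∀ j, t j j = 1)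
    (hb : ∀ k j, X.basicOpen (t k j) ≤ U k)
    (hc : ∀ i j k, X.presheaf.map (homOfLE (inf_le_left : U j ⊓ U k ≤ _)).op (t i j) =
        X.presheaf.map (homOfLE (inf_le_right : U j ⊓ U k ≤ _)).op (t i k) *
        X.presheaf.map (homOfLE (inf_le_left : U j ⊓ U k ≤ _)).op (t k j))
    {L : Type u} [NormedField L] [Algebra K L] (P : Point p L) :
    ∃ (j : Fin (N + 1)) (hP : P.pt ∈ U j), ∀ i, ‖P.ev (U j) hP (t i j)‖ ≤ 1 := by
  have h1 : P.pt ∈ ⨆ j, U j := by rw [hU]; trivial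
  obtain ⟨j, hj⟩ := TopologicalSpace.Opens.mem_iSup.1 h1
  -- The chart is that of the largest homogeneous coordinate. The choice `k = j` gives the value 1,
  -- so the maximum is nonzero and `P` lies in `U k`; dividing by it bounds the new coordinates by
  -- 1.
  obtain ⟨k, hk⟩ := Finite.exists_max fun k => ‖P.ev (U j) hj (t k j)‖
  have h2 : 1 ≤ ‖P.ev (U j) hj (t k j)‖ := by
    have := hk j
    rwa [ht, map_one, norm_one] at this
  have h3 : P.pt ∈ U k := hb k j ((P.mem_basicOpen_iff (U j) hj (t k j)).2 fun h => by
    rw [h, norm_zero] at h2; exact absurd h2 (by norm_num))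
  refine ⟨k, h3, fun i => ?_⟩
  have hjk : P.pt ∈ U j ⊓ U k := ⟨hj, h3⟩
  have h4 := congrArg (P.ev (U j ⊓ U k) hjk) (hc i j k)
  rw [map_mul, P.ev_res, P.ev_res, P.ev_res] at h4
  have h5 := hk i
  rw [h4, norm_mul] at h5
  exact le_of_mul_le_mul_right (h5.trans_eq (one_mul _).symm) (one_pos.trans_le h2)

/-- An affine open subset is covered by small basic open subsets. -/
theorem exists_partition {U : X.Opens} (hU : IsAffineOpen U) (O : X → X.Opens) (hO : ∀ x, x ∈ O x) :
    ∃ (F : Finset Γ(X, U)) (h : Γ(X, U) → Γ(X, U)), (∀ g ∈ F, ∃ x, X.basicOpen g ≤ O x) ∧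
      ∑ g ∈ F, h g * g = 1 := by
  let G : Set Γ(X, U) := {g | ∃ x, X.basicOpen g ≤ O x}
  have h1 : Ideal.span G = ⊤ := by
    rw [← hU.iSup_basicOpen_eq_self_iff]
    refine le_antisymm (iSup_le fun g => X.basicOpen_le g.1) fun x hx => ?_
    obtain ⟨g, hg, hxg⟩ := hU.exists_basicOpen_le ⟨x, hO x⟩ hx
    exact TopologicalSpace.Opens.mem_iSup.2 ⟨⟨g, x, hg⟩, hxg⟩
  obtain ⟨F, hFG, hF⟩ := (Ideal.span_eq_top_iff_finite G).1 h1
  have h2 : (1 : Γ(X, U)) ∈ Ideal.span (F : Set Γ(X, U)) := by rw [hF]; trivial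
  obtain ⟨h, -, hh⟩ := Submodule.mem_span_finset.1 h2
  exact ⟨F, h, fun g hg => hFG hg, hh⟩

/-- Generators of the functions on a basic open subset. -/
theorem exists_generates_basicOpen {U : X.Opens} (hU : IsAffineOpen U) {s : ℕ}
    {t : Fin s → Γ(X, U)} (ht : Generates p U t) (g : Γ(X, U)) :
    ∃ t' : Fin (s + 1) → Γ(X, X.basicOpen g), Generates p (X.basicOpen g) t' ∧
      ∀ (L : Type u) [Field L] [Algebra K L] (P : Point p L) (hP : P.pt ∈ X.basicOpen g) (j),
        (∃ i, P.ev (X.basicOpen g) hP (t' j) = P.ev U (X.basicOpen_le g hP) (t i)) ∨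
          P.ev (X.basicOpen g) hP (t' j) = (P.ev U (X.basicOpen_le g hP) g)⁻¹ := by
  have := hU.isLocalization_basicOpen g
  have hres : ∀ f, algebraMap Γ(X, U) Γ(X, X.basicOpen g) f =
    X.presheaf.map (homOfLE (X.basicOpen_le g)).op f := fun _ => rfl
  let u : Γ(X, X.basicOpen g)ˣ := (IsLocalization.map_units (M := Submonoid.powers g)
    Γ(X, X.basicOpen g) ⟨g, 1, pow_one g⟩).unit
  have hu : (u : Γ(X, X.basicOpen g)) = X.presheaf.map (homOfLE (X.basicOpen_le g)).op g := rfl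
  refine ⟨Fin.snoc (α := fun _ => Γ(X, X.basicOpen g))
    (fun i => X.presheaf.map (homOfLE (X.basicOpen_le g)).op (t i)) ↑u⁻¹, fun f => ?_, ?_⟩
  · obtain ⟨⟨b, ⟨_, n, rfl⟩⟩, hb⟩ := IsLocalization.surj (Submonoid.powers g) f
    obtain ⟨F, rfl⟩ := ht b
    refine ⟨MvPolynomial.rename Fin.castSucc F * MvPolynomial.X (Fin.last s) ^ n, ?_⟩
    rw [map_mul, map_pow, MvPolynomial.coe_eval₂Hom, MvPolynomial.eval₂_rename,
      MvPolynomial.eval₂_X, Fin.snoc_last]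
    have h1 : MvPolynomial.eval₂ (const p (X.basicOpen g))
        ((Fin.snoc (α := fun _ => Γ(X, X.basicOpen g))
          (fun i => X.presheaf.map (homOfLE (X.basicOpen_le g)).op (t i)) ↑u⁻¹) ∘ Fin.castSucc) F =
        algebraMap Γ(X, U) Γ(X, X.basicOpen g) (MvPolynomial.eval₂ (const p U) t F) := by
      rw [MvPolynomial.eval₂_comp_left]
      congr 1
      · ext c; exact (map_const p (X.basicOpen_le g) c).symm
      · funext i; simp [hres]
    rw [h1, ← MvPolynomial.coe_eval₂Hom, ← hb]
    change f * algebraMap Γ(X, U) Γ(X, X.basicOpen g) (g ^ n) * _ = f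
    rw [map_pow, hres, ← hu, mul_assoc, ← mul_pow, Units.mul_inv, one_pow, mul_one]
  · intro L _ _ P hP j
    refine Fin.lastCases (Or.inr ?_) (fun i => Or.inl ⟨i, ?_⟩) j
    · rw [Fin.snoc_last]
      refine eq_inv_of_mul_eq_one_right ?_
      rw [← P.ev_res (X.basicOpen_le g) hP, ← map_mul, ← hu, Units.mul_inv, map_one]
    · rw [Fin.snoc_castSucc, P.ev_res]

/-- The terms of a partition of unity cannot all be small where the `h g` are bounded. The lower
bound for some `g` bounds `g⁻¹`, which is the additional coordinate on the basic open subset of `g`.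
-/
theorem exists_one_le_mul_norm {L A : Type*} [NormedField L] [CommRing A] (ev : A →+* L)
    {F : Finset A} {h : A → A} (hF : ∑ g ∈ F, h g * g = 1) {B : A → ℝ} (hB : ∀ g, ‖ev (h g)‖ ≤ B g) :
    ∃ g ∈ F, 1 ≤ (∑ g ∈ F, B g) * ‖ev g‖ := by
  have h1 : (1 : L) = ∑ g ∈ F, ev (h g) * ev g := by
    rw [← map_one ev, ← hF, map_sum]
    exact Finset.sum_congr rfl fun g _ => map_mul _ _ _
  have hne : F.Nonempty := by
    by_contra hF
    rw [Finset.not_nonempty_iff_eq_empty.1 hF, Finset.sum_empty] at h1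
    exact one_ne_zero h1
  obtain ⟨g, hg, hmax⟩ := F.exists_max_image (fun g => ‖ev g‖) hne
  refine ⟨g, hg, ?_⟩
  calc (1 : ℝ) = ‖∑ g ∈ F, ev (h g) * ev g‖ := by rw [← h1, norm_one]
    _ ≤ ∑ g ∈ F, ‖ev (h g) * ev g‖ := norm_sum_le _ _
    _ ≤ ∑ g' ∈ F, B g' * ‖ev g‖ := Finset.sum_le_sum fun g' hg' => by
      rw [norm_mul]
      exact mul_le_mul (hB g') (hmax g' hg') (norm_nonneg _) ((norm_nonneg _).trans (hB g'))
    _ = _ := (Finset.sum_mul _ _ _).symm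

/-- The ultrametric inequality removes the constant, so coordinates stay integral after passing to a
basic open subset. -/
theorem exists_one_le_norm {L A : Type*} [NormedField L] [IsUltrametricDist L] [CommRing A]
    (ev : A →+* L) {F : Finset A} {h : A → A} (hF : ∑ g ∈ F, h g * g = 1)
    (hB : ∀ g ∈ F, ‖ev (h g)‖ ≤ 1) : ∃ g ∈ F, 1 ≤ ‖ev g‖ := by
  by_contra! H
  have h1 : (1 : L) = ∑ g ∈ F, ev (h g) * ev g := by
    rw [← map_one ev, ← hF, map_sum]
    exact Finset.sum_congr rfl fun g _ => map_mul _ _ _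
  have hne : F.Nonempty := by
    by_contra hF
    rw [Finset.not_nonempty_iff_eq_empty.1 hF, Finset.sum_empty] at h1
    exact one_ne_zero h1
  obtain ⟨g, hg, hmax⟩ := F.exists_max_image (fun g => ‖ev g‖) hne
  have h2 : ‖∑ g ∈ F, ev (h g) * ev g‖ ≤ ‖ev g‖ :=
    IsUltrametricDist.norm_sum_le_of_forall_le_of_nonneg (norm_nonneg _) fun g' hg' => by
      rw [norm_mul]
      exact (mul_le_mul (hB g' hg') (hmax g' hg') (norm_nonneg _) zero_le_one).trans_eq (one_mul _)
  rw [← h1, norm_one] at h2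
  exact absurd (H g hg) (not_lt.2 h2)

/-- A projective variety is covered by finitely many small affine open subsets such that each
point has bounded coordinates in one of them, and integral coordinates at almost all places. -/
theorem IsNice.exists_bounded_cover [NumberField K] (hp : IsNice p) (O : X → X.Opens)
    (hO : ∀ x, x ∈ O x) :
    ∃ (ι : Type u) (_ : Finite ι) (W : ι → X.Opens) (s : ℕ) (g : ∀ a, Fin s → Γ(X, W a)),
      (∀ a, IsAffineOpen (W a)) ∧ (∀ a, ∃ x, W a ≤ O x) ∧ (∀ a, Generates p (W a) (g a)) ∧
      (∀ (L : Type u) [NormedField L] [Algebra K L], ∃ γ : ℝ, ∀ P : Point p L,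
        ∃ (a : ι) (hP : P.pt ∈ W a), ∀ j, ‖P.ev (W a) hP (g a j)‖ ≤ γ) ∧
      ∀ᶠ w : HeightOneSpectrum (𝓞 K) in cofinite, ∀ P : Point p (w.adicCompletion K),
        ∃ (a : ι) (hP : P.pt ∈ W a), ∀ j, ‖P.ev (W a) hP (g a j)‖ ≤ 1 := by
  obtain ⟨N, U, t, hU, hUt, htg, ht1, htb, htc⟩ := hp.exists_charts
  choose F h hFO hF using fun j => exists_partition (hU j) O hO
  choose t' ht' hev using fun (a : Σ j, F j) =>
    exists_generates_basicOpen (hU a.1) (htg a.1) a.2.1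
  -- The functions on the basic open subset of `g` are generated by those of the chart, of norm at
  -- most 1 at `P`, and by `g⁻¹`, of norm at most `C`.
  have key : ∀ (L : Type u) [NormedField L] [Algebra K L] (P : Point p L) (C : ℝ), 0 ≤ C →
      (∀ (j : Fin (N + 1)) (hP : P.pt ∈ U j), (∀ i, ‖P.ev (U j) hP (t i j)‖ ≤ 1) →
        ∃ g ∈ F j, 1 ≤ C * ‖P.ev (U j) hP g‖) →
      ∃ (a : Σ j, F j) (hP : P.pt ∈ X.basicOpen a.2.1), ∀ j,
        ‖P.ev (X.basicOpen a.2.1) hP (t' a j)‖ ≤ max 1 C := by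
    intro L _ _ P C hC hPC
    obtain ⟨j, hj, hj1⟩ := exists_chart_norm_le_one hUt ht1 htb htc P
    obtain ⟨g, hg, hgC⟩ := hPC j hj hj1
    have h0 : P.ev (U j) hj g ≠ 0 := fun h0 => by
      rw [h0, norm_zero, mul_zero] at hgC; exact absurd hgC (by norm_num)
    refine ⟨⟨j, g, hg⟩, (P.mem_basicOpen_iff (U j) hj g).2 h0, fun i => ?_⟩
    rcases hev ⟨j, g, hg⟩ L P ((P.mem_basicOpen_iff (U j) hj g).2 h0) i with ⟨i', hi'⟩ | hi'
    · exact (congrArg norm hi').trans_le ((hj1 i').trans (le_max_left _ _))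
    · refine (congrArg norm hi').trans_le (le_trans ?_ (le_max_right _ _))
      rw [norm_inv, inv_le_iff_one_le_mul₀ (norm_pos_iff.2 h0)]
      exact hgC
  refine ⟨ULift (Σ j, F j), inferInstance, fun a => X.basicOpen a.down.2.1, N + 1 + 1,
    fun a => t' a.down, fun a => (hU _).basicOpen _, fun a => hFO _ _ a.down.2.2,
    fun a => ht' a.down, fun L _ _ => ?_, ?_⟩
  · choose B hB using fun j g => (htg j).exists_norm_ev_le L 1 (h j g)
    let C : Fin (N + 1) → ℝ := fun j => ∑ g ∈ F j, B j g
    refine ⟨max 1 (∑ j, |C j|), fun P => ?_⟩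
    obtain ⟨a, hP, ha⟩ := key L P (∑ j, |C j|) (Finset.sum_nonneg fun _ _ => abs_nonneg _)
      fun j hP hj => by
        obtain ⟨g, hg, h1⟩ := exists_one_le_mul_norm (P.ev (U j) hP) (hF j) (B := B j)
          fun g => hB j g P hP hj
        refine ⟨g, hg, h1.trans (mul_le_mul_of_nonneg_right ?_ (norm_nonneg _))⟩
        exact (le_abs_self _).trans
          (Finset.single_le_sum (f := fun j => |C j|) (fun _ _ => abs_nonneg _) (Finset.mem_univ j))
    exact ⟨⟨a⟩, hP, ha⟩
  · have h1 : ∀ᶠ w : HeightOneSpectrum (𝓞 K) in cofinite, ∀ j, ∀ g ∈ F j,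
        ∀ (P : Point p (w.adicCompletion K)) (hP : P.pt ∈ U j),
          (∀ i, ‖P.ev (U j) hP (t i j)‖ ≤ 1) → ‖P.ev (U j) hP (h j g)‖ ≤ 1 :=
      Filter.eventually_all.2 fun j => (Filter.eventually_all_finset _).2 fun g _ =>
        (htg j).eventually_norm_ev_le _
    filter_upwards [h1] with w hw P
    obtain ⟨a, hP, ha⟩ := key _ P 1 zero_le_one fun j hP hj => by
      simpa using exists_one_le_norm (P.ev (U j) hP) (hF j) fun g hg => hw j g hg P hP hj
    rw [max_self] at ha
    exact ⟨⟨a⟩, hP, ha⟩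

end BoundedCover

end

section

/-! ### Uniform bounds for tangent maps at all places -/

section Comparison

variable {K : Type u} [Field K] {X Y : Scheme.{u}} {p : X ⟶ Spec (.of K)} {q : Y ⟶ Spec (.of K)}

theorem IsNice.isIntegral (hp : IsNice p) : IsIntegral X := by
  have := hp.geometricallyIntegral
  exact GeometricallyIntegral.isIntegral_of_subsingleton p

theorem exists_norm_tangentMap_le_of_finite_cover {L : Type u} [NormedField L] [ProperSpace L]
    [Algebra K L] {NX : TangentBundle p L → ℝ} {NY : TangentBundle q L → ℝ} (hNX : Continuous NX)
    (hNY : Continuous NY) (e : ℕ) (he : e ≠ 0)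
    (hXs : ∀ (P : Point p L) (a : L) (y : Tangent P), NX ⟨P, a • y⟩ = ‖a‖ ^ e * NX ⟨P, y⟩)
    (hYs : ∀ (P : Point q L) (a : L) (y : Tangent P), NY ⟨P, a • y⟩ = ‖a‖ ^ e * NY ⟨P, y⟩)
    (hX0 : ∀ (P : Point p L) (y : Tangent P), y ≠ 0 → 0 < NX ⟨P, y⟩)
    (φ : X ⟶ Y) (hφ : φ ≫ q = p) {ι : Type*} [Finite ι] {W : ι → X.Opens}
    (hW : ∀ a, IsAffineOpen (W a)) {V : ι → Y.Opens} (hV : ∀ a, IsAffineOpen (V a))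
    (hWV : ∀ a, W a ≤ φ ⁻¹ᵁ V a) {s : ℕ} {g : ∀ a, Fin s → Γ(X, W a)}
    (hg : ∀ a, Generates p (W a) (g a))
    (hb : ∃ γ : ℝ, ∀ P : Point p L, ∃ a, ∃ hP : P.pt ∈ W a, ∀ j, ‖P.ev (W a) hP (g a j)‖ ≤ γ) :
    ∃ C : ℝ, 1 ≤ C ∧ ∀ (P : Point p L) (y : Tangent P),
      NY ⟨P.map φ hφ, tangentMap φ hφ P y⟩ ≤ C * NX ⟨P, y⟩ := by
  obtain ⟨γ, hγ⟩ := hb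
  choose C hC using fun a => exists_norm_tangentMap_le hNX hNY e he hXs hYs hX0 φ hφ (hW a) (hV a)
    (hWV a) (hg a) γ
  obtain ⟨B, hB⟩ := Set.Finite.bddAbove (Set.finite_range C)
  refine ⟨max 1 B, le_max_left _ _, fun P y => ?_⟩
  obtain ⟨a, hP, ha⟩ := hγ P
  refine (hC a P hP ha y).trans (mul_le_mul_of_nonneg_right
    ((hB ⟨a, rfl⟩).trans (le_max_right _ _)) ?_)
  by_cases hy : y = 0
  · have h1 := hXs P 0 y
    rw [norm_zero, zero_pow he, zero_mul, zero_smul] at h1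
    rw [hy, h1]
  · exact (hX0 P y hy).le

theorem ev_map_eq {L : Type u} [Field L] [Algebra K L] (φ : X ⟶ Y) (hφ : φ ≫ q = p) {W : X.Opens}
    {V : Y.Opens} (hWV : W ≤ φ ⁻¹ᵁ V) (P : Point p L) (hP : P.pt ∈ W)
    (hP' : (P.map φ hφ).pt ∈ V) (f : Γ(Y, V)) :
    (P.map φ hφ).ev V hP' f = P.ev W hP (φ.appLE V W hWV f) :=
  ((P.ev_res hWV hP (φ.app V f)).trans (Point.ev_map φ hφ P V (hWV hP) f).symm).symm

theorem ev_tangentMap_eq {L : Type u} [Field L] [Algebra K L] (φ : X ⟶ Y) (hφ : φ ≫ q = p)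
    {W : X.Opens} {V : Y.Opens} (hWV : W ≤ φ ⁻¹ᵁ V) {P : Point p L} (y : Tangent P) (hP : P.pt ∈ W)
    (hP' : (P.map φ hφ).pt ∈ V) (f : Γ(Y, V)) :
    Tangent.ev (tangentMap φ hφ P y) V hP' f = Tangent.ev y W hP (φ.appLE V W hWV f) :=
  ((Tangent.ev_res y hWV hP (φ.app V f)).trans
    (Tangent.ev_tangentMap φ hφ y V (hWV hP) f).symm).symm

variable [NumberField K]

/-- The tangent maps of a morphism of nice varieties are uniformly bounded at each place, and
contracting at almost all places. -/
theorem IsNice.exists_norm_tangentMap_le (hX : IsNice p) (hY : IsNice q) (MX : AdelicMetric p)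
    (MY : AdelicMetric q) (φ : X ⟶ Y) (hφ : φ ≫ q = p) :
    ∃ (c : HeightOneSpectrum (𝓞 K) → ℝ) (d : InfinitePlace K → ℝ), (∀ w, 1 ≤ c w) ∧
      (∀ v, 1 ≤ d v) ∧ {w | c w ≠ 1}.Finite ∧
      (∀ (w : HeightOneSpectrum (𝓞 K)) (P : Point p (w.adicCompletion K)) (y : Tangent P),
        MY.finNorm w (P.map φ hφ) (tangentMap φ hφ P y) ≤ c w * MX.finNorm w P y) ∧
      ∀ (v : InfinitePlace K) (P : Point p v.Completion) (y : Tangent P),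
        MY.infNorm v (P.map φ hφ) (tangentMap φ hφ P y) ≤ d v * MX.infNorm v P y := by
  have := hX.isIntegral
  have := hY.isIntegral
  have hXs := hX.smooth
  have hYs := hY.smooth
  choose OX hOX hX' using fun x => MX.exists_nhds_eventually_norm_le_one_iff hX.smooth x
  choose OY hOY hY' using fun y => MY.exists_nhds_eventually_norm_le_one_iff hY.smooth y
  have hV : ∀ x : X, ∃ V : Y.Opens, IsAffineOpen V ∧ φ x ∈ V ∧ V ≤ OY (φ x) := fun x => by
    obtain ⟨_, ⟨V, hV, rfl⟩, h1, h2⟩ :=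
      Y.isBasis_affineOpens.exists_subset_of_mem_open (hOY (φ x)) (OY (φ x)).isOpen
    exact ⟨V, hV, h1, h2⟩
  choose V hV hxV hVO using hV
  -- Each member of the cover is small enough for the metric of `X` to be described by coordinates
  -- at almost all places, and is mapped into an affine open subset of `Y` with the same property.
  obtain ⟨ι, _, W, s, g, hW, hWO, hg, hb, hb'⟩ := hX.exists_bounded_cover
    (fun x => OX x ⊓ φ ⁻¹ᵁ V x) fun x => ⟨hOX x, hxV x⟩
  choose x hx using hWO
  have hWX : ∀ a, W a ≤ OX (x a) := fun a => (hx a).trans inf_le_left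
  have hWV : ∀ a, W a ≤ φ ⁻¹ᵁ V (x a) := fun a => (hx a).trans inf_le_right
  have hfin : ∀ w : HeightOneSpectrum (𝓞 K), ∃ C : ℝ, 1 ≤ C ∧
      ∀ (P : Point p (w.adicCompletion K)) (y : Tangent P),
        MY.finNorm w (P.map φ hφ) (tangentMap φ hφ P y) ≤ C * MX.finNorm w P y := fun w =>
    exists_norm_tangentMap_le_of_finite_cover (MX.continuous_finNorm w) (MY.continuous_finNorm w) 1
      one_ne_zero (fun P a y => by rw [pow_one]; exact (MX.isUltrametricNorm w P).smul a y)
      (fun P a y => by rw [pow_one]; exact (MY.isUltrametricNorm w P).smul a y)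
      (fun P y hy => ((MX.isUltrametricNorm w P).nonneg y).lt_of_ne'
        fun h => hy (((MX.isUltrametricNorm w P).eq_zero_iff y).1 h))
      φ hφ hW (fun a => hV (x a)) hWV hg (hb _)
  have hinf : ∀ v : InfinitePlace K, ∃ C : ℝ, 1 ≤ C ∧
      ∀ (P : Point p v.Completion) (y : Tangent P),
        MY.infNorm v (P.map φ hφ) (tangentMap φ hφ P y) ≤ C * MX.infNorm v P y := fun v =>
    exists_norm_tangentMap_le_of_finite_cover (MX.continuous_infNorm v) (MY.continuous_infNorm v)
      v.mult v.mult_pos.ne' (fun P a y => (MX.isHermitianNorm v P).smul a y)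
      (fun P a y => (MY.isHermitianNorm v P).smul a y)
      (fun P y hy => (MX.isHermitianNorm v P).pos hy) φ hφ hW (fun a => hV (x a)) hWV hg (hb _)
  choose C hC1 hC using hfin
  choose d hd1 hd using hinf
  -- A vector of norm at most 1 takes integral values on the pullbacks of generators of the
  -- functions on `V (x a)`. These are the values of its image on the generators, so the image has
  -- norm at most 1.
  have hev : ∀ a, ∀ᶠ w : HeightOneSpectrum (𝓞 K) in cofinite,
      ∀ (P : Point p (w.adicCompletion K)) (hP : P.pt ∈ W a), (∀ j, ‖P.ev (W a) hP (g a j)‖ ≤ 1) →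
      ∀ y : Tangent P, MX.finNorm w P y ≤ 1 →
        MY.finNorm w (P.map φ hφ) (tangentMap φ hφ P y) ≤ 1 := fun a => by
    by_cases hgen : genericPoint X ∈ W a
    · obtain ⟨s', g', hg'⟩ := exists_generates (p := q) (hV (x a))
      obtain ⟨h1, -⟩ := hX' (x a) (W a) (hW a) (hWX a) hgen s (g a) (hg a)
      obtain ⟨-, h2⟩ := hY' (φ (x a)) (V (x a)) (hV _) (hVO _) (genericPoint_mem (hxV _)) s' g' hg'
      have h3 := Filter.eventually_all.2 fun l => h1 (φ.appLE (V (x a)) (W a) (hWV a) (g' l))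
      have h4 := Filter.eventually_all.2 fun l =>
        (hg a).eventually_norm_ev_le (φ.appLE (V (x a)) (W a) (hWV a) (g' l))
      filter_upwards [h2, h3, h4] with w hw2 hw3 hw4 P hP hPg y hy
      refine hw2 (P.map φ hφ) (hWV a hP) (fun l => ?_) _ fun l => ?_
      · exact (congrArg norm (ev_map_eq φ hφ (hWV a) P hP _ _)).trans_le (hw4 l P hP hPg)
      · exact (congrArg norm (ev_tangentMap_eq φ hφ (hWV a) y hP _ _)).trans_le
          (hw3 l P hP hPg y hy)
    · exact Eventually.of_forall fun w P hP => absurd (genericPoint_mem hP) hgen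
  have hle : ∀ᶠ w : HeightOneSpectrum (𝓞 K) in cofinite,
      ∀ (P : Point p (w.adicCompletion K)) (y : Tangent P),
        MY.finNorm w (P.map φ hφ) (tangentMap φ hφ P y) ≤ MX.finNorm w P y := by
    filter_upwards [hb', Filter.eventually_all.2 hev] with w hw hw' P y
    obtain ⟨a, hP, ha⟩ := hw P
    by_cases hy : y = 0
    · rw [hy, map_zero, (MX.isUltrametricNorm w P).zero, (MY.isUltrametricNorm w _).zero]
    -- Norms take values among the absolute values of scalars, so the inclusion of unit balls gives
    -- the inequality of norms by rescaling `y` to norm 1.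
    · obtain ⟨b, hb0, hb1, hb2⟩ := (MX.isUltrametricNorm w P).exists_smul hy
      have h1 := hw' a P hP ha _ hb2.le
      have h2 : y = b • (b⁻¹ • y) := by rw [smul_smul, mul_inv_cancel₀ hb0, one_smul]
      rw [hb1]
      conv_lhs => rw [h2, map_smul]
      rw [(MY.isUltrametricNorm w _).smul]
      exact mul_le_of_le_one_right (norm_nonneg _) h1
  classical
  -- The constant is exactly 1 wherever the tangent maps contract, so that only finitely many places
  -- contribute to the sum of the logarithms.
  refine ⟨fun w => if ∀ (P : Point p (w.adicCompletion K)) (y : Tangent P),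
      MY.finNorm w (P.map φ hφ) (tangentMap φ hφ P y) ≤ MX.finNorm w P y then 1 else C w, d,
    fun w => ?_, hd1, ?_, fun w P y => ?_, hd⟩
  · dsimp only
    split_ifs
    exacts [le_rfl, hC1 w]
  · refine Set.Finite.subset hle fun w hw h => hw ?_
    exact if_pos h
  · dsimp only
    split_ifs with h
    · rw [one_mul]; exact h P y
    · exact hC w P y

end Comparison

end

section

/-! ### Compatibility of tangent maps with extension of scalars -/

section Transport

variable {K : Type u} [Field K] {X Y : Scheme.{u}} {p : X ⟶ Spec (.of K)} {q : Y ⟶ Spec (.of K)}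
  {L : Type u} [Field L] [Algebra K L]

/-- The tangent spaces at equal points. -/
def Tangent.congr {P P' : Point p L} (h : P = P') : Tangent P →ₗ[L] Tangent P' := by
  subst h
  exact LinearMap.id

theorem Tangent.ev_congr {P P' : Point p L} (h : P = P') (y : Tangent P) (U : X.Opens)
    (hU : P.pt ∈ U) (hU' : P'.pt ∈ U) (f : Γ(X, U)) :
    Tangent.ev (Tangent.congr h y) U hU' f = Tangent.ev y U hU f := by
  subst h
  rfl

theorem Tangent.apply_congr (N : ∀ P : Point p L, Tangent P → ℝ) {P P' : Point p L} (h : P = P')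
    (y : Tangent P) : N P' (Tangent.congr h y) = N P y := by
  subst h
  rfl

theorem Point.map_baseChange (φ : X ⟶ Y) (hφ : φ ≫ q = p) (P : Point p K) (L : Type u) [Field L]
    [Algebra K L] : (P.baseChange L).map φ hφ = (P.map φ hφ).baseChange L :=
  Subtype.ext (Category.assoc _ _ _)

theorem Point.baseChange_self (P : Point p K) : P.baseChange K = P := by
  refine Subtype.ext ?_
  have h : Spec.map (CommRingCat.ofHom (algebraMap K K)) = 𝟙 (Spec (.of K)) :=
    Spec.map_id _
  exact (congrArg (· ≫ P.1) h).trans (Category.id_comp _)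

/-- The base change of the tangent map at a rational point. -/
def tangentMapBaseChange (φ : X ⟶ Y) (hφ : φ ≫ q = p) (P : Point p K) (L : Type u) [Field L]
    [Algebra K L] : Tangent (P.baseChange L) →ₗ[L] Tangent ((P.map φ hφ).baseChange L) :=
  Tangent.congr (P.map_baseChange φ hφ L) ∘ₗ tangentMap φ hφ (P.baseChange L)

theorem tangentMapBaseChange_baseChange (φ : X ⟶ Y) (hφ : φ ≫ q = p) (P : Point p K) (L : Type u)
    [Field L] [Algebra K L] (y : Tangent P) :
    tangentMapBaseChange φ hφ P L (Tangent.baseChange y L) =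
      Tangent.baseChange (tangentMap φ hφ P y) L := by
  refine Tangent.ext_ev fun U hU f => ?_
  have h1 : ((P.baseChange L).map φ hφ).pt ∈ U := by rwa [P.map_baseChange φ hφ L]
  have h2 : (P.map φ hφ).pt ∈ U := by rwa [Point.pt_baseChange] at hU
  refine (Tangent.ev_congr (P.map_baseChange φ hφ L) _ U h1 hU f).trans ?_
  refine (Tangent.ev_tangentMap φ hφ _ U h1 f).trans ?_
  refine (Tangent.ev_baseChange y (φ ⁻¹ᵁ U) h1 h2 (φ.app U f)).trans ?_
  refine (congrArg (algebraMap K L) (Tangent.ev_tangentMap φ hφ y U h2 f).symm).trans ?_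
  exact (Tangent.ev_baseChange (tangentMap φ hφ P y) U hU h2 f).symm

end Transport

/-! ### Comparison of the last slopes -/

section Main

variable {K : Type u} [Field K] [NumberField K] {X Y : Scheme.{u}} {p : X ⟶ Spec (.of K)}
  {q : Y ⟶ Spec (.of K)}

/-- The bounds at the various places depend only on the morphism and on the metrics, hence a single
constant for all rational points. -/
theorem exists_tangentMap_degree_le (hX : IsNice p) (hY : IsNice q) {m n : ℕ}
    (hm : SmoothOfRelativeDimension m p) (hn : SmoothOfRelativeDimension n q)
    (MX : AdelicMetric p) (MY : AdelicMetric q) (φ : X ⟶ Y) (hφ : φ ≫ q = p) :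
    ∃ C : ℝ, 0 ≤ C ∧ ∀ P : Point p K, IsOntoAt φ hφ P →
      ∀ G : Submodule K (Tangent (P.map φ hφ)), G ≠ ⊤ →
        ∃ F : Submodule K (Tangent P), ∃ s : ℕ, 0 < s ∧ Module.finrank K F + s = m ∧
          Module.finrank K G + s = n ∧ MX.degree P ⊤ - MX.degree P F ≤
            MY.degree (P.map φ hφ) ⊤ - MY.degree (P.map φ hφ) G + s * C := by
  have := hX.isIntegral
  have := hY.isIntegral
  obtain ⟨c, d, hc1, hd1, hcfin, hc, hd⟩ := hX.exists_norm_tangentMap_le hY MX MY φ hφ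
  refine ⟨(∑ᶠ w, Real.log (c w)) + ∑ v : InfinitePlace K,
    (Real.log ((n.factorial : ℝ) ^ v.mult) + Real.log (d v)), ?_, fun P hP G hG => ?_⟩
  · refine add_nonneg (finsum_nonneg fun w => Real.log_nonneg (hc1 w))
      (Finset.sum_nonneg fun v _ => add_nonneg (Real.log_nonneg ?_) (Real.log_nonneg (hd1 v)))
    exact one_le_pow₀ (by exact_mod_cast Nat.succ_le_of_lt n.factorial_pos)
  have := finiteDimensional_tangent hm P
  have := finiteDimensional_tangent hn (P.map φ hφ)
  have hc' : ∀ (w : HeightOneSpectrum (𝓞 K)) (y : Tangent (P.baseChange (w.adicCompletion K))),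
      MY.finNorm w _ (tangentMapBaseChange φ hφ P (w.adicCompletion K) y) ≤
        c w * MX.finNorm w _ y := fun w y =>
    (Tangent.apply_congr (MY.finNorm w) (P.map_baseChange φ hφ _) _).trans_le (hc w _ y)
  have hd' : ∀ (v : InfinitePlace K) (y : Tangent (P.baseChange v.Completion)),
      MY.infNorm v _ (tangentMapBaseChange φ hφ P v.Completion y) ≤ d v * MX.infNorm v _ y :=
    fun v y => (Tangent.apply_congr (MY.infNorm v) (P.map_baseChange φ hφ _) _).trans_le (hd v _ y)
  obtain ⟨F, s, hs, h1, h2, h3⟩ := (MX.almostAdapted hX.smooth P).exists_comap_degree_le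
    (MY.almostAdapted hY.smooth (P.map φ hφ)) (tangentMap φ hφ P) hP
    (fun w => tangentMapBaseChange φ hφ P (w.adicCompletion K))
    (fun v => tangentMapBaseChange φ hφ P v.Completion)
    (fun w D => tangentMapBaseChange_baseChange φ hφ P (w.adicCompletion K) D)
    (fun v D => tangentMapBaseChange_baseChange φ hφ P v.Completion D) c d hc1 hd1 hcfin hc' hd' G hG
  rw [finrank_tangent hn (P.map φ hφ)] at h2 h3
  rw [finrank_tangent hm P] at h1
  exact ⟨F, s, hs, h1, h2, h3⟩

/-- Each proper `G` gives a quotient of the same dimension `s` on the side of `X`, whose degree is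
at least `s` times the last slope of `P`. So the last slope of `P` minus `C` is a lower bound for
the slopes of all quotients at the image point. Surjectivity gives `n ≤ m`, whence `0 < m`. The
inequality with the height is the case of the quotient by the zero subspace. -/
theorem exists_slope_le (hX : IsNice p) (hY : IsNice q) {m n : ℕ}
    (hm : SmoothOfRelativeDimension m p) (hn : SmoothOfRelativeDimension n q) (hn0 : 0 < n)
    (MX : AdelicMetric p) (MY : AdelicMetric q) (φ : X ⟶ Y) (hφ : φ ≫ q = p) :
    ∃ C : ℝ, 0 ≤ C ∧ ∀ P : Point p K, IsOntoAt φ hφ P →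
      0 < m ∧ MX.slope P m ≤ MY.slope (P.map φ hφ) n + C ∧
        n * MY.slope (P.map φ hφ) n ≤ MY.height (P.map φ hφ) := by
  have := hX.isIntegral
  have := hY.isIntegral
  obtain ⟨C, hC, hdeg⟩ := exists_tangentMap_degree_le hX hY hm hn MX MY φ hφ
  refine ⟨C, hC, fun P hP => ?_⟩
  have := finiteDimensional_tangent hm P
  have := finiteDimensional_tangent hn (P.map φ hφ)
  have hmP := finrank_tangent hm P
  have hnP := finrank_tangent hn (P.map φ hφ)
  have hAX := MX.almostAdapted hX.smooth P
  have hAY := MY.almostAdapted hY.smooth (P.map φ hφ)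
  have hmn : n ≤ m := by
    have := LinearMap.finrank_le_finrank_of_surjective (f := tangentMap φ hφ P) hP
    rwa [hmP, hnP] at this
  refine ⟨hn0.trans_le hmn, ?_, ?_⟩
  · rw [← sub_le_iff_le_add]
    have h1 := MY.le_slope (P.map φ hφ) hAY.exists_degree_le (hn0.trans_eq hnP.symm)
      (l := MX.slope P m - C) fun G s' hG hs' => ?_
    · rwa [hnP] at h1
    · obtain ⟨F, s, hs, hFs, hGs, hle⟩ := hdeg P hP G hG
      obtain rfl : s' = s := by omega
      have h2 := MX.mul_slope_le P hAX.exists_degree_le F hs (hFs.trans hmP.symm)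
      rw [hmP] at h2
      rw [mul_sub]
      linarith
  · have h1 := MY.mul_slope_le_height (P.map φ hφ) hAY.exists_degree_le hAY.degree_bot
      (hn0.trans_eq hnP.symm)
    rwa [hnP] at h1

theorem AdelicMetric.freeness_nonneg (M : AdelicMetric p) {P : Point p K} {m : ℕ}
    (h : 0 ≤ M.height P) : 0 ≤ M.freeness P m := by
  rw [AdelicMetric.freeness]
  split_ifs <;> positivity

end Main

end

end AdelicSlopes

end

theorem mainTheorem6 {K : Type u} [Field K] [NumberField K] {X Y : Scheme.{u}}
    (p : X ⟶ Spec (.of K)) (q : Y ⟶ Spec (.of K))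
    (hX : AdelicSlopes.IsNice p) (hY : AdelicSlopes.IsNice q)
    (m n : ℕ) (hm : SmoothOfRelativeDimension m p) (hn : SmoothOfRelativeDimension n q)
    (hn0 : 0 < n)
    (MX : AdelicSlopes.AdelicMetric p) (MY : AdelicSlopes.AdelicMetric q)
    (φ : X ⟶ Y) (hφ : φ ≫ q = p) (hdom : IsDominant φ) :
    (∃ C : ℝ, ∀ P : AdelicSlopes.Point p K, AdelicSlopes.IsOntoAt φ hφ P →
      MX.slope P m ≤ MY.slope (P.map φ hφ) n + C ∧
      (0 < MX.height P →
        MX.freeness P m ≤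
          (m * MY.height (P.map φ hφ)) / (n * MX.height P) * MY.freeness (P.map φ hφ) n +
            m * C / MX.height P)) ∧
    ∀ Q : AdelicSlopes.Point q K, AdelicSlopes.IsNonCriticalValue φ hφ Q →
      Tendsto (fun P : {P : AdelicSlopes.Point p K // P.map φ hφ = Q} => MX.freeness P.1 m)
        (comap (fun P => MX.height P.1) atTop) (𝓝 0) := by
  obtain ⟨C, hC, h⟩ := AdelicSlopes.exists_slope_le hX hY hm hn hn0 MX MY φ hφ
  have key : ∀ P : AdelicSlopes.Point p K, AdelicSlopes.IsOntoAt φ hφ P → 0 < MX.height P →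
      MX.freeness P m ≤
        (m * MY.height (P.map φ hφ)) / (n * MX.height P) * MY.freeness (P.map φ hφ) n +
          m * C / MX.height P := fun P hP hh => by
    obtain ⟨hm0, h1, h2⟩ := h P hP
    exact AdelicSlopes.freeness_le hm0 hn0 hC h1 hh h2
  refine ⟨⟨C, fun P hP => ⟨(h P hP).2.1, key P hP⟩⟩, fun Q hQ => ?_⟩
  -- Over `Q` the image point is fixed, so the bound of the first part is a constant divided by the
  -- height of `P`.
  have hlim : Tendsto (fun P : {P : AdelicSlopes.Point p K // P.map φ hφ = Q} =>
      (m * MY.height Q / n * MY.freeness Q n + m * C) / MX.height P.1)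
      (comap (fun P => MX.height P.1) atTop) (𝓝 0) :=
    tendsto_const_nhds.div_atTop tendsto_comap
  have hpos : ∀ᶠ P : {P : AdelicSlopes.Point p K // P.map φ hφ = Q} in
      comap (fun P => MX.height P.1) atTop, 0 < MX.height P.1 :=
    tendsto_comap.eventually (eventually_gt_atTop 0)
  refine tendsto_of_tendsto_of_tendsto_of_le_of_le' tendsto_const_nhds hlim ?_ ?_
  · filter_upwards [hpos] with P hP
    exact MX.freeness_nonneg hP.le
  · filter_upwards [hpos] with P hP
    -- Non-criticality is used for the trivial extension only, with `Q` read as its own base change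
    -- to `K`.
    have h1 := key P.1 (hQ K P.1 (P.2.trans Q.baseChange_self.symm)) hP
    rw [P.2] at h1
    refine h1.trans_eq ?_
    rw [add_div, div_mul_eq_mul_div, div_mul_eq_mul_div, div_div]
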